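/- Let $N\ge 2$, let $S\subset\mathbb R^N$ be a smooth, compact, embedded hypersurface (without boundary) whose Gauss curvature does not vanish at any point, let $\sigma$ be its $(N-1)$-dimensional surface measure, and let $1\le q\le (N+1)/2$. For $f\in L^2(S,d\sigma)$ put $$\mathcal E_Sf(x)=\frac1{(2\pi)^{N/2}}\int_S f(\xi)\,e^{i\xi\cdot x}\,d\sigma(\xi),\qquad x\in\mathbb R^N,$$ and let $T_S=\mathcal E_S(\mathcal E_S)^*$, where $g=(\mathcal E_S)^*h\in L^2(S,d\sigma)$ is determined by $\langle f,g\rangle_{L^2(S)}=\int_{\mathbb R^N}\overline{\mathcal E_Sf}\,h\,dx$ for all $f\in L^2(S,d\sigma)$. For $\alpha\ge1$ let $\mathfrak S^\alpha(L^2(\mathbb R^N))$ be the space of compact operators $T$ on $L^2(\mathbb R^N)$ whose singular values $\mu_n(T)$ (the non-zero eigenvalues of $\sqrt{T^*T}$, counted with multiplicity) satisfy $\|T\|_{\mathfrak S^\alpha}:=(\sum_n\mu_n(T)^\alpha)^{1/\alpha}<\infty$. Then there is a constant $C>0$, depending only on $N$, $S$ and $q$, such that the following two (equivalent) estimates hold.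 (a) For all $W_1,W_2\in L^{2q}(\mathbb R^N,\mathbb C)$, the operator $W_1T_SW_2$ is well defined and bounded on $L^2(\mathbb R^N)$, belongs to $\mathfrak S^{(N-1)q/(N-q)}(L^2(\mathbb R^N))$, and $$\|W_1T_SW_2\|_{\mathfrak S^{(N-1)q/(N-q)}(L^2(\mathbb R^N))}\le C\,\|W_1\|_{L^{2q}(\mathbb R^N)}\|W_2\|_{L^{2q}(\mathbb R^N)}.$$ (b) For every (possibly infinite) orthonormal system $(f_j)_{j\in J}$ in $L^2(S,d\sigma)$ and all coefficients $(\nu_j)_{j\in J}\subset\mathbb C$ for which the right-hand side below is finite, the series $\sum_j\nu_j|\mathcal E_Sf_j|^2$ converges absolutely almost everywhere on $\mathbb R^N$, and, with $q'=q/(q-1)$, $$\Big\|\sum_j\nu_j|\mathcal E_Sf_j|^2\Big\|_{L^{q'}(\mathbb R^N)}\le C\Big(\sum_j|\nu_j|^{\frac{(N-1)q}{N(q-1)}}\Big)^{\frac{N(q-1)}{(N-1)q}}.$$ For $q=1$ this is read with $q'=\infty$ and right-hand side $C\sup_j|\nu_j|$. -/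

import Mathlib

open MeasureTheory Filter
open scoped ENNReal ContDiff InnerProductSpace

noncomputable section

namespace OrthoRestriction

/-- Euclidean space `ℝ^N`. -/
abbrev Eucl (N : ℕ) : Type := EuclideanSpace ℝ (Fin N)

/-! ### Smooth hypersurfaces and Gauss curvature -/

/-- `ρ` is a smooth local defining function of `S` near `p`: on some open neighbourhood `U` of `p`
it is smooth and `S ∩ U` is its zero set, and `dρ(p) ≠ 0`. -/
def IsLocalDefiningFunction {N : ℕ} (S : Set (Eucl N)) (p : Eucl N) (ρ : Eucl N → ℝ) : Prop :=
  ∃ U : Set (Eucl N), IsOpen U ∧ p ∈ U ∧ ContDiffOn ℝ ∞ ρ U ∧ gradient ρ p ≠ 0 ∧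
    S ∩ U = {x ∈ U | ρ x = 0}

/-- `S` is a smooth embedded hypersurface (without boundary) of `ℝ^N`. -/
def IsSmoothHypersurface {N : ℕ} (S : Set (Eucl N)) : Prop :=
  ∀ p ∈ S, ∃ ρ : Eucl N → ℝ, IsLocalDefiningFunction S p ρ

/-- The unit normal field `∇ρ / |∇ρ|` of the level sets of `ρ`. -/
def unitNormal {N : ℕ} (ρ : Eucl N → ℝ) (x : Eucl N) : Eucl N :=
  ‖gradient ρ x‖⁻¹ • gradient ρ x

/-- The tangent space at `p` of the hypersurface `{ρ = 0}`, the orthogonal complement of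
`∇ρ(p)`. -/
def tangentAt {N : ℕ} (ρ : Eucl N → ℝ) (p : Eucl N) : Submodule ℝ (Eucl N) :=
  (Submodule.span ℝ {gradient ρ p})ᗮ

/-- The shape operator (Weingarten map) `v ↦ -D_v ν` on the tangent space at `p`, where `ν` is the
unit normal. The derivative `D_v ν` of the unit field `ν` is tangential, so the orthogonal
projection onto the tangent space only serves to record this in the codomain. -/
def shapeOperator {N : ℕ} (ρ : Eucl N → ℝ) (p : Eucl N) :
    tangentAt ρ p →ₗ[ℝ] tangentAt ρ p :=
  -(((tangentAt ρ p).orthogonalProjectionOnto ∘L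
    (fderiv ℝ (unitNormal ρ) p ∘L (tangentAt ρ p).subtypeL)) :
      tangentAt ρ p →L[ℝ] tangentAt ρ p).toLinearMap

/-- The Gauss curvature at `p`, the determinant of the shape operator (it is independent of the
local defining function up to the sign which comes from the choice of the unit normal). -/
def gaussCurvature {N : ℕ} (ρ : Eucl N → ℝ) (p : Eucl N) : ℝ :=
  LinearMap.det (shapeOperator ρ p)

/-- The Gauss curvature of the hypersurface `S` does not vanish at any point of `S`. -/
def HasNonzeroGaussCurvature {N : ℕ} (S : Set (Eucl N)) : Prop :=
  ∀ p ∈ S, ∃ ρ : Eucl N → ℝ, IsLocalDefiningFunction S p ρ ∧ gaussCurvature ρ p ≠ 0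

/-- The `(N-1)`-dimensional surface measure `dσ` of `S`, as a measure on `ℝ^N` carried by `S`:
the `(N-1)`-dimensional Hausdorff measure, normalised to agree with Lebesgue measure on
`(N-1)`-planes. -/
def surfaceMeasure {N : ℕ} (S : Set (Eucl N)) : Measure (Eucl N) :=
  (Measure.euclideanHausdorffMeasure (N - 1) : Measure (Eucl N)).restrict S

/-- The Hilbert space `L²(S, dσ)`. -/
abbrev L2Surface {N : ℕ} (S : Set (Eucl N)) : Type := Lp ℂ 2 (surfaceMeasure S)

/-- The Hilbert space `L²(ℝ^N)`. -/
abbrev L2Space (N : ℕ) : Type := Lp ℂ 2 (volume : Measure (Eucl N))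

/-! ### The extension operator, its adjoint, and `W₁ T_S W₂` -/

/-- The extension operator
`(E_S f)(x) = (2π)^(-N/2) ∫_S f(ξ) e^{i ξ·x} dσ(ξ)`. -/
def extensionOp {N : ℕ} (S : Set (Eucl N)) (f : Eucl N → ℂ) (x : Eucl N) : ℂ :=
  (((2 * Real.pi) ^ ((N : ℝ) / 2) : ℝ) : ℂ)⁻¹ *
    ∫ ξ, f ξ * Complex.exp (Complex.I * ((⟪ξ, x⟫_ℝ : ℝ) : ℂ)) ∂(surfaceMeasure S)

/-- `(E_S)^* h = g`: the function `h` on `ℝ^N` lies in the domain of the adjoint of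
`E_S` and its image is `g ∈ L²(S)`, that is, `⟨f, g⟩_{L²(S)} = ∫ conj(E_S f) h` for
all `f ∈ L²(S)`. Such a `g` is unique. -/
def IsExtensionAdjoint {N : ℕ} (S : Set (Eucl N)) (h : Eucl N → ℂ) (g : L2Surface S) : Prop :=
  ∀ f : L2Surface S,
    Integrable (fun x => (starRingEnd ℂ) (extensionOp S f x) * h x) volume ∧
    ⟪f, g⟫_ℂ = ∫ x, (starRingEnd ℂ) (extensionOp S f x) * h x

/-- The bounded operator `B` on `L²(ℝ^N)` is `W₁ T_S W₂`, where `T_S = E_S (E_S)^*`: for every `v`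
in `L²(ℝ^N)`, `(E_S)^*(W₂ v)` is defined in `L²(S)` and `B v = W₁ E_S((E_S)^*(W₂ v))`.
There is at most one such `B`. -/
def IsWTSW {N : ℕ} (S : Set (Eucl N)) (W₁ W₂ : Eucl N → ℂ) (B : L2Space N →L[ℂ] L2Space N) :
    Prop :=
  ∀ v : L2Space N, ∃ g : L2Surface S,
    IsExtensionAdjoint S (fun x => W₂ x * v x) g ∧
    (B v : Eucl N → ℂ) =ᵐ[volume] fun x => W₁ x * extensionOp S g x

/-! ### Schatten classes -/

section Schatten

variable {H : Type*} [NormedAddCommGroup H] [InnerProductSpace ℂ H] [CompleteSpace H]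

/-- The multiplicity of `s` as an eigenvalue of `|T| = √(T^* T)`. -/
def singularMultiplicity (T : H →L[ℂ] H) (s : ℝ) : ℕ∞ :=
  Cardinal.toENat (Module.rank ℂ
    (Module.End.eigenspace ((CFC.abs T : H →L[ℂ] H) : H →ₗ[ℂ] H) (s : ℂ)))

/-- The sum `∑ μ_n(T)^α` over the singular values of `T` (the non-zero eigenvalues of
`√(T^* T)`), counted with multiplicity. -/
def schattenSum (α : ℝ) (T : H →L[ℂ] H) : ℝ≥0∞ :=
  ∑' s : {s : ℝ // 0 < s}, (singularMultiplicity T s : ℝ≥0∞) * ENNReal.ofReal ((s : ℝ) ^ α)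

/-- `T` belongs to the Schatten class of exponent `α`: it is compact and its singular values are
in `ℓ^α`. -/
def MemSchatten (α : ℝ) (T : H →L[ℂ] H) : Prop :=
  IsCompactOperator T ∧ schattenSum α T < ⊤

/-- The Schatten norm of exponent `α`. -/
def schattenNorm (α : ℝ) (T : H →L[ℂ] H) : ℝ≥0∞ :=
  schattenSum α T ^ (1 / α)

end Schatten

/-! ### Sequence norms -/

/-- The `ℓ^β` norm `(∑ |ν_j|^β)^(1/β)` of a family of complex numbers, which is `sup |ν_j|` for
`β = ∞`. -/
def seqNorm {J : Type*} (β : ℝ≥0∞) (ν : J → ℂ) : ℝ≥0∞ :=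
  if β = ⊤ then ⨆ j, ‖ν j‖ₑ else (∑' j, ‖ν j‖ₑ ^ β.toReal) ^ (1 / β.toReal)

end OrthoRestriction

end

universe u

open OrthoRestriction

/-! The endpoint `q = (N+1)/2` follows from Stein's complex interpolation, carried out on sums over
orthonormal systems. Hölder with the elementary case `q = 1` then gives the whole range.

The working notion is `EnergyBound`, a Schatten bound for `A† A` expressed without singular values.
It passes to adjoints (`EnergyBound.adjoint`) and forces compactness
(`EnergyBound.isCompactOperator`). By Hölder it is interchangeable, for `0 < γ < 1`, with a weighted
estimate `∑ tⱼ^γ ‖A uⱼ‖² ≤ D (∑ tⱼ)^γ`, where `α = 1/(1-γ)` (`energyBound_of_weighted`,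
`EnergyBound.weighted`). The weighted form is what interpolation produces.

The geometric input is decay. Locally `S` is a graph over its tangent plane, and nonzero curvature
makes the Hessian of the graph function injective. Its gradient then expands distances, and the
Fourier transform of a smoothly cut-off piece is `O((1+|⟪ν,x⟫|)^(-(N-1)/2))`, uniformly in the
tangential component of `x` (`exists_oscillatory_decay`, `exists_graphPatch`).

For one patch, let `K` be this Fourier transform, `τ = ⟪ν, x-y⟫` and `b = (N+1)/2`. Consider the
kernels `(W(x) W(y) (1+iτ))^(bz) K(x-y) / (1+iτ)`, which at `z = 1/b` reduce to `W(x) K(x-y) W(y)`.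
On `Re z = 0` the power `(1+iτ)^(-1-iσ)` is a Laplace transform of `t^(iσ) e^(-t)` up to a Gamma
factor. The kernel thus becomes the Fourier transform of a bounded density on `ℝ^N`, and Plancherel
gives an `L²` bound (`GraphPatch.exists_form_bound`). On `Re z = 1` the decay of `K` cancels the
growth `|1+iτ|^(b-1)`, so the kernel is Hilbert–Schmidt, controlled by `∫ W^(N+1)`. The three lines
theorem yields `GraphPatch.exists_weighted_bound`, an estimate for the adjoint of `W E_S`. Passing
to the operator itself and choosing `W` as a power of the density `∑ tⱼ^γ |E_S fⱼ|²` gives the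
endpoint (`exists_endpoint_bound`).

At `q = 1` the bound is Bessel's inequality for evaluation at a point. A pointwise Hölder inequality
between the two ends gives `exists_finite_bound`, and monotone convergence gives (b). For (a), the
finite bound becomes an energy bound for `W E_S` (`exists_mulExt_energyBound`), the operator factors
as `(W₁ E_S)(W̄₂ E_S)†`, and its singular values are recovered from pairs of orthonormal systems
(`schattenSum_le`). -/

noncomputable section

namespace OrthoRestriction

/-! ### Energy bounds: duality and compactness -/

section Abstract

variable {H₁ : Type*} [NormedAddCommGroup H₁] [InnerProductSpace ℂ H₁]
variable {H₂ : Type*} [NormedAddCommGroup H₂] [InnerProductSpace ℂ H₂]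

/-- `∑ ‖A uⱼ‖ ^ (2α) ≤ M` for all finite orthonormal systems `(uⱼ)`. This says that `A† A` lies in
the Schatten class of exponent `α`. -/
def EnergyBound (α M : ℝ) (A : H₁ →L[ℂ] H₂) : Prop :=
  ∀ (n : ℕ) (u : Fin n → H₁), Orthonormal ℂ u → ∑ j, ‖A (u j)‖ ^ (2 * α) ≤ M

lemma EnergyBound.sum_le {α M : ℝ} {A : H₁ →L[ℂ] H₂} (h : EnergyBound α M A) {ι : Type*}
    [Fintype ι] {u : ι → H₁} (hu : Orthonormal ℂ u) : ∑ j, ‖A (u j)‖ ^ (2 * α) ≤ M := by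
  have e := Fintype.equivFin ι
  have := h _ (u ∘ e.symm) (hu.comp _ e.symm.injective)
  rwa [← e.symm.sum_comp (fun j => ‖A (u j)‖ ^ (2 * α))]

lemma norm_sq_rpow {x : ℝ} (hx : 0 ≤ x) (α : ℝ) : (x ^ 2) ^ α = x ^ (2 * α) := by
  rw [Real.rpow_mul hx, Real.rpow_two]

/-- The energy bound passes to the adjoint. -/
theorem EnergyBound.adjoint [CompleteSpace H₁] [CompleteSpace H₂] {α M : ℝ} (hα : 1 ≤ α) {A : H₁ →L[ℂ] H₂} (h : EnergyBound α M A) :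
    EnergyBound α M (ContinuousLinearMap.adjoint A) := by
  intro n v hv
  -- Compress `A A†` to the span of the `v j` and take an orthonormal eigenbasis `g`. The vectors
  -- `A† (g i)` are then orthogonal, so after normalisation they form a system to which the
  -- hypothesis on `A` applies.
  set V : Submodule ℂ H₂ := Submodule.span ℂ (Set.range v) with hV
  have : FiniteDimensional ℂ V := FiniteDimensional.span_of_finite ℂ (Set.finite_range v)
  have : CompleteSpace V := FiniteDimensional.complete ℂ V
  set L : V →L[ℂ] H₁ := (ContinuousLinearMap.adjoint A) ∘L V.subtypeL with hL
  set T : V →L[ℂ] V := (ContinuousLinearMap.adjoint L) ∘L L with hT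
  have hTin : ∀ x y : V, ⟪x, T y⟫_ℂ = ⟪L x, L y⟫_ℂ := fun x y => by
    simp [hT, ContinuousLinearMap.adjoint_inner_right]
  have hsym : (T : V →ₗ[ℂ] V).IsSymmetric := by
    intro x y
    have h1 : ⟪T x, y⟫_ℂ = ⟪L x, L y⟫_ℂ := by
      simp [hT, ContinuousLinearMap.adjoint_inner_left]
    exact h1.trans (hTin x y).symm
  set g := hsym.eigenvectorBasis rfl with hg
  set s := hsym.eigenvalues rfl with hs
  have hTg : ∀ i, T (g i) = (s i : ℂ) • g i := fun i => hsym.apply_eigenvectorBasis rfl i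
  have hLL : ∀ i k, ⟪L (g i), L (g k)⟫_ℂ = if i = k then (s k : ℂ) else 0 := by
    intro i k
    rw [← hTin, hTg, inner_smul_right, orthonormal_iff_ite.1 g.orthonormal i k]
    split_ifs <;> simp
  have hsn : ∀ i, s i = ‖L (g i)‖ ^ 2 := by
    intro i
    have := hLL i i
    rw [inner_self_eq_norm_sq_to_K, if_pos rfl] at this
    exact (Complex.ofReal_injective (by simpa using this)).symm
  have hs0 : ∀ i, 0 ≤ s i := fun i => by rw [hsn i]; positivity
  -- the sum of the eigenvalues
  have hsum : ∑ i, s i ^ α ≤ M := by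
    let I := {i // 0 < s i}
    let f : I → H₁ := fun i => ((Real.sqrt (s i))⁻¹ : ℂ) • L (g i)
    have hf : Orthonormal ℂ f := by
      classical
      rw [orthonormal_iff_ite]
      intro i k
      by_cases hik : i = k
      · subst hik
        have h1 : (Real.sqrt (s i) : ℂ) * Real.sqrt (s i) = s i := by
          rw [← Complex.ofReal_mul, Real.mul_self_sqrt (hs0 _)]
        have h2 : (Real.sqrt (s i) : ℂ) ≠ 0 := by
          simpa using (Real.sqrt_pos.2 i.2).ne'
        simp only [f, inner_smul_left, inner_smul_right, hLL, if_pos]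
        rw [← h1]
        simp only [map_inv₀, Complex.conj_ofReal]
        field_simp
      · have hik' : i.1 ≠ k.1 := fun h => hik (Subtype.ext h)
        simp [f, inner_smul_left, inner_smul_right, hLL, hik, hik']
    have key : ∀ i : I, s i ^ α ≤ ‖A (f i)‖ ^ (2 * α) := by
      intro i
      -- The component of `A (f i)` along `g i` already has the size required.
      have h1 : ⟪((g i : V) : H₂), A (f i)⟫_ℂ = Real.sqrt (s i) := by
        rw [← ContinuousLinearMap.adjoint_inner_left]
        change ⟪L (g i), f i⟫_ℂ = _
        simp only [f, inner_smul_right, hLL, if_pos]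
        have h2 : (Real.sqrt (s i) : ℂ) ≠ 0 := by
          simpa using (Real.sqrt_pos.2 i.2).ne'
        have h1 : (Real.sqrt (s i) : ℂ) * Real.sqrt (s i) = s i := by
          rw [← Complex.ofReal_mul, Real.mul_self_sqrt (hs0 _)]
        rw [← h1]
        field_simp
      have h3 : Real.sqrt (s i) ≤ ‖A (f i)‖ := by
        have := norm_inner_le_norm (𝕜 := ℂ) ((g i : V) : H₂) (A (f i))
        rw [h1] at this
        have h4 : ‖((g i : V) : H₂)‖ = 1 := by
          rw [← Submodule.coe_norm]; exact g.orthonormal.1 i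
        simpa [h4, abs_of_nonneg (Real.sqrt_nonneg _)] using this
      calc s i ^ α = (Real.sqrt (s i)) ^ (2 * α) := by
            rw [← norm_sq_rpow (Real.sqrt_nonneg _), Real.sq_sqrt (hs0 _)]
        _ ≤ _ := Real.rpow_le_rpow (Real.sqrt_nonneg _) h3 (by linarith)
    calc ∑ i, s i ^ α = ∑ i ∈ Finset.univ.filter (fun i => 0 < s i), s i ^ α := by
          rw [Finset.sum_filter]
          refine Finset.sum_congr rfl fun i _ => ?_
          split_ifs with hi
          · rfl
          · rw [le_antisymm (not_lt.1 hi) (hs0 i), Real.zero_rpow (by linarith)]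
      _ = ∑ i : I, s i ^ α := by
          rw [← Finset.sum_subtype_eq_sum_filter]; simp [I, Finset.subtype_univ]
      _ ≤ ∑ i : I, ‖A (f i)‖ ^ (2 * α) := Finset.sum_le_sum fun i _ => key i
      _ ≤ M := h.sum_le hf
  let v' : Fin n → V := fun j => ⟨v j, Submodule.subset_span ⟨j, rfl⟩⟩
  have hv' : Orthonormal ℂ v' := by
    rw [orthonormal_iff_ite] at hv ⊢
    exact hv
  have hexp : ∀ j, ‖(ContinuousLinearMap.adjoint A) (v j)‖ ^ 2
      = ∑ i, ‖⟪g i, v' j⟫_ℂ‖ ^ 2 * s i := by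
    intro j
    have h1 : ((‖L (v' j)‖ ^ 2 : ℝ) : ℂ) = ⟪v' j, T (v' j)⟫_ℂ := by
      rw [hTin, inner_self_eq_norm_sq_to_K]; norm_cast
    rw [← g.sum_inner_mul_inner] at h1
    have h2 : ∀ i, ⟪v' j, g i⟫_ℂ * ⟪g i, T (v' j)⟫_ℂ = ((‖⟪g i, v' j⟫_ℂ‖ ^ 2 * s i : ℝ) : ℂ) := by
      intro i
      have h3 : ⟪g i, T (v' j)⟫_ℂ = (s i : ℂ) * ⟪g i, v' j⟫_ℂ := by
        rw [← show ⟪T (g i), v' j⟫_ℂ = ⟪g i, T (v' j)⟫_ℂ from hsym _ _, hTg, inner_smul_left]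
        simp
      rw [h3, ← inner_conj_symm (v' j) (g i)]
      push_cast
      rw [← Complex.conj_mul']
      ring
    rw [Finset.sum_congr rfl fun i _ => h2 i, ← Complex.ofReal_sum] at h1
    exact_mod_cast h1
  calc ∑ j, ‖(ContinuousLinearMap.adjoint A) (v j)‖ ^ (2 * α)
      = ∑ j, (∑ i, ‖⟪g i, v' j⟫_ℂ‖ ^ 2 * s i) ^ α := by
        refine Finset.sum_congr rfl fun j _ => ?_
        rw [← hexp, norm_sq_rpow (norm_nonneg _)]
    -- Jensen for the convex power `α ≥ 1`: for fixed `j` the weights sum to one, since `g` is an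
    -- orthonormal basis of `V`. The sum over `j` is then handled by Bessel.
    _ ≤ ∑ j, ∑ i, ‖⟪g i, v' j⟫_ℂ‖ ^ 2 * s i ^ α := by
        refine Finset.sum_le_sum fun j _ => ?_
        refine Real.rpow_arith_mean_le_arith_mean_rpow _ _ _ (fun i _ => by positivity) ?_
          (fun i _ => hs0 i) hα
        rw [g.sum_sq_norm_inner_right, hv'.1 j, one_pow]
    _ = ∑ i, (∑ j, ‖⟪v' j, g i⟫_ℂ‖ ^ 2) * s i ^ α := by
        rw [Finset.sum_comm]
        simp_rw [Finset.sum_mul, norm_inner_symm]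
    _ ≤ ∑ i, s i ^ α := by
        refine Finset.sum_le_sum fun i _ => ?_
        have h1 : ∑ j, ‖⟪v' j, g i⟫_ℂ‖ ^ 2 ≤ 1 := by
          simpa [g.orthonormal.1 i] using hv'.sum_inner_products_le (g i) (s := Finset.univ)
        exact mul_le_of_le_one_left (Real.rpow_nonneg (hs0 i) _) h1
    _ ≤ M := hsum

/-- An operator satisfying an energy bound is compact. -/
theorem EnergyBound.isCompactOperator [CompleteSpace H₂] {α M : ℝ} (hα : 0 ≤ α) {A : H₁ →L[ℂ] H₂}
    (h : EnergyBound α M A) : IsCompactOperator A := by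
  have key : ∀ ε : ℝ, 0 < ε → ∃ F : H₁ →L[ℂ] H₂, IsCompactOperator F ∧ ‖A - F‖ ≤ ε := by
    intro ε hε
    -- the cardinality of orthonormal systems on which `A` is at least `ε` is bounded
    let P : ℕ → Prop := fun n => ∃ u : Fin n → H₁, Orthonormal ℂ u ∧ ∀ j, ε ≤ ‖A (u j)‖
    have hP0 : P 0 := ⟨Fin.elim0, ⟨fun i => i.elim0, fun i => i.elim0⟩, fun i => i.elim0⟩
    have hbd : ∀ n, P n → n ≤ ⌈M / ε ^ (2 * α)⌉₊ := by
      rintro n ⟨u, hu, hlow⟩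
      have h1 := h n u hu
      have h2 : (n : ℝ) * ε ^ (2 * α) ≤ M := by
        calc (n : ℝ) * ε ^ (2 * α) = ∑ j : Fin n, ε ^ (2 * α) := by simp
          _ ≤ _ := (Finset.sum_le_sum fun j _ => Real.rpow_le_rpow hε.le (hlow j) (by positivity)).trans h1
      have h3 : (n : ℝ) ≤ M / ε ^ (2 * α) := by
        rwa [le_div_iff₀ (by positivity)]
      exact_mod_cast h3.trans (Nat.le_ceil _)
    classical
    -- Take such a system of maximal size. A unit vector orthogonal to its span with image of norm
    -- at least `ε` could be adjoined, so `A` is within `ε` of its composition with the projection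
    -- onto that span.
    obtain ⟨n, hn⟩ : ∃ n, n = Nat.findGreatest P ⌈M / ε ^ (2 * α)⌉₊ := ⟨_, rfl⟩
    have hPn : P n := hn ▸ Nat.findGreatest_spec (P := P) (Nat.zero_le _) hP0
    obtain ⟨u, hu, hlow⟩ := hPn
    set V : Submodule ℂ H₁ := Submodule.span ℂ (Set.range u) with hV
    have : FiniteDimensional ℂ V := FiniteDimensional.span_of_finite ℂ (Set.finite_range u)
    refine ⟨A ∘L (V.subtypeL ∘L V.orthogonalProjectionOnto), ?_, ?_⟩
    · have : ProperSpace V := FiniteDimensional.proper ℂ V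
      exact (isCompactOperator_of_locallyCompactSpace_rng (A ∘L V.subtypeL)).comp_clm
        V.orthogonalProjectionOnto
    · refine ContinuousLinearMap.opNorm_le_bound _ hε.le fun x => ?_
      set y : H₁ := x - V.orthogonalProjectionOnto x with hy
      have hyV : y ∈ Vᗮ := V.sub_starProjection_mem_orthogonal x
      have hyn : ‖y‖ ≤ ‖x‖ := by
        have h1 := norm_add_sq_eq_norm_sq_add_norm_sq_of_inner_eq_zero (𝕜 := ℂ) (V.starProjection x) y
          ((Submodule.mem_orthogonal _ _).1 hyV _ (V.starProjection_apply_mem x))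
        have h2 : V.starProjection x + y = x :=
          add_sub_cancel _ _
        rw [h2] at h1
        nlinarith [norm_nonneg x, norm_nonneg y, mul_self_nonneg ‖V.starProjection x‖]
      have hAy : (A - A ∘L (V.subtypeL ∘L V.orthogonalProjectionOnto)) x = A y := by
        simp [hy]
      rw [hAy]
      refine le_trans ?_ (mul_le_mul_of_nonneg_left hyn hε.le)
      by_contra! hcon
      have hy0 : 0 < ‖y‖ := by
        rw [norm_pos_iff]
        rintro h0
        simp [h0] at hcon
      have hPn : P (n + 1) := by
        refine ⟨Fin.snoc u ((‖y‖⁻¹ : ℂ) • y), ?_, ?_⟩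
        · have hnorm : ‖(‖y‖⁻¹ : ℂ) • y‖ = 1 := by
            rw [norm_smul]; simp [hy0.ne']
          have hort : ∀ i, ⟪u i, y⟫_ℂ = 0 := fun i =>
            (Submodule.mem_orthogonal _ _).1 hyV _ (Submodule.subset_span ⟨i, rfl⟩)
          have hort' : ∀ i, ⟪y, u i⟫_ℂ = 0 := fun i => by
            rw [← inner_conj_symm, hort, map_zero]
          refine ⟨fun i => ?_, fun i j hij => ?_⟩
          · refine Fin.lastCases ?_ (fun i => ?_) i
            · simpa using hnorm
            · simpa using hu.1 i
          · revert hij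
            refine Fin.lastCases ?_ (fun i => ?_) i <;> refine Fin.lastCases ?_ (fun j => ?_) j
            · simp
            · simp [inner_smul_left, hort']
            · simp [inner_smul_right, hort]
            · intro hij
              simpa using hu.2 (i := i) (j := j) (fun h => hij (by rw [h]))
        · intro i
          refine Fin.lastCases ?_ (fun i => ?_) i
          · have : ε ≤ ‖y‖⁻¹ * ‖A y‖ := by
              rw [inv_mul_eq_div, le_div_iff₀ hy0]; exact hcon.le
            simpa [norm_smul] using this
          · simpa using hlow i
      have := Nat.le_findGreatest (hbd _ hPn) hPn
      omega
  choose F hF hFA using fun k : ℕ => key (1 / (k + 1 : ℝ)) (by positivity)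
  refine isCompactOperator_of_tendsto (F := F) (l := atTop) ?_ (Eventually.of_forall hF)
  rw [tendsto_iff_norm_sub_tendsto_zero]
  refine squeeze_zero (fun _ => norm_nonneg _) (fun k => ?_) tendsto_one_div_add_atTop_nhds_zero_nat
  rw [norm_sub_rev]
  exact hFA k

end Abstract

/-! ### Singular values from pairs of orthonormal systems -/

section Singular

variable {H : Type*} [NormedAddCommGroup H] [InnerProductSpace ℂ H] [CompleteSpace H]

/-- Both sides equal `⟪x, B† B y⟫`. This replaces the polar decomposition: `|B| x ↦ B x` preserves
inner products. -/
lemma inner_apply_apply_eq_inner_abs (B : H →L[ℂ] H) (x y : H) :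
    ⟪B x, B y⟫_ℂ = ⟪(CFC.abs B) x, (CFC.abs B) y⟫_ℂ := by
  have h1 : IsSelfAdjoint (CFC.abs B) := IsSelfAdjoint.of_nonneg (CFC.abs_nonneg B)
  rw [← ContinuousLinearMap.adjoint_inner_right, ← ContinuousLinearMap.adjoint_inner_right]
  have h2 := congrArg (fun T : H →L[ℂ] H => T y) (CFC.abs_mul_abs B)
  have h3 : ContinuousLinearMap.adjoint (CFC.abs B) = CFC.abs B := h1
  rw [h3]
  exact congrArg _ h2.symm

/-- Gram–Schmidt. Infinite rank is allowed, so multiplicities can be tested before they are known to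
be finite. -/
lemma exists_orthonormal_fin_of_le_rank {V : Type*} [NormedAddCommGroup V] [InnerProductSpace ℂ V]
    {m : ℕ} (h : (m : ℕ∞) ≤ Cardinal.toENat (Module.rank ℂ V)) :
    ∃ e : Fin m → V, Orthonormal ℂ e := by
  obtain ⟨s, hs, hli⟩ := le_rank_iff_exists_linearIndependent_finset.1
    (Cardinal.natCast_le_toENat.1 h)
  have e := (Finset.equivFinOfCardEq hs).symm
  exact ⟨_, InnerProductSpace.gramSchmidtNormed_orthonormal (hli.comp e e.injective)⟩

/-- The sum of the powers of the singular values is controlled by the diagonal matrix elements with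
respect to pairs of orthonormal systems. -/
theorem schattenSum_le {α M : ℝ} (B : H →L[ℂ] H)
    (hM : ∀ (n : ℕ) (u v : Fin n → H), Orthonormal ℂ u → Orthonormal ℂ v →
      ∑ i, ‖⟪v i, B (u i)⟫_ℂ‖ ^ α ≤ M) :
    schattenSum α B ≤ ENNReal.ofReal M := by
  classical
  have hsym : ((CFC.abs B : H →L[ℂ] H) : H →ₗ[ℂ] H).IsSymmetric :=
    ContinuousLinearMap.isSelfAdjoint_iff_isSymmetric.1
      (IsSelfAdjoint.of_nonneg (CFC.abs_nonneg B))
  -- The integers `m s` stay free below the multiplicities. Taking a single `s` and `m s` large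
  -- excludes infinite multiplicity.
  have fin : ∀ (F : Finset {s : ℝ // 0 < s}) (m : {s : ℝ // 0 < s} → ℕ),
      (∀ s ∈ F, (m s : ℕ∞) ≤ singularMultiplicity B s) →
      ∑ s ∈ F, (m s : ℝ) * (s : ℝ) ^ α ≤ M := by
    intro F m hm
    have := fun s : F => exists_orthonormal_fin_of_le_rank (hm s s.2)
    choose e he using this
    have hfam : OrthogonalFamily ℂ
        (fun s : F => Module.End.eigenspace ((CFC.abs B : H →L[ℂ] H) : H →ₗ[ℂ] H) ((s : ℝ) : ℂ))
        (fun s => (Module.End.eigenspace ((CFC.abs B : H →L[ℂ] H) : H →ₗ[ℂ] H)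
          ((s : ℝ) : ℂ)).subtypeₗᵢ) :=
      hsym.orthogonalFamily_eigenspaces.comp (γ := F) (f := fun s => ((s : ℝ) : ℂ))
        (fun a b hab => Subtype.ext (Subtype.ext (Complex.ofReal_injective hab)))
    have hon := hfam.orthonormal_sigma_orthonormal he
    set u : (Σ s : F, Fin (m s)) → H := fun a => (e a.1 a.2 : H) with hu
    have hon' : Orthonormal ℂ u := hon
    have habs : ∀ a, (CFC.abs B) (u a) = ((a.1 : ℝ) : ℂ) • u a := fun a =>
      Module.End.mem_eigenspace_iff.1 (e a.1 a.2).2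
    have hpos : ∀ a : (Σ s : F, Fin (m s)), ((a.1 : ℝ) : ℂ) ≠ 0 := fun a => by
      have := a.1.1.2
      exact_mod_cast this.ne'
    have hBB : ∀ a b, ⟪B (u a), B (u b)⟫_ℂ = ((a.1 : ℝ) : ℂ) * ((b.1 : ℝ) : ℂ) * ⟪u a, u b⟫_ℂ := by
      intro a b
      rw [inner_apply_apply_eq_inner_abs, habs, habs, inner_smul_left, inner_smul_right,
        Complex.conj_ofReal]
      ring
    -- Left singular vectors: the diagonal elements `⟪v a, B (u a)⟫` are exactly the singular
    -- values.
    set v : (Σ s : F, Fin (m s)) → H := fun a => ((a.1 : ℝ) : ℂ)⁻¹ • B (u a) with hv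
    have hvo : Orthonormal ℂ v := by
      rw [orthonormal_iff_ite] at hon' ⊢
      intro a b
      rw [hv]
      simp only [inner_smul_left, inner_smul_right, hBB, hon', map_inv₀, Complex.conj_ofReal]
      split_ifs with hab
      · subst hab
        have := hpos a
        field_simp
      · simp
    have hin : ∀ a, ‖⟪v a, B (u a)⟫_ℂ‖ = (a.1 : ℝ) := by
      intro a
      have h1 : ⟪u a, u a⟫_ℂ = 1 := by
        rw [inner_self_eq_norm_sq_to_K, hon'.1 a]; simp
      rw [hv]
      simp only [inner_smul_left, hBB, h1, map_inv₀, Complex.conj_ofReal, mul_one]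
      rw [← mul_assoc, inv_mul_cancel₀ (hpos a), one_mul]
      simp [abs_of_pos a.1.1.2]
    have ee := Fintype.equivFin (Σ s : F, Fin (m s))
    have := hM _ (u ∘ ee.symm) (v ∘ ee.symm) (hon'.comp _ ee.symm.injective)
      (hvo.comp _ ee.symm.injective)
    simp only [Function.comp_apply, hin] at this
    rw [ee.symm.sum_comp (fun a => ((a.1 : {s : ℝ // 0 < s}) : ℝ) ^ α), Fintype.sum_sigma] at this
    rw [← Finset.sum_coe_sort F (fun s => (m s : ℝ) * (s : ℝ) ^ α)]
    simpa using this
  have hfinite : ∀ s : {s : ℝ // 0 < s}, singularMultiplicity B s ≠ ⊤ := by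
    intro s hs
    have hsα : 0 < (s : ℝ) ^ α := Real.rpow_pos_of_pos s.2 _
    obtain ⟨k, hk⟩ := exists_nat_gt (M / (s : ℝ) ^ α)
    have := fin {s} (fun _ => k) (by simp [hs])
    rw [div_lt_iff₀ hsα] at hk
    simp at this
    linarith
  rw [schattenSum, ENNReal.tsum_eq_iSup_sum]
  refine iSup_le fun F => ?_
  have h1 := fin F (fun s => (singularMultiplicity B s).toNat) (fun s _ => by
    rw [ENat.natCast_toNat (hfinite s)])
  refine le_trans (le_of_eq ?_) (ENNReal.ofReal_le_ofReal h1)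
  rw [ENNReal.ofReal_sum_of_nonneg fun s _ => mul_nonneg (Nat.cast_nonneg _)
    (Real.rpow_nonneg s.2.le _)]
  refine Finset.sum_congr rfl fun s _ => ?_
  rw [ENNReal.ofReal_mul (Nat.cast_nonneg _), ENNReal.ofReal_natCast]
  congr 1
  conv_lhs => rw [← ENat.natCast_toNat (hfinite s)]
  simp

end Singular

end OrthoRestriction

end

noncomputable section

namespace OrthoRestriction

/-! ### Oscillatory integrals: stationary phase by averaging over small balls -/

section Oscillatory

variable {V : Type*} [NormedAddCommGroup V] [InnerProductSpace ℝ V]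

lemma norm_iteratedFDeriv_smul_le_of_bounds {m k : ℕ} (hk : k ≤ m) {f : V → ℝ} {g : V → ℂ}
    (hf : ContDiff ℝ m f) (hg : ContDiff ℝ m g) {x : V} {a b : ℝ}
    (ha : ∀ i ≤ m, ‖iteratedFDeriv ℝ i f x‖ ≤ a) (hb : ∀ i ≤ m, ‖iteratedFDeriv ℝ i g x‖ ≤ b) :
    ‖iteratedFDeriv ℝ k (fun y => f y • g y) x‖ ≤ 2 ^ m * (a * b) := by
  have ha0 : 0 ≤ a := (norm_nonneg _).trans (ha 0 (Nat.zero_le _))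
  have hb0 : 0 ≤ b := (norm_nonneg _).trans (hb 0 (Nat.zero_le _))
  refine (norm_iteratedFDeriv_smul_le hf hg x (n := k) (by exact_mod_cast hk)).trans ?_
  calc ∑ i ∈ Finset.range (k + 1), (k.choose i : ℝ) * ‖iteratedFDeriv ℝ i f x‖ *
        ‖iteratedFDeriv ℝ (k - i) g x‖
      ≤ ∑ i ∈ Finset.range (k + 1), (k.choose i : ℝ) * (a * b) := by
        refine Finset.sum_le_sum fun i hi => ?_
        rw [Finset.mem_range] at hi
        rw [mul_assoc]
        exact mul_le_mul_of_nonneg_left (mul_le_mul (ha i (by omega)) (hb _ (by omega))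
          (norm_nonneg _) ha0) (Nat.cast_nonneg _)
    _ = 2 ^ k * (a * b) := by
        rw [← Finset.sum_mul]
        congr 1
        exact_mod_cast Nat.sum_range_choose k
    _ ≤ 2 ^ m * (a * b) := by
        gcongr
        norm_num

/-- Needed for the chain rule: the cost of differentiating `e^(iψ)` depends on derivatives of `ψ`
only, not on its size. -/
lemma norm_iteratedFDeriv_cexp_ofReal (i : ℕ) (t : ℝ) :
    ‖iteratedFDeriv ℝ i (fun s : ℝ => Complex.exp (Complex.I * s)) t‖ = 1 := by
  rw [norm_iteratedFDeriv_eq_norm_iteratedDeriv]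
  have h : ∀ i : ℕ, iteratedDeriv i (fun s : ℝ => Complex.exp (Complex.I * s))
      = fun s : ℝ => Complex.I ^ i * Complex.exp (Complex.I * s) := by
    intro i
    induction i with
    | zero => simp
    | succ i ih =>
      rw [iteratedDeriv_succ, ih]
      ext s
      have h1 : HasDerivAt (fun s : ℝ => Complex.I * (s : ℂ)) (Complex.I * 1) s :=
        (Complex.ofRealCLM.hasDerivAt (x := s)).const_mul Complex.I
      have h2 := (h1.cexp).const_mul (Complex.I ^ i)
      rw [h2.deriv]
      ring
  rw [h i]
  simp [Complex.norm_exp]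

lemma norm_iteratedFDeriv_comp_add_smul {F : Type*} [NormedAddCommGroup F] [NormedSpace ℝ F]
    {m i : ℕ} (hi : i ≤ m) {f : V → F} (hf : ContDiff ℝ m f) (c η : V) {μ : ℝ} (hμ : 0 ≤ μ) :
    ‖iteratedFDeriv ℝ i (fun η => f (c + μ • η)) η‖ = μ ^ i * ‖iteratedFDeriv ℝ i f (c + μ • η)‖ := by
  have h1 : ContDiff ℝ i (fun y => f (c + y)) :=
    (hf.of_le (by exact_mod_cast hi)).comp (contDiff_const.add contDiff_id)
  have h2 := congrFun (iteratedFDeriv_comp_const_smul μ h1) η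
  rw [show (fun η => f (c + μ • η)) = fun η => (fun y => f (c + y)) (μ • η) from rfl, h2, norm_smul,
    iteratedFDeriv_comp_add_left]
  simp [abs_of_nonneg hμ]

lemma exists_iteratedFDeriv_bound {f : V → ℝ} {m : ℕ} (hf : ContDiff ℝ m f)
    (hc : HasCompactSupport f) : ∃ B : ℝ, 1 ≤ B ∧ ∀ i ≤ m, ∀ x, ‖iteratedFDeriv ℝ i f x‖ ≤ B := by
  have h : ∀ i : ℕ, ∃ B : ℝ, i ≤ m → ∀ x, ‖iteratedFDeriv ℝ i f x‖ ≤ B := by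
    intro i
    by_cases hi : i ≤ m
    · obtain ⟨B, hB⟩ := (hf.continuous_iteratedFDeriv (m := i)
        (by exact_mod_cast hi)).bounded_above_of_compact_support (hc.iteratedFDeriv i)
      exact ⟨B, fun _ => hB⟩
    · exact ⟨0, fun h => absurd h hi⟩
  choose B hB using h
  refine ⟨1 + ∑ i ∈ Finset.range (m + 1), |B i|, ?_, fun i hi x => ?_⟩
  · have := Finset.sum_nonneg (s := Finset.range (m + 1)) fun i _ => abs_nonneg (B i)
    linarith
  · have h1 := Finset.single_le_sum (f := fun i => |B i|) (fun i _ => abs_nonneg (B i))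
      (Finset.mem_range.2 (Nat.lt_succ_of_le hi))
    have h2 := hB i hi x
    have h3 := le_abs_self (B i)
    linarith

/-- Derivative bounds for the rescaled second-order Taylor remainder of `φ`, uniform in the centre
and the scale. -/
lemma norm_iteratedFDeriv_taylor_le {m i : ℕ} (hm : 2 ≤ m) (h1i : 1 ≤ i) (hi : i ≤ m) {φ : V → ℝ}
    (hφ : ContDiff ℝ m φ) {B : ℝ} (hB1 : 1 ≤ B) (hB : ∀ i ≤ m, ∀ x, ‖iteratedFDeriv ℝ i φ x‖ ≤ B)
    {μ : ℝ} (hμ : 0 < μ) (hμ1 : μ ≤ 1) (c : V) {η : V} (hη : ‖η‖ ≤ 1) :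
    ‖iteratedFDeriv ℝ i (fun η => (μ ^ 2)⁻¹ * (φ (c + μ • η) - φ c - μ * fderiv ℝ φ c η)) η‖ ≤ B := by
  obtain ⟨j, rfl⟩ : ∃ j, i = j + 1 := ⟨i - 1, by omega⟩
  have hdiff : Differentiable ℝ φ := hφ.differentiable (by
    have : (m : WithTop ℕ∞) ≠ 0 := by exact_mod_cast (by omega : m ≠ 0)
    exact this)
  have hfd : ContDiff ℝ (m - 1 : ℕ) (fderiv ℝ φ) := by
    refine hφ.fderiv_right ?_
    exact_mod_cast (by omega : m - 1 + 1 ≤ m)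
  -- After one derivative, the Lipschitz bound for `dφ` pays for the factor `μ⁻¹`. Every further
  -- derivative brings a factor `μ`, the first of which cancels `μ⁻¹`.
  have hder : (fderiv ℝ (fun η => (μ ^ 2)⁻¹ * (φ (c + μ • η) - φ c - μ * fderiv ℝ φ c η)))
      = fun η => μ⁻¹ • (fderiv ℝ φ (c + μ • η) - fderiv ℝ φ c) := by
    ext1 η
    have h1 : HasFDerivAt (fun η : V => c + μ • η) (μ • ContinuousLinearMap.id ℝ V) η :=
      ((hasFDerivAt_id η).const_smul μ).const_add c
    have h2 := (hdiff (c + μ • η)).hasFDerivAt.comp η h1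
    have h3 := (((h2.sub_const (φ c)).sub ((fderiv ℝ φ c).hasFDerivAt.const_mul μ)).const_mul
      (μ ^ 2)⁻¹)
    refine h3.fderiv.trans ?_
    ext v
    simp
    field_simp
  rw [← norm_iteratedFDeriv_fderiv, hder]
  rcases Nat.eq_zero_or_pos j with rfl | hj
  · rw [norm_iteratedFDeriv_zero, norm_smul, norm_inv, Real.norm_of_nonneg hμ.le]
    have hlip : ‖fderiv ℝ φ (c + μ • η) - fderiv ℝ φ c‖ ≤ B * ‖(c + μ • η) - c‖ := by
      refine convex_univ.norm_image_sub_le_of_norm_fderiv_le (𝕜 := ℝ) (fun x _ => ?_) (fun x _ => ?_)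
        (Set.mem_univ _) (Set.mem_univ _)
      · refine (hfd.differentiable ?_) x
        have : ((m - 1 : ℕ) : WithTop ℕ∞) ≠ 0 := by exact_mod_cast (by omega : m - 1 ≠ 0)
        exact this
      · have := hB 2 hm x
        rw [← norm_iteratedFDeriv_fderiv, ← norm_iteratedFDeriv_fderiv,
          norm_iteratedFDeriv_zero] at this
        exact this
    rw [add_sub_cancel_left, norm_smul, Real.norm_of_nonneg hμ.le] at hlip
    calc μ⁻¹ * ‖fderiv ℝ φ (c + μ • η) - fderiv ℝ φ c‖ ≤ μ⁻¹ * (B * (μ * ‖η‖)) := by gcongr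
      _ = B * ‖η‖ := by field_simp
      _ ≤ B := mul_le_of_le_one_right (by linarith) hη
  · have hjm : j ≤ m - 1 := by omega
    have hc1 : ContDiff ℝ (m - 1 : ℕ) (fun η => fderiv ℝ φ (c + μ • η)) :=
      hfd.comp (contDiff_const.add (contDiff_const.smul contDiff_id))
    have hc2 : ContDiff ℝ j (fun η => fderiv ℝ φ (c + μ • η)) :=
      hc1.of_le (by exact_mod_cast hjm)
    have e1 : iteratedFDeriv ℝ j (fun η => μ⁻¹ • (fderiv ℝ φ (c + μ • η) - fderiv ℝ φ c)) η
        = μ⁻¹ • iteratedFDeriv ℝ j (fun η => fderiv ℝ φ (c + μ • η)) η := by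
      rw [iteratedFDeriv_const_smul_apply' ((hc2.sub contDiff_const).contDiffAt)]
      congr 1
      have := iteratedFDeriv_sub_apply (𝕜 := ℝ) (i := j) (x := η) hc2.contDiffAt
        (contDiff_const (c := fderiv ℝ φ c)).contDiffAt
      rw [show (fun η => fderiv ℝ φ (c + μ • η) - fderiv ℝ φ c)
        = (fun η => fderiv ℝ φ (c + μ • η)) - fun _ => fderiv ℝ φ c from rfl, this,
        iteratedFDeriv_const_of_ne (by omega)]
      simp
    rw [e1, norm_smul, norm_iteratedFDeriv_comp_add_smul hjm hfd c η hμ.le,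
      norm_iteratedFDeriv_fderiv, norm_inv, Real.norm_of_nonneg hμ.le]
    obtain ⟨l, rfl⟩ : ∃ l, j = l + 1 := ⟨j - 1, by omega⟩
    calc μ⁻¹ * (μ ^ (l + 1) * ‖iteratedFDeriv ℝ (l + 1 + 1) φ (c + μ • η)‖)
        = μ ^ l * ‖iteratedFDeriv ℝ (l + 1 + 1) φ (c + μ • η)‖ := by
          rw [pow_succ]; field_simp
      _ ≤ 1 * B := by
          gcongr
          · exact pow_le_one₀ hμ.le hμ1
          · exact hB _ hi _
      _ = B := one_mul B

variable [FiniteDimensional ℝ V] [MeasurableSpace V] [BorelSpace V]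

/-- Decay of the Fourier integral of a function supported in the unit ball in terms of bounds on
its derivatives. -/
lemma exists_fourier_decay_const (m : ℕ) : ∃ C : ℝ, 0 ≤ C ∧ ∀ (g : V → ℂ) (B : ℝ), ContDiff ℝ m g →
    (∀ i ≤ m, ∀ x, ‖iteratedFDeriv ℝ i g x‖ ≤ B) → tsupport g ⊆ Metric.closedBall 0 1 →
    ∀ ξ : V, ‖∫ η, Complex.exp (Complex.I * (⟪η, ξ⟫_ℝ : ℝ)) * g η‖ ≤ C * B * ((1 + ‖ξ‖) ^ m)⁻¹ := by
  set b : ℝ := volume.real (Metric.closedBall (0 : V) 1) with hb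
  have hb0 : 0 ≤ b := measureReal_nonneg
  refine ⟨2 ^ m * (b + (2 * Real.pi) ^ m * (2 ^ m * ((m + 1) * b))), by positivity, ?_⟩
  intro g B hg hB hsupp ξ
  have hB0 : 0 ≤ B := (norm_nonneg _).trans (hB 0 (Nat.zero_le _) 0)
  have hcs : HasCompactSupport g :=
    HasCompactSupport.of_support_subset_isCompact (isCompact_closedBall 0 1)
      ((subset_tsupport g).trans hsupp)
  have h_integrable : ∀ i ≤ m, Integrable (fun v => ‖iteratedFDeriv ℝ i g v‖) := fun i hi =>
    ((hg.continuous_iteratedFDeriv (m := i) (by exact_mod_cast hi)).norm).integrable_of_hasCompactSupport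
      (hcs.iteratedFDeriv i).norm
  have hbound : ∀ i ≤ m, ∫ v, ‖iteratedFDeriv ℝ i g v‖ ≤ B * b := by
    intro i hi
    have h1 : (fun v => ‖iteratedFDeriv ℝ i g v‖) ≤ (Metric.closedBall (0 : V) 1).indicator
        (fun _ => B) := by
      intro v
      by_cases hv : v ∈ Metric.closedBall (0 : V) 1
      · rw [Set.indicator_of_mem hv]; exact hB i hi v
      · rw [Set.indicator_of_notMem hv]
        have : iteratedFDeriv ℝ i g v = 0 := by
          by_contra hne
          exact hv (hsupp (support_iteratedFDeriv_subset i hne))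
        simp [this]
    refine (integral_mono (h_integrable i hi) ((integrable_indicator_iff
      Metric.isClosed_closedBall.measurableSet).2 (integrableOn_const
        (measure_closedBall_lt_top.ne))) h1).trans ?_
    rw [integral_indicator Metric.isClosed_closedBall.measurableSet, setIntegral_const, smul_eq_mul,
      mul_comm]
  -- Converts `e^(i⟪η,ξ⟫)` to the normalisation `e^(-2πi⟪η,w⟫)`.
  set w : V := (-(2 * Real.pi)⁻¹ : ℝ) • ξ with hw
  have hF : FourierTransform.fourier g w
      = ∫ η, Complex.exp (Complex.I * (⟪η, ξ⟫_ℝ : ℝ)) * g η := by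
    rw [Real.fourier_eq']
    refine integral_congr_ae (Eventually.of_forall fun η => ?_)
    simp only [smul_eq_mul]
    congr 2
    rw [hw, inner_smul_right]
    push_cast
    have : (Real.pi : ℂ) ≠ 0 := by exact_mod_cast Real.pi_ne_zero
    field_simp
  have h1 := Real.pow_mul_norm_iteratedFDeriv_fourier_le (K := 0) (N := m) hg
    (fun k n hk hn => by
      have : k = 0 := by exact_mod_cast Nat.le_zero.1 (by exact_mod_cast hk)
      subst this
      simpa using h_integrable n (by exact_mod_cast hn)) (k := 0) (n := m) (by simp) le_rfl w
  rw [norm_iteratedFDeriv_zero, hF] at h1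
  set J := ‖∫ η, Complex.exp (Complex.I * (⟪η, ξ⟫_ℝ : ℝ)) * g η‖ with hJ
  have h2 : ‖w‖ ^ m * J ≤ 2 ^ m * ((m + 1) * (B * b)) := by
    refine h1.trans ?_
    simp only [pow_zero, CharP.cast_eq_zero, mul_zero, zero_add, one_mul]
    gcongr
    rw [Finset.sum_product]
    simp only [Finset.range_one, Finset.sum_singleton, pow_zero, one_mul]
    refine (Finset.sum_le_sum fun i hi => hbound i (by rw [Finset.mem_range] at hi; omega)).trans ?_
    simp
  have h3 : J ≤ B * b := by
    refine (norm_integral_le_integral_norm _).trans (le_trans (le_of_eq ?_) (hbound 0 (by omega)))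
    refine integral_congr_ae (Eventually.of_forall fun η => ?_)
    simp [Complex.norm_exp]
  have h4 : ‖ξ‖ ^ m * J ≤ (2 * Real.pi) ^ m * (2 ^ m * ((m + 1) * (B * b))) := by
    have : ‖ξ‖ = (2 * Real.pi) * ‖w‖ := by
      rw [hw, norm_smul, norm_neg, norm_inv, Real.norm_of_nonneg (by positivity)]
      field_simp
    rw [this, mul_pow, mul_assoc]
    gcongr
  have h5 : (1 + ‖ξ‖) ^ m ≤ 2 ^ m * (1 + ‖ξ‖ ^ m) := by
    rcases le_total ‖ξ‖ 1 with h | h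
    · calc (1 + ‖ξ‖) ^ m ≤ 2 ^ m := by gcongr; linarith
        _ ≤ _ := le_mul_of_one_le_right (by positivity) (by simp)
    · calc (1 + ‖ξ‖) ^ m ≤ (2 * ‖ξ‖) ^ m := by gcongr; linarith
        _ = 2 ^ m * ‖ξ‖ ^ m := mul_pow _ _ _
        _ ≤ _ := by gcongr; linarith
  rw [← div_eq_mul_inv, le_div_iff₀ (by positivity)]
  calc J * (1 + ‖ξ‖) ^ m ≤ J * (2 ^ m * (1 + ‖ξ‖ ^ m)) := by gcongr
    _ = 2 ^ m * (J + ‖ξ‖ ^ m * J) := by ring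
    _ ≤ 2 ^ m * (B * b + (2 * Real.pi) ^ m * (2 ^ m * ((m + 1) * (B * b)))) := by gcongr
    _ = _ := by ring

/-- An expanding map spends little time near any given value. -/
lemma exists_integral_expanding_le {F : V → V} (hF : Continuous F) {R κ : ℝ} (hκ : 0 < κ)
    (hexp : ∀ c ∈ Metric.closedBall (0 : V) R, ∀ c' ∈ Metric.closedBall (0 : V) R,
      κ * ‖c - c'‖ ≤ ‖F c - F c'‖) {m : ℕ} (hm : Module.finrank ℝ V < m) :
    ∃ C : ℝ, 0 ≤ C ∧ ∀ (L : ℝ) (y : V), 0 < L →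
      ∫ c in Metric.closedBall (0 : V) R, ((1 + L * ‖F c + y‖) ^ m)⁻¹ ≤
        C * (L ^ Module.finrank ℝ V)⁻¹ := by
  have h_integrable : Integrable (fun x : V => ((1 + ‖x‖) ^ m)⁻¹) := by
    have := integrable_one_add_norm (E := V) (μ := volume) (r := m) (by exact_mod_cast hm)
    refine this.congr (Eventually.of_forall fun x => ?_)
    simp only
    rw [Real.rpow_neg (by positivity), Real.rpow_natCast]
  set I := ∫ x : V, ((1 + ‖x‖) ^ m)⁻¹ with hI
  have hI0 : 0 ≤ I := integral_nonneg fun x => by positivity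
  refine ⟨((κ / 2) ^ Module.finrank ℝ V)⁻¹ * I, by positivity, fun L y hL => ?_⟩
  rcases (Metric.closedBall (0 : V) R).eq_empty_or_nonempty with he | hne
  · rw [he]; simp; positivity
  -- The value `-y` need not be attained by `F`. At a minimiser `c₀` one still has `‖F c - F c₀‖ ≤ 2
  -- ‖F c + y‖`, so `‖F c + y‖` dominates `κ/2 ‖c - c₀‖` and the integrand is compared with a
  -- rescaled integrable profile.
  obtain ⟨c₀, hc₀, hmin⟩ := (isCompact_closedBall (0 : V) R).exists_isMinOn hne
    (f := fun c => ‖F c + y‖) (by fun_prop)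
  have hlow : ∀ c ∈ Metric.closedBall (0 : V) R, κ / 2 * ‖c - c₀‖ ≤ ‖F c + y‖ := by
    intro c hc
    have h1 := hexp c hc c₀ hc₀
    have h2 : ‖F c₀ + y‖ ≤ ‖F c + y‖ := hmin hc
    have h3 : ‖F c - F c₀‖ ≤ ‖F c + y‖ + ‖F c₀ + y‖ := by
      have : F c - F c₀ = (F c + y) - (F c₀ + y) := by abel
      rw [this]; exact norm_sub_le _ _
    linarith
  set t := L * (κ / 2) with ht
  have ht0 : 0 < t := by positivity
  have hscale : Integrable (fun c : V => ((1 + ‖t • (c - c₀)‖) ^ m)⁻¹) :=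
    ((h_integrable.comp_smul ht0.ne').comp_sub_right c₀)
  calc ∫ c in Metric.closedBall (0 : V) R, ((1 + L * ‖F c + y‖) ^ m)⁻¹
      ≤ ∫ c in Metric.closedBall (0 : V) R, ((1 + ‖t • (c - c₀)‖) ^ m)⁻¹ := by
        refine setIntegral_mono_on ?_ hscale.integrableOn
          Metric.isClosed_closedBall.measurableSet fun c hc => ?_
        · refine ContinuousOn.integrableOn_compact (isCompact_closedBall _ _) ?_
          refine Continuous.continuousOn ?_
          refine Continuous.inv₀ (by fun_prop) fun c => by positivity
        · refine inv_anti₀ (by positivity) ?_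
          gcongr
          rw [norm_smul, Real.norm_of_nonneg ht0.le, ht, mul_assoc]
          exact mul_le_mul_of_nonneg_left (hlow c hc) hL.le
    _ ≤ ∫ c : V, ((1 + ‖t • (c - c₀)‖) ^ m)⁻¹ :=
        setIntegral_le_integral hscale (Eventually.of_forall fun c => by positivity)
    _ = ∫ c : V, ((1 + ‖t • c‖) ^ m)⁻¹ :=
        integral_sub_right_eq_self (fun c : V => ((1 + ‖t • c‖) ^ m)⁻¹) c₀
    _ = (t ^ Module.finrank ℝ V)⁻¹ * I := by
        rw [Measure.integral_comp_smul volume (fun c : V => ((1 + ‖c‖) ^ m)⁻¹) t, smul_eq_mul,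
          abs_of_nonneg (by positivity)]
    _ = ((κ / 2) ^ Module.finrank ℝ V)⁻¹ * I * (L ^ Module.finrank ℝ V)⁻¹ := by
        rw [ht, mul_pow, mul_inv]; ring

/-- Stationary phase bound at the scale `μ`, for a phase with an expanding gradient. -/
lemma exists_oscillatory_bound {φ χ : V → ℝ} {m : ℕ} (hm : Module.finrank ℝ V < m) (hm2 : 2 ≤ m)
    (hφ : ContDiff ℝ m φ) (hφc : HasCompactSupport φ) (hχ : ContDiff ℝ m χ) {R δ κ : ℝ}
    (hδ : 0 < δ) (hκ : 0 < κ) (hχs : tsupport χ ⊆ Metric.closedBall 0 R)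
    (hexp : ∀ c ∈ Metric.closedBall (0 : V) (R + δ), ∀ c' ∈ Metric.closedBall (0 : V) (R + δ),
      κ * ‖c - c'‖ ≤ ‖fderiv ℝ φ c - fderiv ℝ φ c'‖) :
    ∃ C : ℝ, 0 ≤ C ∧ ∀ (x : V) (μ : ℝ), 0 < μ → μ ≤ 1 →
      ‖∫ v, χ v • Complex.exp (Complex.I * ((⟪v, x⟫_ℝ + (μ ^ 2)⁻¹ * φ v : ℝ) : ℂ))‖ ≤
        C * μ ^ Module.finrank ℝ V := by
  have hχc : HasCompactSupport χ := HasCompactSupport.of_support_subset_isCompact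
    (isCompact_closedBall 0 R) ((subset_tsupport χ).trans hχs)
  have hm0 : (m : WithTop ℕ∞) ≠ 0 := by exact_mod_cast (by omega : m ≠ 0)
  -- Radius at most `δ`, so that only centres at which the gradient is known to expand contribute;
  -- at most `1`, so that the unit-ball Taylor and Fourier decay bounds apply.
  let bump : ContDiffBump (0 : V) := ⟨min δ 1 / 2, min δ 1, by positivity,
    half_lt_self (by positivity)⟩
  set ρ : V → ℝ := bump.normed volume with hρdef
  have hρ : ContDiff ℝ m ρ := bump.contDiff_normed
  have hρint : ∫ η, ρ η = 1 := bump.integral_normed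
  have hρs : tsupport ρ = Metric.closedBall 0 (min δ 1) := bump.tsupport_normed_eq
  have hρs1 : tsupport ρ ⊆ Metric.closedBall 0 1 := by
    rw [hρs]; exact Metric.closedBall_subset_closedBall (min_le_right _ _)
  have hρc : HasCompactSupport ρ := bump.hasCompactSupport_normed
  obtain ⟨Bφ, hBφ1, hBφ⟩ := exists_iteratedFDeriv_bound hφ hφc
  obtain ⟨Bχ, hBχ1, hBχ⟩ := exists_iteratedFDeriv_bound hχ hχc
  obtain ⟨Bρ, hBρ1, hBρ⟩ := exists_iteratedFDeriv_bound hρ hρc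
  obtain ⟨C₁, hC₁, hdecay⟩ := exists_fourier_decay_const (V := V) m
  set F : V → V := fun c => (InnerProductSpace.toDual ℝ V).symm (fderiv ℝ φ c) with hF
  have hFc : Continuous F :=
    (InnerProductSpace.toDual ℝ V).symm.continuous.comp (hφ.continuous_fderiv hm0)
  have hFin : ∀ c η, fderiv ℝ φ c η = ⟪η, F c⟫_ℝ := fun c η => by
    rw [real_inner_comm, hF, InnerProductSpace.toDual_symm_apply]
  obtain ⟨C₂, hC₂, hC₂'⟩ := exists_integral_expanding_le hFc hκ (R := R + δ)
    (fun c hc c' hc' => by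
      have := hexp c hc c' hc'
      rwa [hF, ← map_sub, LinearIsometryEquiv.norm_map]) hm
  -- Two applications of the Leibniz rule, for `ρ` and `χ`, and the higher chain rule for the
  -- exponential of the rescaled remainder; nothing depends on `c`, `μ` or `x`.
  set B : ℝ := 2 ^ m * (Bρ * (2 ^ m * (Bχ * (m.factorial * 1 * Bφ ^ m)))) with hBdef
  have hB0 : 0 ≤ B := by positivity
  refine ⟨C₁ * B * C₂, by positivity, fun x μ hμ hμ1 => ?_⟩
  set Θ : V → ℝ := fun v => ⟪v, x⟫_ℝ + (μ ^ 2)⁻¹ * φ v with hΘ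
  have hΘc : Continuous Θ := by have := hφ.continuous; fun_prop
  set h : V → ℂ := fun v => χ v • Complex.exp (Complex.I * (Θ v : ℂ)) with hh
  have hhc : Continuous h := by have := hχ.continuous; fun_prop
  set ψ : V → V → ℝ := fun c η => (μ ^ 2)⁻¹ * (φ (c + μ • η) - φ c - μ * fderiv ℝ φ c η) with hψ
  set g : V → V → ℂ := fun c η => ρ η • (χ (c + μ • η) • Complex.exp (Complex.I * (ψ c η : ℂ)))
    with hg
  -- At scale `μ` around `c` the phase is a constant, a linear part of frequency `ξ c` and the
  -- remainder `ψ c`, which is harmless because `μ⁻²` matches the scale. Hence the local integral is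
  -- small unless `c` is nearly stationary.
  set ξ : V → V := fun c => μ⁻¹ • (F c + (μ ^ 2) • x) with hξ
  -- the inner integral
  have hinner : ∀ c, ∫ η, ρ η • h (c + μ • η) = Complex.exp (Complex.I * (Θ c : ℂ)) *
      ∫ η, Complex.exp (Complex.I * (⟪η, ξ c⟫_ℝ : ℝ)) * g c η := by
    intro c
    rw [← integral_const_mul]
    refine integral_congr_ae (Eventually.of_forall fun η => ?_)
    simp only [hh, hg, Complex.real_smul]
    have : Θ (c + μ • η) = Θ c + ⟪η, ξ c⟫_ℝ + ψ c η := by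
      simp only [hΘ, hξ, hψ, inner_add_left, inner_smul_left, inner_smul_right, inner_add_right,
        hFin]
      simp only [RCLike.conj_to_real]
      field_simp
      ring
    rw [this]
    push_cast
    rw [mul_add, mul_add, Complex.exp_add, Complex.exp_add]
    ring
  have hψd : ∀ c, ContDiff ℝ m (ψ c) := by
    intro c
    have h1 : ContDiff ℝ m (fun η : V => φ (c + μ • η)) :=
      hφ.comp (contDiff_const.add (contDiff_const.smul contDiff_id))
    exact contDiff_const.mul ((h1.sub contDiff_const).sub
      (contDiff_const.mul (fderiv ℝ φ c).contDiff))
  have hexpd : ContDiff ℝ m (fun s : ℝ => Complex.exp (Complex.I * s)) :=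
    (contDiff_const.mul Complex.ofRealCLM.contDiff).cexp
  have hχd : ∀ c, ContDiff ℝ m (fun η : V => χ (c + μ • η)) := fun c =>
    hχ.comp (contDiff_const.add (contDiff_const.smul contDiff_id))
  have hed : ∀ c, ContDiff ℝ m (fun η => Complex.exp (Complex.I * (ψ c η : ℂ))) := fun c =>
    hexpd.comp (hψd c)
  have hgd : ∀ c, ContDiff ℝ m (g c) := fun c => hρ.smul ((hχd c).smul (hed c))
  have hgB : ∀ c, ∀ i ≤ m, ∀ η, ‖iteratedFDeriv ℝ i (g c) η‖ ≤ B := by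
    intro c i hi η
    by_cases hη : η ∈ tsupport ρ
    · have hη1 : ‖η‖ ≤ 1 := by simpa using hρs1 hη
      refine norm_iteratedFDeriv_smul_le_of_bounds hi hρ ((hχd c).smul (hed c))
        (fun i hi => hBρ i hi η) fun i hi => ?_
      refine norm_iteratedFDeriv_smul_le_of_bounds hi (hχd c) (hed c) (fun i hi => ?_)
        fun i hi => ?_
      · rw [norm_iteratedFDeriv_comp_add_smul hi hχ c η hμ.le]
        calc μ ^ i * _ ≤ 1 * Bχ := by
              gcongr
              · exact pow_le_one₀ hμ.le hμ1
              · exact hBχ i hi _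
          _ = Bχ := one_mul _
      · refine (norm_iteratedFDeriv_comp_le (N := m) hexpd (hψd c) (n := i)
          (by exact_mod_cast hi) η (C := 1) (D := Bφ)
          (fun j _ => (norm_iteratedFDeriv_cexp_ofReal j _).le) fun j h1j hj => ?_).trans ?_
        · refine (norm_iteratedFDeriv_taylor_le hm2 h1j (hj.trans hi) hφ hBφ1 hBφ hμ hμ1 c
            hη1).trans ?_
          exact le_self_pow₀ hBφ1 (by omega)
        · gcongr
    · have h0 : iteratedFDeriv ℝ i (g c) η = 0 := by
        by_contra hne
        refine hη ?_
        have h1 : tsupport (g c) ⊆ tsupport ρ := tsupport_smul_subset_left _ _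
        exact h1 (support_iteratedFDeriv_subset i hne)
      simpa [h0] using hB0
  have hnorm : ∀ c, ‖∫ η, ρ η • h (c + μ • η)‖ ≤
      C₁ * B * ((1 + μ⁻¹ * ‖F c + (μ ^ 2) • x‖) ^ m)⁻¹ := by
    intro c
    rw [hinner, norm_mul]
    have h1 : ‖Complex.exp (Complex.I * (Θ c : ℂ))‖ = 1 := by simp [Complex.norm_exp]
    rw [h1, one_mul]
    refine (hdecay (g c) B (hgd c) (hgB c)
      ((tsupport_smul_subset_left _ _).trans hρs1) (ξ c)).trans (le_of_eq ?_)
    rw [hξ, norm_smul, norm_inv, Real.norm_of_nonneg hμ.le]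
  have hmem : ∀ c η, ρ η ≠ 0 → χ (c + μ • η) ≠ 0 → c ∈ Metric.closedBall (0 : V) (R + δ) := by
    intro c η h1 h2
    have h3 : ‖η‖ ≤ min δ 1 := by
      have := subset_tsupport ρ h1
      rw [hρs] at this
      simpa using this
    have h4 : ‖c + μ • η‖ ≤ R := by simpa using hχs (subset_tsupport χ h2)
    have h5 : ‖μ • η‖ ≤ δ := by
      rw [norm_smul, Real.norm_of_nonneg hμ.le]
      calc μ * ‖η‖ ≤ 1 * δ := by
            gcongr
            exact h3.trans (min_le_left _ _)
        _ = δ := one_mul δ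
    have h6 : ‖c‖ ≤ ‖c + μ • η‖ + ‖μ • η‖ := by
      simpa using norm_sub_le (c + μ • η) (μ • η)
    simp only [Metric.mem_closedBall, dist_zero_right]
    linarith
  have hzero : ∀ c, c ∉ Metric.closedBall (0 : V) (R + δ) → ∫ η, ρ η • h (c + μ • η) = 0 := by
    intro c hc
    refine integral_eq_zero_of_ae (Eventually.of_forall fun η => ?_)
    simp only [hh, Pi.zero_apply]
    by_cases h1 : ρ η = 0
    · simp [h1]
    by_cases h2 : χ (c + μ • η) = 0
    · simp [h2]
    exact absurd (hmem c η h1 h2) hc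
  have hprod : Integrable (Function.uncurry fun η c : V => ρ η • h (c + μ • η))
      ((volume : Measure V).prod volume) := by
    refine Continuous.integrable_of_hasCompactSupport ?_ ?_
    · have := hρ.continuous
      fun_prop
    · refine HasCompactSupport.of_support_subset_isCompact
        ((isCompact_closedBall (0 : V) 1).prod (isCompact_closedBall (0 : V) (R + δ))) ?_
      rintro ⟨η, c⟩ hne
      simp only [Function.mem_support, Function.uncurry_apply_pair, hh, ne_eq, smul_eq_zero,
        not_or] at hne
      exact ⟨hρs1 (subset_tsupport ρ hne.1), hmem c η hne.1 hne.2.1⟩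
  -- Averaging over translations with total weight one leaves the integral unchanged and localises
  -- it to balls of radius comparable to `μ`.
  have hrep : ∫ v, h v = ∫ c, ∫ η, ρ η • h (c + μ • η) := by
    calc ∫ v, h v = ∫ η, ρ η • ∫ v, h v := by
          rw [integral_smul_const, hρint, one_smul]
      _ = ∫ η, ∫ c, ρ η • h (c + μ • η) := by
          refine integral_congr_ae (Eventually.of_forall fun η => ?_)
          simp only
          rw [integral_smul, integral_add_right_eq_self h (μ • η)]
      _ = _ := integral_integral_swap hprod
  rw [hrep]
  calc ‖∫ c, ∫ η, ρ η • h (c + μ • η)‖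
      = ‖∫ c in Metric.closedBall (0 : V) (R + δ), ∫ η, ρ η • h (c + μ • η)‖ := by
        rw [setIntegral_eq_integral_of_forall_compl_eq_zero hzero]
    _ ≤ ∫ c in Metric.closedBall (0 : V) (R + δ),
          C₁ * B * ((1 + μ⁻¹ * ‖F c + (μ ^ 2) • x‖) ^ m)⁻¹ := by
        refine norm_integral_le_of_norm_le ?_ (Eventually.of_forall hnorm)
        refine ContinuousOn.integrableOn_compact (isCompact_closedBall _ _) ?_
        refine Continuous.continuousOn ?_
        refine continuous_const.mul (Continuous.inv₀ (by fun_prop) fun c => by positivity)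
    -- The expanding-map bound with `L = μ⁻¹` and `y = μ² x`. Its uniformity in `y` gives uniformity
    -- in `x`.
    _ ≤ C₁ * B * (C₂ * (μ⁻¹ ^ Module.finrank ℝ V)⁻¹) := by
        rw [integral_const_mul]
        exact mul_le_mul_of_nonneg_left (hC₂' μ⁻¹ _ (by positivity)) (by positivity)
    _ = C₁ * B * C₂ * μ ^ Module.finrank ℝ V := by
        rw [inv_pow, inv_inv]; ring

/-- Decay of an oscillatory integral whose phase has an expanding gradient, uniformly with respect
to linear perturbations of the phase. -/
theorem exists_oscillatory_decay {φ χ : V → ℝ} {m : ℕ} (hm : Module.finrank ℝ V < m) (hm2 : 2 ≤ m)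
    (hφ : ContDiff ℝ m φ) (hφc : HasCompactSupport φ) (hχ : ContDiff ℝ m χ) {R δ κ : ℝ}
    (hδ : 0 < δ) (hκ : 0 < κ) (hχs : tsupport χ ⊆ Metric.closedBall 0 R)
    (hexp : ∀ c ∈ Metric.closedBall (0 : V) (R + δ), ∀ c' ∈ Metric.closedBall (0 : V) (R + δ),
      κ * ‖c - c'‖ ≤ ‖fderiv ℝ φ c - fderiv ℝ φ c'‖) :
    ∃ C : ℝ, 0 ≤ C ∧ ∀ (x : V) (s : ℝ),
      ‖∫ v, χ v • Complex.exp (Complex.I * ((⟪v, x⟫_ℝ + s * φ v : ℝ) : ℂ))‖ *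
        (1 + |s|) ^ ((Module.finrank ℝ V : ℝ) / 2) ≤ C := by
  obtain ⟨C₁, hC₁, h₁⟩ := exists_oscillatory_bound hm hm2 hφ hφc hχ hδ hκ hχs hexp
  obtain ⟨C₂, hC₂, h₂⟩ := exists_oscillatory_bound (φ := fun v => -φ v) hm hm2 hφ.neg hφc.neg hχ
    hδ hκ hχs (fun c hc c' hc' => by
      have := hexp c' hc' c hc
      rwa [fderiv_fun_neg, fderiv_fun_neg, neg_sub_neg, norm_sub_rev c])
  set n := Module.finrank ℝ V with hn
  set A := ∫ v, |χ v| with hA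
  have hA0 : 0 ≤ A := integral_nonneg fun v => abs_nonneg _
  have htriv : ∀ (x : V) (s : ℝ),
      ‖∫ v, χ v • Complex.exp (Complex.I * ((⟪v, x⟫_ℝ + s * φ v : ℝ) : ℂ))‖ ≤ A := by
    intro x s
    refine (norm_integral_le_integral_norm _).trans (le_of_eq ?_)
    refine integral_congr_ae (Eventually.of_forall fun v => ?_)
    have : ‖Complex.exp (Complex.I * ((⟪v, x⟫_ℝ + s * φ v : ℝ) : ℂ))‖ = 1 := by
      rw [mul_comm]; exact Complex.norm_exp_ofReal_mul_I _
    simp only [norm_smul, this, mul_one, Real.norm_eq_abs]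
  have hbig : ∀ t : ℝ, 1 ≤ t → ∀ J C : ℝ, 0 ≤ C →
      J ≤ C * (Real.sqrt t)⁻¹ ^ n → J * (1 + t) ^ ((n : ℝ) / 2) ≤ C * 2 ^ ((n : ℝ) / 2) := by
    intro t ht J C hC hJ
    have h1 : (Real.sqrt t)⁻¹ ^ n = (t ^ ((n : ℝ) / 2))⁻¹ := by
      rw [inv_pow, Real.sqrt_eq_rpow, ← Real.rpow_natCast, ← Real.rpow_mul (by linarith)]
      congr 2; ring
    have ht0 : 0 < t := by linarith
    rw [h1] at hJ
    calc J * (1 + t) ^ ((n : ℝ) / 2) ≤ (C * (t ^ ((n : ℝ) / 2))⁻¹) * (2 * t) ^ ((n : ℝ) / 2) := by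
          gcongr
          linarith
      _ = C * 2 ^ ((n : ℝ) / 2) := by
          rw [Real.mul_rpow (by norm_num) ht0.le]
          have : 0 < t ^ ((n : ℝ) / 2) := by positivity
          field_simp
  have hsq : ∀ t : ℝ, 1 ≤ t → (((Real.sqrt t)⁻¹) ^ 2)⁻¹ = t := fun t ht => by
    rw [inv_pow, inv_inv, Real.sq_sqrt (by linarith)]
  have hsq1 : ∀ t : ℝ, 1 ≤ t → (Real.sqrt t)⁻¹ ≤ 1 := fun t ht =>
    inv_le_one_of_one_le₀ (Real.one_le_sqrt.2 ht)
  have hsq0 : ∀ t : ℝ, 1 ≤ t → 0 < (Real.sqrt t)⁻¹ := fun t ht => by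
    have : 0 < t := by linarith
    positivity
  refine ⟨(A + C₁ + C₂) * 2 ^ ((n : ℝ) / 2), by positivity, fun x s => ?_⟩
  have h2 : (0 : ℝ) ≤ 2 ^ ((n : ℝ) / 2) := by positivity
  -- Small `s` needs only the trivial bound. Otherwise the scale is `μ = |s|^(-1/2)`, with `-φ` in
  -- place of `φ` for negative `s`.
  rcases le_total |s| 1 with hs | hs
  · calc _ ≤ A * 2 ^ ((n : ℝ) / 2) := by
          gcongr
          · exact htriv x s
          · linarith
      _ ≤ _ := by gcongr; linarith
  · rcases abs_cases s with ⟨ha, _⟩ | ⟨ha, _⟩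
    · rw [ha] at hs ⊢
      have := h₁ x _ (hsq0 s hs) (hsq1 s hs)
      rw [hsq s hs] at this
      refine (hbig s hs _ C₁ hC₁ this).trans ?_
      gcongr; linarith
    · rw [ha] at hs ⊢
      have := h₂ x _ (hsq0 _ hs) (hsq1 _ hs)
      rw [hsq _ hs] at this
      simp only [neg_mul_neg] at this
      refine (hbig _ hs _ C₂ hC₂ this).trans ?_
      gcongr; linarith

end Oscillatory

end OrthoRestriction

end

noncomputable section

namespace OrthoRestriction

/-! ### Hypersurfaces as graphs; curvature and the Hessian -/

section Geometry

/-- In finite dimension an injective linear map is bounded below, say by `K⁻¹`. Strict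
differentiability makes the error at most `(2K)⁻¹`, so half of the lower bound survives. -/
lemma exists_expanding_of_injective {V F : Type*} [NormedAddCommGroup V] [NormedSpace ℝ V]
    [FiniteDimensional ℝ V] [NormedAddCommGroup F] [NormedSpace ℝ F] {f : V → F} {f' : V →L[ℝ] F}
    {a : V} (hf : HasStrictFDerivAt f f' a) (hinj : ∀ v, f' v = 0 → v = 0) :
    ∃ κ > 0, ∃ s ∈ nhds a, ∀ c ∈ s, ∀ c' ∈ s, κ * ‖c - c'‖ ≤ ‖f c - f c'‖ := by
  obtain ⟨K, hK, hanti⟩ := (f' : V →ₗ[ℝ] F).exists_antilipschitzWith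
    (LinearMap.ker_eq_bot'.2 hinj)
  have hKr : (0 : ℝ) < K := hK
  obtain ⟨s, hs, happ⟩ := hf.approximates_deriv_on_nhds (c := (2 * K)⁻¹) (Or.inr (by positivity))
  refine ⟨(2 * K)⁻¹, by positivity, s, hs, fun c hc c' hc' => ?_⟩
  have h1 := happ c hc c' hc'
  have h2 : ‖c - c'‖ ≤ K * ‖f' (c - c')‖ := by
    simpa [dist_eq_norm] using hanti.le_mul_dist (c - c') 0
  have h3 : (K : ℝ)⁻¹ * ‖c - c'‖ ≤ ‖f' (c - c')‖ := by
    rw [inv_mul_le_iff₀ hKr]; exact h2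
  have h4 : ‖f' (c - c')‖ ≤ ‖f c - f c' - f' (c - c')‖ + ‖f c - f c'‖ := by
    have := norm_sub_le (f c - f c') (f c - f c' - f' (c - c'))
    rw [sub_sub_cancel] at this
    linarith
  have h5 : ((2 * K : NNReal) : ℝ)⁻¹ = (K : ℝ)⁻¹ / 2 := by
    push_cast; field_simp
  push_cast at h1 h5 ⊢
  rw [h5] at h1 ⊢
  linarith

/-- A point of a subspace `νᗮ` plus the component along `ν`. -/
lemma orthogonal_decomposition {N : ℕ} {ν : Eucl N} (hν : ‖ν‖ = 1) (x : Eucl N) :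
    ((ℝ ∙ ν)ᗮ.orthogonalProjectionOnto x : Eucl N) + ⟪ν, x⟫_ℝ • ν = x := by
  have h := (ℝ ∙ ν).starProjection_add_starProjection_orthogonal x
  rw [Submodule.starProjection_unit_singleton ℝ hν] at h
  rw [add_comm]
  exact h

variable {N : ℕ} {S : Set (Eucl N)} {p : Eucl N} {ρ : Eucl N → ℝ}

/-- Inverse function theorem for `x ↦ (P (x - p), ρ x)`. The graph function is the normal component
of the local inverse on the slice where the second coordinate vanishes. -/
lemma exists_graph_function (hpS : p ∈ S) (hρ : IsLocalDefiningFunction S p ρ) {ν : Eucl N}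
    (hν : ν = unitNormal ρ p) (m : ℕ) (hm : m ≠ 0) :
    ‖ν‖ = 1 ∧ ∃ φ : (ℝ ∙ ν)ᗮ → ℝ, ContDiffAt ℝ m φ 0 ∧ φ 0 = 0 ∧
      (∀ᶠ v in nhds (0 : (ℝ ∙ ν)ᗮ), ρ (p + v + φ v • ν) = 0) ∧
      ∀ᶠ x in nhds p, x ∈ S → x = p + ((ℝ ∙ ν)ᗮ.orthogonalProjectionOnto (x - p) : Eucl N) +
        φ ((ℝ ∙ ν)ᗮ.orthogonalProjectionOnto (x - p)) • ν := by
  obtain ⟨U, hU, hpU, hρU, hgrad, hSU⟩ := hρ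
  have hg0 : 0 < ‖gradient ρ p‖ := norm_pos_iff.2 hgrad
  have hν1 : ‖ν‖ = 1 := by
    rw [hν, unitNormal, norm_smul, norm_inv, norm_norm, inv_mul_cancel₀ hg0.ne']
  refine ⟨hν1, ?_⟩
  have hgν : gradient ρ p = ‖gradient ρ p‖ • ν := by
    rw [hν, unitNormal, smul_smul, mul_inv_cancel₀ hg0.ne', one_smul]
  have hρp : ρ p = 0 := by
    have : p ∈ S ∩ U := ⟨hpS, hpU⟩
    rw [hSU] at this
    exact this.2
  have hρm : ContDiffAt ℝ m ρ p :=
    ((hρU.contDiffAt (hU.mem_nhds hpU)).of_le (by exact_mod_cast le_top))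
  have hdρ : HasFDerivAt ρ (fderiv ℝ ρ p) p :=
    (hρm.differentiableAt (by exact_mod_cast hm)).hasFDerivAt
  have hdρ' : ∀ x, fderiv ℝ ρ p x = ‖gradient ρ p‖ * ⟪ν, x⟫_ℝ := by
    intro x
    have : ⟪gradient ρ p, x⟫_ℝ = fderiv ℝ ρ p x := by
      rw [gradient, InnerProductSpace.toDual_symm_apply]
    rw [← this]
    conv_lhs => rw [hgν]
    rw [inner_smul_left]; simp
  set T := (ℝ ∙ ν)ᗮ with hT
  set P : Eucl N →L[ℝ] T := T.orthogonalProjectionOnto with hP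
  have hTν : ∀ v : T, ⟪ν, (v : Eucl N)⟫_ℝ = 0 := fun v =>
    (Submodule.mem_orthogonal_singleton_iff_inner_right).1 v.2
  have hPν : P ν = 0 := by
    rw [hP, Submodule.orthogonalProjectionOnto_eq_zero_iff, hT, Submodule.orthogonal_orthogonal]
    exact Submodule.mem_span_singleton_self ν
  have hPv : ∀ v : T, P (v : Eucl N) = v := fun v => T.orthogonalProjectionOnto_mem_subspace_eq_self v
  have hνν : ⟪ν, ν⟫_ℝ = 1 := by rw [real_inner_self_eq_norm_sq, hν1]; norm_num
  let e : Eucl N ≃L[ℝ] T × ℝ := ContinuousLinearEquiv.equivOfInverse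
    (P.prod (fderiv ℝ ρ p))
    ((T.subtypeL ∘L ContinuousLinearMap.fst ℝ T ℝ) +
      (ContinuousLinearMap.snd ℝ T ℝ).smulRight (‖gradient ρ p‖⁻¹ • ν))
    (fun x => by
      simp only [ContinuousLinearMap.prod_apply, add_apply,
        ContinuousLinearMap.comp_apply, ContinuousLinearMap.coe_fst', Submodule.subtypeL_apply,
        ContinuousLinearMap.smulRight_apply, ContinuousLinearMap.coe_snd', hdρ', smul_smul]
      rw [mul_comm, ← mul_assoc, inv_mul_cancel₀ hg0.ne', one_mul]
      exact orthogonal_decomposition hν1 x)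
    (fun y => by
      simp only [ContinuousLinearMap.prod_apply, add_apply,
        ContinuousLinearMap.comp_apply, ContinuousLinearMap.coe_fst', Submodule.subtypeL_apply,
        ContinuousLinearMap.smulRight_apply, ContinuousLinearMap.coe_snd', map_add, hPv, map_smul,
        hPν, hdρ', hTν, hνν]
      ext
      · simp
      · simp [hg0.ne'])
  set Φ : Eucl N → T × ℝ := fun x => (P (x - p), ρ x) with hΦ
  have hΦm : ContDiffAt ℝ m Φ p :=
    (P.contDiff.contDiffAt.comp p (contDiffAt_id.sub contDiffAt_const)).prodMk hρm
  have hΦd : HasFDerivAt Φ (e : Eucl N →L[ℝ] T × ℝ) p := by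
    have h1 : HasFDerivAt (fun x => P (x - p)) P p := by
      have := HasFDerivAt.comp (g := P) (f := fun x => x - p) p P.hasFDerivAt
        ((hasFDerivAt_id p).sub_const p)
      rwa [ContinuousLinearMap.comp_id] at this
    exact h1.prodMk hdρ
  have hm' : (m : WithTop ℕ∞) ≠ 0 := by exact_mod_cast hm
  set Ψ := hΦm.localInverse hΦd hm' with hΨ
  have hΦp : Φ p = (0, 0) := by simp [hΦ, hρp]
  have hΨm : ContDiffAt ℝ m Ψ (0, 0) := hΦp ▸ hΦm.to_localInverse hΦd hm'
  have hstrict := hΦm.hasStrictFDerivAt' hΦd hm'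
  have hleft : ∀ᶠ x in nhds p, Ψ (Φ x) = x := hstrict.eventually_left_inverse
  have hright : ∀ᶠ y in nhds ((0, 0) : T × ℝ), Φ (Ψ y) = y :=
    hΦp ▸ hstrict.eventually_right_inverse
  have hΨ0 : Ψ (0, 0) = p := hΦp ▸ hΦm.localInverse_apply_image hΦd hm'
  have hι : ContDiff ℝ m (fun v : T => (v, (0 : ℝ))) := contDiff_id.prodMk contDiff_const
  refine ⟨fun v => ⟪ν, Ψ (v, 0) - p⟫_ℝ, ?_, by simp [hΨ0], ?_, ?_⟩
  · refine contDiffAt_const.inner ℝ ((ContDiffAt.comp (0 : T) (g := Ψ) ?_ hι.contDiffAt).sub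
      contDiffAt_const)
    exact hΨm
  · have hcont : Tendsto (fun v : T => (v, (0 : ℝ))) (nhds 0) (nhds (0, 0)) :=
      hι.continuous.tendsto 0
    filter_upwards [hcont.eventually hright] with v hv
    have h1 : P (Ψ (v, 0) - p) = v := congrArg Prod.fst hv
    have h2 : ρ (Ψ (v, 0)) = 0 := congrArg Prod.snd hv
    have h3 : ((P (Ψ (v, 0) - p) : T) : Eucl N) + ⟪ν, Ψ (v, 0) - p⟫_ℝ • ν = Ψ (v, 0) - p :=
      orthogonal_decomposition hν1 (Ψ (v, 0) - p)
    have h4 : p + v + ⟪ν, Ψ (v, 0) - p⟫_ℝ • ν = Ψ (v, 0) := by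
      rw [h1] at h3
      rw [add_assoc, h3, add_sub_cancel]
    rw [h4, h2]
  · filter_upwards [hleft, hU.mem_nhds hpU] with x hx hxU hxS
    have h1 : ρ x = 0 := by
      have : x ∈ S ∩ U := ⟨hxS, hxU⟩
      rw [hSU] at this
      exact this.2
    have h2 : Ψ (P (x - p), 0) = x := by
      rw [← h1]; exact hx
    change x = p + _ + ⟪ν, Ψ (P (x - p), 0) - p⟫_ℝ • ν
    rw [h2, add_assoc, orthogonal_decomposition hν1 (x - p), add_sub_cancel]

/-- Differentiating the tangency relation `⟪n (G v), w + dφ(v) w • ν⟫ = 0` at `0` along `u`, where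
`n` is the unit normal and `dφ(0) = 0`, gives `⟪D_u n, w⟫ = -D²φ(u, w)`. A null vector of the
Hessian is therefore killed by the shape operator, which is invertible. -/
lemma hessian_injective (hρ : IsLocalDefiningFunction S p ρ) (hK : gaussCurvature ρ p ≠ 0)
    {ν : Eucl N} (hν : ν = unitNormal ρ p) (hν1 : ‖ν‖ = 1)
    {T : Submodule ℝ (Eucl N)} (hT : T = (ℝ ∙ ν)ᗮ) {φ : T → ℝ}
    (hφ : ContDiffAt ℝ 2 φ 0) (hφ0 : φ 0 = 0)
    (hgraph : ∀ᶠ v in nhds (0 : T), ρ (p + v + φ v • ν) = 0) (u : T)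
    (hu : fderiv ℝ (fderiv ℝ φ) 0 u = 0) : u = 0 := by
  obtain ⟨U, hU, hpU, hρU, hgrad, hSU⟩ := hρ
  have hg0 : 0 < ‖gradient ρ p‖ := norm_pos_iff.2 hgrad
  have hgν : gradient ρ p = ‖gradient ρ p‖ • ν := by
    rw [hν, unitNormal, smul_smul, mul_inv_cancel₀ hg0.ne', one_smul]
  have hTν : ∀ v : T, ⟪ν, (v : Eucl N)⟫_ℝ = 0 := fun v =>
    (Submodule.mem_orthogonal_singleton_iff_inner_right).1 (hT ▸ v.2)
  have hνν : ⟪ν, ν⟫_ℝ = 1 := by rw [real_inner_self_eq_norm_sq, hν1]; norm_num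
  set G : T → Eucl N := fun v => p + v + φ v • ν with hG
  have hG0 : G 0 = p := by simp [hG, hφ0]
  have hφd : ∀ᶠ v in nhds (0 : T), DifferentiableAt ℝ φ v := by
    filter_upwards [hφ.eventually (by simp)] with v hv
    exact hv.differentiableAt (by simp)
  have hGd : ∀ v, DifferentiableAt ℝ φ v →
      HasFDerivAt G (T.subtypeL + (fderiv ℝ φ v).smulRight ν) v := by
    intro v hv
    exact (T.subtypeL.hasFDerivAt.const_add p).add (hv.hasFDerivAt.smul_const ν)
  have hGc : Tendsto G (nhds 0) (nhds p) := by
    have := (hGd 0 hφd.self_of_nhds).continuousAt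
    rwa [ContinuousAt, hG0] at this
  have hρ2 : ContDiffAt ℝ 2 ρ p :=
    ((hρU.contDiffAt (hU.mem_nhds hpU)).of_le (by norm_cast))
  have hρd : ∀ᶠ x in nhds p, DifferentiableAt ℝ ρ x := by
    filter_upwards [hU.mem_nhds hpU] with x hx
    exact (hρU.contDiffAt (hU.mem_nhds hx)).differentiableAt (by simp)
  have hgin : ∀ x y, ⟪gradient ρ x, y⟫_ℝ = fderiv ℝ ρ x y := fun x y => by
    rw [gradient, InnerProductSpace.toDual_symm_apply]
  have hnd : DifferentiableAt ℝ (unitNormal ρ) p := by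
    have h1 : DifferentiableAt ℝ (gradient ρ) p := by
      have h2 : DifferentiableAt ℝ (fderiv ℝ ρ) p :=
        (hρ2.fderiv_right (m := 1) (by norm_num)).differentiableAt (by simp)
      exact ((InnerProductSpace.toDual ℝ (Eucl N)).symm.differentiable _).comp p h2
    exact (h1.norm ℝ hgrad |>.inv hg0.ne').smul h1
  -- tangency of the graph
  have htan : ∀ w : T, ∀ᶠ v in nhds (0 : T),
      ⟪unitNormal ρ (G v), (w : Eucl N) + fderiv ℝ φ v w • ν⟫_ℝ = 0 := by
    intro w
    filter_upwards [hφd, hGc.eventually hρd, hgraph.eventually_nhds] with v h1 h2 h3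
    have h4 := (h2.hasFDerivAt.comp v (hGd v h1)).unique
      ((hasFDerivAt_const (0 : ℝ) v).congr_of_eventuallyEq h3)
    have h5 := congrArg (fun L : T →L[ℝ] ℝ => L w) h4
    simp only [ContinuousLinearMap.comp_apply, add_apply,
      Submodule.subtypeL_apply, ContinuousLinearMap.smulRight_apply,
      zero_apply] at h5
    rw [unitNormal, inner_smul_left, hgin, h5, mul_zero]
  have hφ'0 : ∀ w, fderiv ℝ φ 0 w = 0 := by
    intro w
    have := (htan w).self_of_nhds
    rw [hG0, ← hν, inner_add_right, inner_smul_right, hTν, hνν] at this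
    simpa using this
  have hφ'd : DifferentiableAt ℝ (fderiv ℝ φ) 0 :=
    (hφ.fderiv_right (m := 1) (by norm_num)).differentiableAt (by simp)
  have hid : ∀ w : T, ⟪fderiv ℝ (unitNormal ρ) p u, (w : Eucl N)⟫_ℝ = 0 := by
    intro w
    have h1 : HasFDerivAt (fun v => unitNormal ρ (G v))
        (fderiv ℝ (unitNormal ρ) p ∘L (T.subtypeL + (fderiv ℝ φ 0).smulRight ν)) 0 := by
      refine HasFDerivAt.comp (g := unitNormal ρ) (f := G) (0 : T) ?_ (hGd 0 hφd.self_of_nhds)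
      rw [hG0]; exact hnd.hasFDerivAt
    have h2' := hφ'd.hasFDerivAt.clm_apply (hasFDerivAt_const w (0 : T))
    have h2 := (h2'.smul_const ν).const_add (w : Eucl N)
    have h3 := (h1.inner ℝ h2).unique
      ((hasFDerivAt_const (0 : ℝ) (0 : T)).congr_of_eventuallyEq (htan w))
    have h4 := congrArg (fun L : T →L[ℝ] ℝ => L u) h3
    simp only [ContinuousLinearMap.comp_apply, ContinuousLinearMap.prod_apply,
      fderivInnerCLM_apply, ContinuousLinearMap.smulRight_apply, ContinuousLinearMap.flip_apply,
      hu, hφ'0, zero_apply, zero_smul, inner_zero_right, zero_add, add_zero,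
      add_apply, Submodule.subtypeL_apply] at h4
    simpa using h4
  have hTT : tangentAt ρ p = T := by
    rw [tangentAt, hT, hgν, Submodule.span_singleton_smul_eq (IsUnit.mk0 _ hg0.ne')]
  have hu' : (u : Eucl N) ∈ tangentAt ρ p := hTT ▸ u.2
  have hker : shapeOperator ρ p ⟨u, hu'⟩ = 0 := by
    have h1 : (tangentAt ρ p).orthogonalProjectionOnto (fderiv ℝ (unitNormal ρ) p u) = 0 := by
      rw [Submodule.orthogonalProjectionOnto_eq_zero_iff, Submodule.mem_orthogonal']
      intro w hw
      exact hid ⟨w, hTT ▸ hw⟩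
    simpa [shapeOperator] using h1
  have hinj : Function.Injective (shapeOperator ρ p) := by
    have : IsUnit (LinearMap.det (shapeOperator ρ p)) := isUnit_iff_ne_zero.2 hK
    exact ((LinearEquiv.ofIsUnitDet (v := Module.finBasis ℝ _) (v' := Module.finBasis ℝ _)
      (f := shapeOperator ρ p) (by rwa [LinearMap.det_toMatrix])).injective)
  have := hinj (hker.trans (map_zero _).symm)
  exact Subtype.ext (congrArg (fun w : tangentAt ρ p => (w : Eucl N)) this)

/-- A piece of a hypersurface, written as the graph of `φ` over the hyperplane `νᗮ` through `p`,
with a cutoff `χ` such that the Fourier transform of the resulting measure decays. -/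
structure GraphPatch (N : ℕ) where
  /-- base point -/
  p : Eucl N
  /-- unit normal of the hyperplane -/
  ν : Eucl N
  /-- graph function -/
  φ : (ℝ ∙ ν)ᗮ → ℝ
  /-- cutoff -/
  χ : (ℝ ∙ ν)ᗮ → ℝ
  norm_ν : ‖ν‖ = 1
  continuous_φ : Continuous φ
  continuous_χ : Continuous χ
  compact_χ : HasCompactSupport χ
  χ_nonneg : ∀ v, 0 ≤ χ v
  decay : ∃ C : ℝ, 0 ≤ C ∧ ∀ (x : (ℝ ∙ ν)ᗮ) (s : ℝ),
    ‖∫ v, χ v • Complex.exp (Complex.I * ((⟪v, x⟫_ℝ + s * φ v : ℝ) : ℂ))‖ *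
      (1 + |s|) ^ (((N : ℝ) - 1) / 2) ≤ C

/-- The parametrisation of a graph patch. -/
def GraphPatch.param (P : GraphPatch N) (v : (ℝ ∙ P.ν)ᗮ) : Eucl N := P.p + v + P.φ v • P.ν

lemma GraphPatch.continuous_param (P : GraphPatch N) : Continuous P.param := by
  have := P.continuous_φ
  unfold GraphPatch.param
  fun_prop

lemma finrank_orthogonal_unit {ν : Eucl N} (hν : ‖ν‖ = 1) :
    Module.finrank ℝ (ℝ ∙ ν)ᗮ + 1 = N := by
  have h1 := (ℝ ∙ ν).finrank_add_finrank_orthogonal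
  rw [finrank_span_singleton (by rintro rfl; simp at hν), finrank_euclideanSpace,
    Fintype.card_fin] at h1
  omega

/-- Multiplication by a bump function. Compact support provides the global derivative and Lipschitz
bounds on the phase. -/
lemma exists_contDiff_eventuallyEq {V : Type*} [NormedAddCommGroup V] [InnerProductSpace ℝ V]
    [FiniteDimensional ℝ V] {φ : V → ℝ} {m : ℕ} (hφ : ContDiffAt ℝ m φ 0) :
    ∃ φ' : V → ℝ, ContDiff ℝ m φ' ∧ HasCompactSupport φ' ∧ φ' =ᶠ[nhds 0] φ := by
  obtain ⟨u, hu, hφu⟩ := hφ.contDiffOn (m := m) le_rfl (by simp)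
  have hu' : u ∈ nhds (0 : V) := by simpa using hu
  obtain ⟨r, hr, hru⟩ := Metric.mem_nhds_iff.1 hu'
  let b : ContDiffBump (0 : V) := ⟨r / 4, r / 2, by positivity, by linarith⟩
  have hbs : tsupport b = Metric.closedBall 0 (r / 2) := b.tsupport_eq
  have hsub : tsupport (fun v => b v * φ v) ⊆ tsupport b :=
    closure_mono (Function.support_mul_subset_left _ _)
  refine ⟨fun v => b v * φ v, ?_, ?_, ?_⟩
  · refine contDiff_iff_contDiffAt.2 fun x => ?_
    by_cases hx : x ∈ tsupport (fun v => b v * φ v)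
    swap
    · exact contDiffAt_const.congr_of_eventuallyEq (notMem_tsupport_iff_eventuallyEq.1 hx)
    have hxb : x ∈ Metric.ball (0 : V) r := by
      have := hsub hx
      rw [hbs, Metric.mem_closedBall] at this
      rw [Metric.mem_ball]; linarith
    refine b.contDiff.contDiffAt.mul ?_
    refine hφu.contDiffAt (Filter.mem_of_superset (Metric.isOpen_ball.mem_nhds hxb) ?_)
    exact hru
  · exact b.hasCompactSupport.mul_right
  · filter_upwards [Metric.ball_mem_nhds (0 : V) (show 0 < r / 4 by positivity)] with v hv
    have : b v = 1 := b.one_of_mem_closedBall (Metric.ball_subset_closedBall hv)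
    simp [this]

/-- Near a point of nonzero Gauss curvature, the surface measure is dominated by the measure of a
graph patch. -/
theorem exists_graphPatch (hpS : p ∈ S) (hρ : IsLocalDefiningFunction S p ρ)
    (hK : gaussCurvature ρ p ≠ 0) :
    ∃ P : GraphPatch N, ∃ U ∈ nhds p, ∃ C : ℝ≥0∞, C ≠ ⊤ ∧ ∀ H : Eucl N → ℝ≥0∞, Measurable H →
      ∫⁻ ξ in S ∩ U, H ξ ∂(Measure.euclideanHausdorffMeasure (N - 1)) ≤
        C * ∫⁻ v, ENNReal.ofReal (P.χ v) * H (P.param v) := by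
  obtain ⟨ν, hν⟩ : ∃ ν, ν = unitNormal ρ p := ⟨_, rfl⟩
  -- Enough smoothness: the decay theorem needs more derivatives than the dimension `N - 1` of the
  -- tangent plane, and at least two.
  set m := N + 2 with hm
  obtain ⟨hν1, φ₀, hφ₀, hφ₀0, hgraph, hS⟩ := exists_graph_function hpS hρ hν m (by omega)
  have hfr := finrank_orthogonal_unit hν1
  obtain ⟨φ, hφ, hφc, hφe⟩ := exists_contDiff_eventuallyEq hφ₀
  have hinj := hessian_injective hρ hK hν hν1 rfl (hφ₀.of_le (by exact_mod_cast (by omega : 2 ≤ m)))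
    hφ₀0 hgraph
  have hfd : ContDiff ℝ 1 (fderiv ℝ φ) :=
    hφ.fderiv_right (by exact_mod_cast (by omega : 1 + 1 ≤ m))
  have hstrict : HasStrictFDerivAt (fderiv ℝ φ) (fderiv ℝ (fderiv ℝ φ) 0) 0 :=
    hfd.contDiffAt.hasStrictFDerivAt (by simp)
  obtain ⟨κ, hκ, s, hs, hexp⟩ := exists_expanding_of_injective (F := (ℝ ∙ ν)ᗮ →L[ℝ] ℝ)
    (f := fderiv ℝ φ) (f' := fderiv ℝ (fderiv ℝ φ) 0) hstrict (fun v hv => by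
      refine hinj v ?_
      rwa [← hφe.fderiv.fderiv_eq])
  obtain ⟨r, hr, hrs⟩ := Metric.mem_nhds_iff.1 hs
  -- The support radius `r/4` plus a margin `δ = r/4` remains where the gradient expands; the part
  -- of `S` to be covered lies over the ball of radius `r/8`, where `b = 1`.
  let b : ContDiffBump (0 : (ℝ ∙ ν)ᗮ) := ⟨r / 8, r / 4, by positivity, by linarith⟩
  have hbs : tsupport b = Metric.closedBall 0 (r / 4) := b.tsupport_eq
  have hball : Metric.closedBall (0 : (ℝ ∙ ν)ᗮ) (r / 4 + r / 4) ⊆ s := fun v hv => hrs (by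
    rw [Metric.mem_closedBall] at hv
    rw [Metric.mem_ball]; linarith)
  have hdecay := exists_oscillatory_decay (φ := φ) (χ := b) (m := m) (by omega) (by omega) hφ hφc
    b.contDiff (R := r / 4) (δ := r / 4) (κ := κ) (by positivity) hκ hbs.le
    (fun c hc c' hc' => hexp c (hball hc) c' (hball hc'))
  have hfr' : (Module.finrank ℝ (ℝ ∙ ν)ᗮ : ℝ) = (N : ℝ) - 1 := by
    rw [eq_sub_iff_add_eq]; exact_mod_cast hfr
  rw [hfr'] at hdecay
  let P : GraphPatch N := ⟨p, ν, φ, b, hν1, hφ.continuous, b.continuous, b.hasCompactSupport,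
    fun v => b.nonneg, hdecay⟩
  obtain ⟨K, hKlip⟩ : ∃ K, LipschitzWith K φ :=
    hφ.lipschitzWith_of_hasCompactSupport hφc (by exact_mod_cast (by omega : m ≠ 0))
  obtain ⟨L, hL⟩ : ∃ L, LipschitzWith L P.param := by
    have h1 : LipschitzWith 1 (fun v : (ℝ ∙ ν)ᗮ => p + (v : Eucl N)) :=
      LipschitzWith.of_dist_le_mul fun x y => by simp [Subtype.dist_eq]
    have h2 : LipschitzWith K (fun v : (ℝ ∙ ν)ᗮ => φ v • ν) :=
      LipschitzWith.of_dist_le_mul fun x y => by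
        rw [dist_eq_norm, ← sub_smul, norm_smul, hν1, mul_one, ← dist_eq_norm]
        exact hKlip.dist_le_mul x y
    exact ⟨_, h1.add h2⟩
  have hproj : Tendsto (fun x => (ℝ ∙ ν)ᗮ.orthogonalProjectionOnto (x - p)) (nhds p) (nhds 0) := by
    have : Continuous (fun x => (ℝ ∙ ν)ᗮ.orthogonalProjectionOnto (x - p)) := by fun_prop
    simpa using this.tendsto p
  set B := Metric.ball (0 : (ℝ ∙ ν)ᗮ) (r / 8) with hB
  have hBm : MeasurableSet B := measurableSet_ball
  refine ⟨P, _, (hS.and (hproj.eventually (hφe.and (Metric.ball_mem_nhds _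
    (show 0 < r / 8 by positivity))))), (L : ℝ≥0∞) ^ ((N - 1 : ℕ) : ℝ), by simp, ?_⟩
  intro H hH
  set U := {x | _} with hU
  have hsub : S ∩ U ⊆ P.param '' B := by
    rintro x ⟨hxS, hx1, hx2, hx3⟩
    refine ⟨_, hx3, ?_⟩
    have h1 := hx1 hxS
    rw [← hx2] at h1
    exact h1.symm
  have hpm : Measurable P.param := P.continuous_param.measurable
  -- A Lipschitz parametrisation enlarges `(N-1)`-dimensional Hausdorff measure by at most
  -- `L^(N-1)`. As only nonnegative integrands are estimated, this one-sided bound replaces the area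
  -- formula.
  have hμ : (Measure.euclideanHausdorffMeasure (N - 1) : Measure (Eucl N)).restrict (S ∩ U) ≤
      ((L : ℝ≥0∞) ^ ((N - 1 : ℕ) : ℝ)) • (volume.restrict B).map P.param := by
    refine Measure.le_iff.2 fun A hA => ?_
    rw [Measure.restrict_apply hA, Measure.smul_apply, Measure.map_apply hpm hA,
      Measure.restrict_apply (hpm hA), smul_eq_mul]
    have h1 : A ∩ (S ∩ U) ⊆ P.param '' (P.param ⁻¹' A ∩ B) := by
      rintro x ⟨hxA, hx⟩
      obtain ⟨v, hv, rfl⟩ := hsub hx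
      exact ⟨v, ⟨hxA, hv⟩, rfl⟩
    refine (measure_mono h1).trans ?_
    have h2 := hL.hausdorffMeasure_image_le (d := ((N - 1 : ℕ) : ℝ)) (by positivity)
      (P.param ⁻¹' A ∩ B)
    have h3 : (volume : Measure (ℝ ∙ ν)ᗮ) = Measure.euclideanHausdorffMeasure (N - 1) := by
      rw [← InnerProductSpace.euclideanHausdorffMeasure_eq_volume]
      congr 1
      omega
    rw [h3]
    simp only [Measure.euclideanHausdorffMeasure_def, Measure.smul_apply]
    rw [ENNReal.smul_def, ENNReal.smul_def, smul_eq_mul, smul_eq_mul, mul_left_comm]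
    gcongr
  calc ∫⁻ ξ in S ∩ U, H ξ ∂(Measure.euclideanHausdorffMeasure (N - 1))
      ≤ ∫⁻ ξ, H ξ ∂(((L : ℝ≥0∞) ^ ((N - 1 : ℕ) : ℝ)) • (volume.restrict B).map P.param) :=
        lintegral_mono' hμ le_rfl
    _ = (L : ℝ≥0∞) ^ ((N - 1 : ℕ) : ℝ) * ∫⁻ v in B, H (P.param v) := by
        rw [lintegral_smul_measure, lintegral_map hH hpm, smul_eq_mul]
    _ ≤ _ := by
        refine mul_le_mul' le_rfl ?_
        rw [← lintegral_indicator hBm]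
        refine lintegral_mono fun v => ?_
        by_cases hv : v ∈ B
        · have h1 : P.χ v = 1 := b.one_of_mem_closedBall (Metric.ball_subset_closedBall hv)
          rw [Set.indicator_of_mem hv, h1]
          simp
        · rw [Set.indicator_of_notMem hv]; exact zero_le

/-- The surface measure of a compact hypersurface with nonvanishing curvature is dominated by
finitely many graph patches. -/
theorem exists_graphPatches (hcompact : IsCompact S) (hcurv : HasNonzeroGaussCurvature S) :
    ∃ (k : ℕ) (P : Fin k → GraphPatch N) (C : ℝ≥0∞), C ≠ ⊤ ∧ ∀ H : Eucl N → ℝ≥0∞, Measurable H →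
      ∫⁻ ξ, H ξ ∂(surfaceMeasure S) ≤
        ∑ i, C * ∫⁻ v, ENNReal.ofReal ((P i).χ v) * H ((P i).param v) := by
  have hloc : ∀ p ∈ S, ∃ P : GraphPatch N, ∃ U ∈ nhds p, ∃ C : ℝ≥0∞, C ≠ ⊤ ∧
      ∀ H : Eucl N → ℝ≥0∞, Measurable H →
      ∫⁻ ξ in S ∩ U, H ξ ∂(Measure.euclideanHausdorffMeasure (N - 1)) ≤
        C * ∫⁻ v, ENNReal.ofReal (P.χ v) * H (P.param v) := by
    intro p hp
    obtain ⟨ρ, hρ, hK⟩ := hcurv p hp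
    exact exists_graphPatch hp hρ hK
  choose! P U hU C hC hle using hloc
  obtain ⟨t, htS, hcov⟩ := hcompact.elim_nhds_subcover U hU
  let e := t.equivFin.symm
  refine ⟨t.card, fun i => P (e i) (htS _ (e i).2), ∑ i, C (e i), ?_, fun H hH => ?_⟩
  · exact (ENNReal.sum_lt_top.2 fun i _ => (hC _ (htS _ (e i).2)).lt_top).ne
  have h1 : S ⊆ ⋃ i, (S ∩ U (e i)) := by
    intro x hx
    obtain ⟨p, hp, hxp⟩ := Set.mem_iUnion₂.1 (hcov hx)
    refine Set.mem_iUnion.2 ⟨e.symm ⟨p, hp⟩, hx, ?_⟩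
    simpa using hxp
  calc ∫⁻ ξ, H ξ ∂(surfaceMeasure S)
      ≤ ∫⁻ ξ in ⋃ i, (S ∩ U (e i)), H ξ ∂(Measure.euclideanHausdorffMeasure (N - 1)) :=
        lintegral_mono_set h1
    _ ≤ ∑' i, ∫⁻ ξ in S ∩ U (e i), H ξ ∂(Measure.euclideanHausdorffMeasure (N - 1)) :=
        lintegral_iUnion_le _ _
    _ = ∑ i, ∫⁻ ξ in S ∩ U (e i), H ξ ∂(Measure.euclideanHausdorffMeasure (N - 1)) :=
        tsum_fintype _
    _ ≤ _ := by
        refine Finset.sum_le_sum fun i _ => (hle _ (htS _ (e i).2) H hH).trans ?_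
        gcongr
        exact Finset.single_le_sum (f := fun i => C (e i)) (fun _ _ => zero_le)
          (Finset.mem_univ i)

end Geometry

end OrthoRestriction

end

noncomputable section

namespace OrthoRestriction

/-! ### Fourier transform, holomorphic parameter integrals, the Gamma function -/

section Tools

/-- The Fourier transform `∫ e^{-i⟨ξ,x⟩} h(x) dμ(x)`. -/
def fhat {E : Type*} [NormedAddCommGroup E] [InnerProductSpace ℝ E] [MeasurableSpace E]
    (μ : Measure E) (h : E → ℂ) (ξ : E) : ℂ :=
  ∫ x, Complex.exp (-(Complex.I * ((⟪ξ, x⟫_ℝ : ℝ) : ℂ))) * h x ∂μ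

section Plancherel

variable {E : Type*} [NormedAddCommGroup E] [InnerProductSpace ℝ E] [FiniteDimensional ℝ E]
  [MeasurableSpace E] [BorelSpace E]

-- The integral and its `L²` extension define the same tempered distribution; testing against smooth
-- compactly supported functions identifies them almost everywhere.
open FourierTransform in
lemma fourier_ae_eq_toLp {h : E → ℂ} (h1 : Integrable h) (h2 : MemLp h 2) :
    𝓕 h =ᵐ[volume] (𝓕 (h2.toLp h) : Lp ℂ 2 (volume : Measure E)) := by
  have hc : Continuous (𝓕 h) :=
    VectorFourier.fourierIntegral_continuous Real.continuous_fourierChar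
      (by exact continuous_inner) h1
  refine ae_eq_of_integral_contDiff_smul_eq hc.locallyIntegrable
    ((Lp.memLp _).locallyIntegrable (by norm_num)) fun g hg hgc => ?_
  let gs : SchwartzMap E ℂ := HasCompactSupport.toSchwartzMap (f := fun x => (g x : ℂ))
    (hgc.comp_left (g := fun x : ℝ => (x : ℂ)) (by simp)) (Complex.ofRealCLM.contDiff.comp hg)
  have hgs : ∀ x, gs x = (g x : ℂ) := fun x => rfl
  have key := congrArg (fun T => T gs) (Lp.fourier_toTemperedDistribution_eq (h2.toLp h))
  simp only [TemperedDistribution.fourier_apply, Lp.toTemperedDistribution_apply] at key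
  have hL : ∫ x, (𝓕 gs) x • (h2.toLp h : E → ℂ) x = ∫ x, (𝓕 gs) x • h x := by
    refine integral_congr_ae ?_
    filter_upwards [h2.coeFn_toLp] with x hx
    rw [hx]
  rw [hL] at key
  have hflip : ∫ x, (𝓕 gs) x • h x = ∫ x, gs x • 𝓕 h x := by
    have := VectorFourier.integral_fourierIntegral_smul_eq_flip (L := innerₗ E)
      (μ := volume) (ν := volume) (f := gs) (g := h) Real.continuous_fourierChar
      (by exact continuous_inner) gs.integrable h1
    simpa using! this
  rw [hflip] at key
  simpa [hgs] using key

open FourierTransform in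
lemma lintegral_fourier_sq {h : E → ℂ} (h1 : Integrable h) (h2 : MemLp h 2) :
    ∫⁻ w, ‖𝓕 h w‖ₑ ^ 2 = ∫⁻ x, ‖h x‖ₑ ^ 2 := by
  have e1 : eLpNorm (𝓕 h) 2 volume = eLpNorm h 2 volume := by
    rw [eLpNorm_congr_ae (fourier_ae_eq_toLp h1 h2)]
    have h3 : ‖(𝓕 (h2.toLp h) : Lp ℂ 2 (volume : Measure E))‖ₑ = ‖h2.toLp h‖ₑ := by
      rw [← ofReal_norm, ← ofReal_norm, Lp.norm_fourier_eq]
    rw [Lp.enorm_def, Lp.enorm_def] at h3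
    rw [h3, eLpNorm_congr_ae h2.coeFn_toLp]
  have e2 : ∀ f : E → ℂ, ∫⁻ w, ‖f w‖ₑ ^ 2 = eLpNorm f 2 volume ^ 2 := by
    intro f
    rw [eLpNorm_eq_lintegral_rpow_enorm_toReal (by norm_num) (by norm_num)]
    simp only [ENNReal.toReal_ofNat, one_div]
    rw [← ENNReal.rpow_natCast, ← ENNReal.rpow_mul]
    simp
  rw [e2, e2, e1]

/-- Plancherel for integrable and square integrable functions. -/
lemma lintegral_fhat_sq {h : E → ℂ} (h1 : Integrable h) (h2 : MemLp h 2) :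
    ∫⁻ ξ, ‖fhat volume h ξ‖ₑ ^ 2 =
      ENNReal.ofReal ((2 * Real.pi) ^ Module.finrank ℝ E) * ∫⁻ x, ‖h x‖ₑ ^ 2 := by
  have hpi : (0 : ℝ) < 2 * Real.pi := by positivity
  have e : ∀ w : E, fhat volume h ((2 * Real.pi) • w) = FourierTransform.fourier h w := by
    intro w
    rw [fhat, Real.fourier_eq']
    refine integral_congr_ae (Eventually.of_forall fun x => ?_)
    simp only [smul_eq_mul, inner_smul_left]
    congr 2
    rw [real_inner_comm]
    push_cast
    simp only [RCLike.conj_to_real]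
    push_cast
    ring
  rw [← lintegral_fourier_sq h1 h2]
  simp_rw [← e]
  have hemb : MeasurableEmbedding (fun w : E => (2 * Real.pi) • w) :=
    (Homeomorph.smulOfNeZero (2 * Real.pi) hpi.ne').measurableEmbedding
  rw [← hemb.lintegral_map (fun ξ => ‖fhat volume h ξ‖ₑ ^ 2),
    Measure.map_addHaar_smul volume hpi.ne', lintegral_smul_measure, smul_eq_mul, ← mul_assoc,
    ← ENNReal.ofReal_mul (by positivity), abs_of_pos (by positivity),
    mul_inv_cancel₀ (by positivity), ENNReal.ofReal_one, one_mul]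

end Plancherel

/-- Parameter integrals of exponentials are entire. -/
lemma differentiable_integral_cexp_mul {X : Type*} [MeasurableSpace X] {μ : Measure X} {G L : X → ℂ}
    (hG : Integrable G μ) (hL : AEStronglyMeasurable L μ) {B : ℝ} (hB : ∀ᵐ x ∂μ, ‖L x‖ ≤ B) :
    Differentiable ℂ (fun z : ℂ => ∫ x, Complex.exp (z * L x) * G x ∂μ) := by
  intro z₀
  have hmeas : ∀ z : ℂ, AEStronglyMeasurable (fun x => Complex.exp (z * L x) * G x) μ := fun z =>
    (Complex.continuous_exp.comp_aestronglyMeasurable (hL.const_mul z)).mul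
      hG.aestronglyMeasurable
  have hbd : ∀ z : ℂ, ∀ x, ‖L x‖ ≤ B → ‖Complex.exp (z * L x)‖ ≤ Real.exp (‖z‖ * B) := by
    intro z x hx
    refine (Complex.norm_exp_le_exp_norm _).trans (Real.exp_le_exp.2 ?_)
    rw [norm_mul]
    gcongr
  refine (hasDerivAt_integral_of_dominated_loc_of_deriv_le (μ := μ)
    (F := fun z x => Complex.exp (z * L x) * G x)
    (F' := fun z x => Complex.exp (z * L x) * L x * G x) (x₀ := z₀)
    (s := Metric.ball z₀ 1)
    (bound := fun x => Real.exp ((‖z₀‖ + 1) * B) * B * ‖G x‖)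
    (Metric.ball_mem_nhds z₀ one_pos) (Eventually.of_forall hmeas) ?_ ?_ ?_ ?_ ?_).2.differentiableAt
  · refine (hG.norm.const_mul (Real.exp (‖z₀‖ * B))).mono' (hmeas z₀) ?_
    filter_upwards [hB] with x hx
    rw [norm_mul]
    gcongr
    exact hbd z₀ x hx
  · exact ((Complex.continuous_exp.comp_aestronglyMeasurable (hL.const_mul z₀)).mul hL).mul
      hG.aestronglyMeasurable
  · filter_upwards [hB] with x hx z hz
    have hB0 : 0 ≤ B := (norm_nonneg _).trans hx
    have hz' : ‖z‖ ≤ ‖z₀‖ + 1 := by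
      have h1 : ‖z - z₀‖ < 1 := by simpa [dist_eq_norm] using hz
      have h2 := norm_add_le z₀ (z - z₀)
      rw [add_sub_cancel] at h2
      linarith
    rw [norm_mul, norm_mul]
    gcongr
    exact (hbd z x hx).trans (Real.exp_le_exp.2 (by gcongr))
  · exact hG.norm.const_mul _
  · filter_upwards with x z _
    have h1 : HasDerivAt (fun z : ℂ => z * L x) (L x) z := by
      simpa using (hasDerivAt_id z).mul_const (L x)
    exact h1.cexp.mul_const (G x)

section Gamma

-- The reflection formula gives `|Γ(1+iσ)|² = πσ / sinh(πσ)`, and `sinh x ≤ x e^x` for `x ≥ 0`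
-- bounds this below. The rate is not sharp; any exponential rate is admissible for the
-- interpolation.
open Complex in
lemma norm_inv_Gamma_le (σ : ℝ) : ‖(Gamma (1 + I * σ))⁻¹‖ ≤ Real.exp (Real.pi * |σ|) := by
  rcases eq_or_ne σ 0 with rfl | hσ
  · simp
  have hz : (I * σ : ℂ) ≠ 0 := by simp [hσ]
  have h1 : Gamma (1 + I * σ) = I * σ * Gamma (I * σ) := by
    rw [add_comm]; exact Gamma_add_one _ hz
  have h2 := Gamma_mul_Gamma_one_sub (I * σ)
  have h3 : Gamma (1 - I * σ) = (starRingEnd ℂ) (Gamma (1 + I * σ)) := by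
    rw [← Gamma_conj]
    congr 1
    simp [sub_eq_add_neg]
  set g := Gamma (1 + I * σ) with hg
  have h4 : ‖g‖ ^ 2 = |Real.pi * σ| / ‖sin (Real.pi * (I * σ))‖ := by
    have : g * (starRingEnd ℂ) g = I * σ * (Real.pi / sin (Real.pi * (I * σ))) := by
      rw [← h2, ← h3, h1]; ring
    have h5 := congrArg norm this
    rw [norm_mul, RCLike.norm_conj] at h5
    rw [sq, h5]
    simp [abs_mul]
    ring
  have h5 : ‖sin (Real.pi * (I * σ))‖ = Real.sinh |Real.pi * σ| := by
    have e1 : (Real.pi * (I * σ) : ℂ) = ((Real.pi * σ : ℝ) : ℂ) * I := by push_cast; ring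
    rw [e1, sin_mul_I, norm_mul, norm_I, mul_one, ← ofReal_sinh, norm_real, Real.norm_eq_abs,
      Real.abs_sinh]
  have hx : 0 < |Real.pi * σ| := abs_pos.2 (mul_ne_zero Real.pi_ne_zero hσ)
  have h6 : Real.sinh |Real.pi * σ| ≤ |Real.pi * σ| * Real.exp |Real.pi * σ| := by
    set x := |Real.pi * σ|
    have e1 : 1 - 2 * x ≤ Real.exp (-(2 * x)) := by
      have := Real.add_one_le_exp (-(2 * x)); linarith
    have e2 : Real.exp (-x) = Real.exp x * Real.exp (-(2 * x)) := by
      rw [← Real.exp_add]; congr 1; ring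
    rw [Real.sinh_eq, e2]
    have := Real.exp_pos x
    nlinarith
  have hs0 : 0 < Real.sinh |Real.pi * σ| := Real.sinh_pos_iff.2 hx
  have h7 : Real.exp (-|Real.pi * σ|) ≤ ‖g‖ ^ 2 := by
    rw [h4, h5, le_div_iff₀ hs0, Real.exp_neg, inv_mul_le_iff₀ (Real.exp_pos _)]
    linarith
  have h8 : Real.exp (-(Real.pi * |σ|)) ≤ ‖g‖ := by
    have e1 : |Real.pi * σ| = Real.pi * |σ| := by rw [abs_mul, abs_of_pos Real.pi_pos]
    rw [e1] at h7
    have e3 : Real.exp (-(Real.pi * |σ|)) ^ 2 ≤ Real.exp (-(Real.pi * |σ|)) := by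
      have : Real.exp (-(Real.pi * |σ|)) ≤ 1 := Real.exp_le_one_iff.2 (by
        have := Real.pi_pos; have := abs_nonneg σ; simp; positivity)
      have := Real.exp_pos (-(Real.pi * |σ|))
      nlinarith
    exact le_of_sq_le_sq (e3.trans h7) (norm_nonneg _)
  rw [norm_inv]
  refine inv_le_of_inv_le₀ (Real.exp_pos _) ?_
  rwa [← Real.exp_neg]

/-- The Gamma integral with a complex rate. -/
lemma integral_cpow_mul_exp_neg_complex {r : ℂ} (hr : 0 < r.re) (σ : ℝ) :
    ∫ t in Set.Ioi (0 : ℝ), (t : ℂ) ^ (Complex.I * σ) * Complex.exp (-(r * t)) =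
      (1 / r) ^ (1 + Complex.I * σ) * Complex.Gamma (1 + Complex.I * σ) := by
  set U : Set ℂ := {r | 0 < r.re} with hU
  have hUo : IsOpen U := isOpen_lt continuous_const Complex.continuous_re
  have hnorm : ∀ t ∈ Set.Ioi (0 : ℝ), ‖(t : ℂ) ^ (Complex.I * σ)‖ = 1 := by
    intro t ht
    rw [Complex.norm_cpow_eq_rpow_re_of_pos ht]
    simp
  have hmeas1 : AEStronglyMeasurable (fun t : ℝ => (t : ℂ) ^ (Complex.I * σ))
      (volume.restrict (Set.Ioi 0)) := by
    have : Measurable (fun t : ℝ => (t : ℂ) ^ (Complex.I * σ)) := by fun_prop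
    exact this.aestronglyMeasurable
  have hexp : ∀ (r : ℂ) (t : ℝ), ‖Complex.exp (-(r * t))‖ = Real.exp (-(r.re * t)) := by
    intro r t
    rw [Complex.norm_exp]
    simp
  have hdiff : DifferentiableOn ℂ (fun r : ℂ => ∫ t in Set.Ioi (0 : ℝ),
      (t : ℂ) ^ (Complex.I * σ) * Complex.exp (-(r * t))) U := by
    intro r₀ hr₀
    have hr₀' : 0 < r₀.re := hr₀
    refine DifferentiableAt.differentiableWithinAt ?_
    set c := r₀.re / 2 with hc
    have hc0 : 0 < c := by positivity
    refine (hasDerivAt_integral_of_dominated_loc_of_deriv_le (μ := volume.restrict (Set.Ioi 0))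
      (F := fun r (t : ℝ) => (t : ℂ) ^ (Complex.I * σ) * Complex.exp (-(r * t)))
      (F' := fun r (t : ℝ) => (t : ℂ) ^ (Complex.I * σ) * (Complex.exp (-(r * t)) * (-t)))
      (x₀ := r₀) (s := {r : ℂ | c < r.re}) (bound := fun t => Real.exp (-c * t) * t)
      ((isOpen_lt continuous_const Complex.continuous_re).mem_nhds (by
        change c < r₀.re; linarith)) ?_ ?_ ?_ ?_ ?_ ?_).2.differentiableAt
    · exact Eventually.of_forall fun r => hmeas1.mul (by fun_prop)
    · have h1 : IntegrableOn (fun t : ℝ => Real.exp (-r₀.re * t)) (Set.Ioi 0) :=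
        exp_neg_integrableOn_Ioi 0 hr₀'
      refine Integrable.mono' h1 (hmeas1.mul (by fun_prop)) ?_
      filter_upwards [ae_restrict_mem measurableSet_Ioi] with t ht
      rw [norm_mul, hnorm t ht, hexp, one_mul, neg_mul]
    · exact hmeas1.mul (by fun_prop)
    · filter_upwards [ae_restrict_mem measurableSet_Ioi] with t ht r hr
      have ht0 : (0 : ℝ) < t := ht
      have hr' : c < r.re := hr
      rw [norm_mul, hnorm t ht, norm_mul, hexp, one_mul, norm_neg, Complex.norm_real,
        Real.norm_of_nonneg ht0.le]
      gcongr
      nlinarith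
    · have := integrableOn_rpow_mul_exp_neg_mul_rpow (p := 1) (s := 1) (b := c) (by norm_num)
        one_pos hc0
      refine this.congr_fun (fun t _ => ?_) measurableSet_Ioi
      simp [mul_comm]
    · filter_upwards with t r _
      have h1 : HasDerivAt (fun r : ℂ => -(r * t)) (-(t : ℂ)) r := by
        simpa using! ((hasDerivAt_id r).mul_const (t : ℂ)).fun_neg
      exact h1.cexp.const_mul _
  have hdiff2 : DifferentiableOn ℂ (fun r : ℂ => (1 / r) ^ (1 + Complex.I * σ) *
      Complex.Gamma (1 + Complex.I * σ)) U := by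
    intro r hr
    have hr' : 0 < r.re := hr
    have hr0 : r ≠ 0 := by rintro rfl; simp at hr'
    refine DifferentiableAt.differentiableWithinAt ?_
    refine DifferentiableAt.mul_const ?_ _
    refine DifferentiableAt.cpow_const ((differentiableAt_const _).div differentiableAt_id hr0) ?_
    left
    rw [one_div, Complex.inv_re]
    exact div_pos hr' (Complex.normSq_pos.2 hr0)
  have hconn : IsPreconnected U := (convex_halfSpace_re_gt 0).isPreconnected
  have heq : Set.EqOn (fun r : ℂ => ∫ t in Set.Ioi (0 : ℝ),
      (t : ℂ) ^ (Complex.I * σ) * Complex.exp (-(r * t))) (fun r : ℂ => (1 / r) ^ (1 + Complex.I * σ) *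
      Complex.Gamma (1 + Complex.I * σ)) U := by
    -- Identity theorem: both sides are holomorphic on the right half-plane and agree at the real
    -- points `1 + 1/(n+1)`, which accumulate at `1`.
    refine (hdiff.analyticOnNhd hUo).eqOn_of_preconnected_of_frequently_eq
      (hdiff2.analyticOnNhd hUo) hconn (z₀ := 1) (by simp [hU]) ?_
    have hseq : Tendsto (fun n : ℕ => ((1 + 1 / (n + 1 : ℝ) : ℝ) : ℂ)) atTop (nhdsWithin 1 {1}ᶜ) := by
      refine tendsto_nhdsWithin_iff.2 ⟨?_, Eventually.of_forall fun n => ?_⟩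
      · have : Tendsto (fun n : ℕ => (1 + 1 / (n + 1 : ℝ) : ℝ)) atTop (nhds (1 + 0)) :=
          tendsto_const_nhds.add tendsto_one_div_add_atTop_nhds_zero_nat
        rw [add_zero] at this
        have h2 := (Complex.continuous_ofReal.tendsto 1).comp this
        rw [Complex.ofReal_one] at h2
        exact h2
      · have : (0 : ℝ) < 1 / (n + 1 : ℝ) := by positivity
        simp only [Set.mem_compl_iff, Set.mem_singleton_iff]
        intro h
        have h2 : (1 + 1 / (n + 1 : ℝ) : ℝ) = 1 := by exact_mod_cast h
        linarith
    refine hseq.frequently (Frequently.of_forall fun n => ?_)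
    have hp : (0 : ℝ) < 1 + 1 / (n + 1 : ℝ) := by positivity
    have := Complex.integral_cpow_mul_exp_neg_mul_Ioi (a := 1 + Complex.I * σ)
      (r := 1 + 1 / (n + 1 : ℝ)) (by simp) hp
    simpa using! this
  exact heq hr

end Gamma

end Tools

end OrthoRestriction

end

noncomputable section

namespace OrthoRestriction

variable {N : ℕ}

/-! ### Translates of a graph in the normal direction -/

section Shear

/-- Orthogonal coordinates along and across a unit vector preserve Lebesgue measure. -/
lemma measurePreserving_add_smul {ν : Eucl N} (hν : ‖ν‖ = 1) :
    MeasurePreserving (fun w : (ℝ ∙ ν)ᗮ × ℝ => (w.1 : Eucl N) + w.2 • ν) := by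
  let f : WithLp 2 ((ℝ ∙ ν)ᗮ × ℝ) →ₗᵢ[ℝ] Eucl N :=
    { toFun := fun w => (w.fst : Eucl N) + w.snd • ν
      map_add' := fun a b => by simp [add_smul]; abel
      map_smul' := fun c a => by simp [mul_smul]
      norm_map' := fun w => by
        have h0 : ⟪(w.fst : Eucl N), ν⟫_ℝ = 0 := by
          rw [real_inner_comm]
          exact Submodule.mem_orthogonal_singleton_iff_inner_right.1 w.fst.2
        have h1 : ‖(w.fst : Eucl N) + w.snd • ν‖ ^ 2 = ‖w‖ ^ 2 := by
          rw [norm_add_sq_real, inner_smul_right, h0, norm_smul, hν, WithLp.prod_norm_sq_eq_of_L2]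
          simp
        change ‖(w.fst : Eucl N) + w.snd • ν‖ = ‖w‖
        exact (sq_eq_sq₀ (norm_nonneg _) (norm_nonneg _)).1 h1 }
  have hfin : Module.finrank ℝ (WithLp 2 ((ℝ ∙ ν)ᗮ × ℝ)) = Module.finrank ℝ (Eucl N) := by
    rw [(WithLp.linearEquiv 2 ℝ ((ℝ ∙ ν)ᗮ × ℝ)).finrank_eq, Module.finrank_prod,
      Module.finrank_self, finrank_orthogonal_unit hν, finrank_euclideanSpace, Fintype.card_fin]
  have h1 := (f.toLinearIsometryEquiv hfin).measurePreserving.comp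
    (WithLp.volume_preserving_toLp (ℝ ∙ ν)ᗮ ℝ)
  exact h1

/-- In orthogonal coordinates the map is `(v, t) ↦ p + v + (φ v - t) ν`. For fixed `v` the variable
`t` is only reflected and translated, so the Jacobian has modulus one. -/
lemma GraphPatch.lintegral_param_sub (P : GraphPatch N) {H : Eucl N → ℝ≥0∞} (hH : Measurable H) :
    ∫⁻ w : (ℝ ∙ P.ν)ᗮ × ℝ, H (P.param w.1 - w.2 • P.ν) ∂(volume.prod volume) = ∫⁻ x, H x := by
  have hc := P.continuous_param
  rw [lintegral_prod _ (by
    refine (hH.comp ?_).aemeasurable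
    have : Continuous fun w : (ℝ ∙ P.ν)ᗮ × ℝ => P.param w.1 - w.2 • P.ν := by fun_prop
    exact this.measurable)]
  have h1 : ∀ v : (ℝ ∙ P.ν)ᗮ, ∫⁻ t : ℝ, H (P.param v - t • P.ν) =
      ∫⁻ t : ℝ, H (P.p + ((v : Eucl N) + t • P.ν)) := by
    intro v
    rw [← lintegral_sub_left_eq_self (fun t : ℝ => H (P.p + ((v : Eucl N) + t • P.ν))) (P.φ v)]
    refine lintegral_congr fun t => ?_
    rw [GraphPatch.param, sub_smul]
    congr 1
    abel
  simp only [h1]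
  have hm : Measurable fun x => H (P.p + x) := hH.comp (measurable_const_add _)
  have h2 := (measurePreserving_add_smul P.norm_ν).lintegral_comp hm
  rw [lintegral_add_left_eq_self H P.p] at h2
  rw [← h2, Measure.volume_eq_prod, lintegral_prod]
  refine (hm.comp ?_).aemeasurable
  have : Continuous fun w : (ℝ ∙ P.ν)ᗮ × ℝ => (w.1 : Eucl N) + w.2 • P.ν := by fun_prop
  exact this.measurable

end Shear

/-! ### Sesquilinear forms on the Fourier side -/

section Forms

variable {E : Type*} [NormedAddCommGroup E] [InnerProductSpace ℝ E] [MeasurableSpace E]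
  [BorelSpace E]

lemma continuous_fhat {μ : Measure E} {h : E → ℂ} (hh : Integrable h μ) :
    Continuous (fhat μ h) := by
  refine continuous_of_dominated (bound := fun x => ‖h x‖) ?_ ?_ hh.norm ?_
  · intro ξ
    refine AEStronglyMeasurable.mul (Continuous.aestronglyMeasurable (by fun_prop))
      hh.aestronglyMeasurable
  · intro ξ
    refine Eventually.of_forall fun x => ?_
    rw [norm_mul, ← mul_neg, mul_comm Complex.I, ← Complex.ofReal_neg, Complex.norm_exp_ofReal_mul_I,
      one_mul]
  · refine Eventually.of_forall fun x => by fun_prop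

/-- A form with a bounded symbol on the Fourier side. -/
lemma enorm_integral_conj_fhat_le {Z : Type*} [MeasurableSpace Z] {m : Measure Z}
    {μ : Measure E} {c : Z → ℂ} {Q : Z → E} (hQ : Measurable Q)
    {h₁ h₂ : E → ℂ} (hh₁ : Integrable h₁ μ) (hh₂ : Integrable h₂ μ) {M : ℝ≥0∞}
    (hM : ∀ᵐ z ∂m, ‖c z‖ₑ ≤ M) :
    ‖∫ z, c z * ((starRingEnd ℂ) (fhat μ h₁ (Q z)) * fhat μ h₂ (Q z)) ∂m‖ₑ ≤
      M * (∫⁻ z, ‖fhat μ h₁ (Q z)‖ₑ ^ 2 ∂m + ∫⁻ z, ‖fhat μ h₂ (Q z)‖ₑ ^ 2 ∂m) := by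
  have hm : ∀ {h : E → ℂ}, Integrable h μ → Measurable fun z => ‖fhat μ h (Q z)‖ₑ ^ 2 := by
    intro h hh
    exact (((continuous_fhat hh).measurable.comp hQ).enorm).pow_const 2
  refine (enorm_integral_le_lintegral_enorm _).trans ?_
  rw [← lintegral_add_left (hm hh₁), ← lintegral_const_mul _ ((hm hh₁).fun_add (hm hh₂))]
  refine lintegral_mono_ae ?_
  filter_upwards [hM] with z hz
  rw [enorm_mul, enorm_mul, RCLike.enorm_conj]
  refine mul_le_mul' hz ?_
  set a := ‖fhat μ h₁ (Q z)‖ₑ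
  set b := ‖fhat μ h₂ (Q z)‖ₑ
  rcases le_total a b with h | h
  · calc a * b ≤ b * b := by gcongr
      _ = b ^ 2 := (sq b).symm
      _ ≤ a ^ 2 + b ^ 2 := le_add_self
  · calc a * b ≤ a * a := by gcongr
      _ = a ^ 2 := (sq a).symm
      _ ≤ a ^ 2 + b ^ 2 := le_self_add

variable [SecondCountableTopology E]

/-- The sesquilinear form of a convolution operator, diagonalised by the Fourier transform. -/
lemma integral_conj_mul_mul_kernel {Z : Type*} [MeasurableSpace Z] {m : Measure Z} [SFinite m]
    {μ : Measure E} [SFinite μ] {c : Z → ℂ} (hc : Integrable c m) {Q : Z → E} (hQ : Measurable Q)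
    {h₁ h₂ : E → ℂ} (hh₁ : Integrable h₁ μ) (hh₂ : Integrable h₂ μ) :
    ∫ w : E × E, (starRingEnd ℂ) (h₁ w.1) * h₂ w.2 *
        (∫ z, c z * Complex.exp (Complex.I * ((⟪Q z, w.1 - w.2⟫_ℝ : ℝ) : ℂ)) ∂m) ∂(μ.prod μ) =
      ∫ z, c z * ((starRingEnd ℂ) (fhat μ h₁ (Q z)) * fhat μ h₂ (Q z)) ∂m := by
  have hconj : Integrable (fun x => (starRingEnd ℂ) (h₁ x)) μ :=
    (Complex.conjCLE.toContinuousLinearMap.integrable_comp hh₁)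
  have h_integrable : Integrable (fun p : (E × E) × Z =>
      (starRingEnd ℂ) (h₁ p.1.1) * h₂ p.1.2 *
        (c p.2 * Complex.exp (Complex.I * ((⟪Q p.2, p.1.1 - p.1.2⟫_ℝ : ℝ) : ℂ))))
      ((μ.prod μ).prod m) := by
    have h0 := (hconj.mul_prod hh₂).mul_prod hc
    have h1 : AEStronglyMeasurable (fun p : (E × E) × Z =>
        Complex.exp (Complex.I * ((⟪Q p.2, p.1.1 - p.1.2⟫_ℝ : ℝ) : ℂ)))
        ((μ.prod μ).prod m) := by
      refine Measurable.aestronglyMeasurable ?_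
      have : Measurable fun p : (E × E) × Z => ⟪Q p.2, p.1.1 - p.1.2⟫_ℝ := by
        refine Measurable.inner (hQ.comp measurable_snd) ?_
        exact (measurable_fst.comp measurable_fst).sub (measurable_snd.comp measurable_fst)
      fun_prop
    refine (h0.mul_bdd (c := 1) h1 (Eventually.of_forall fun p => ?_)).congr
      (Eventually.of_forall fun p => ?_)
    · rw [mul_comm Complex.I, Complex.norm_exp_ofReal_mul_I]
    · simp only; ring
  have h1 : ∀ w : E × E, (starRingEnd ℂ) (h₁ w.1) * h₂ w.2 *
        (∫ z, c z * Complex.exp (Complex.I * ((⟪Q z, w.1 - w.2⟫_ℝ : ℝ) : ℂ)) ∂m) =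
      ∫ z, (starRingEnd ℂ) (h₁ w.1) * h₂ w.2 *
        (c z * Complex.exp (Complex.I * ((⟪Q z, w.1 - w.2⟫_ℝ : ℝ) : ℂ))) ∂m := fun w =>
    (integral_const_mul _ _).symm
  simp only [h1]
  rw [integral_integral_swap h_integrable]
  refine integral_congr_ae (Eventually.of_forall fun z => ?_)
  simp only
  have h2 : (starRingEnd ℂ) (fhat μ h₁ (Q z)) =
      ∫ x, Complex.exp (Complex.I * ((⟪Q z, x⟫_ℝ : ℝ) : ℂ)) * (starRingEnd ℂ) (h₁ x) ∂μ := by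
    rw [fhat, ← integral_conj]
    refine integral_congr_ae (Eventually.of_forall fun x => ?_)
    simp [← Complex.exp_conj]
  rw [h2, fhat, ← integral_prod_mul, ← integral_const_mul]
  refine integral_congr_ae (Eventually.of_forall fun w => ?_)
  simp only
  rw [inner_sub_right, Complex.ofReal_sub, mul_sub, sub_eq_add_neg, Complex.exp_add]
  ring

end Forms

lemma lintegral_fhat_restrict_sq {A : Set (Eucl N)} (hA : MeasurableSet A) {h : Eucl N → ℂ}
    (h1 : Integrable h (volume.restrict A)) (h2 : MemLp h 2 (volume.restrict A)) :
    ∫⁻ ξ, ‖fhat (volume.restrict A) h ξ‖ₑ ^ 2 =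
      ENNReal.ofReal ((2 * Real.pi) ^ N) * ∫⁻ x in A, ‖h x‖ₑ ^ 2 := by
  have h3 : ∀ ξ, fhat (volume.restrict A) h ξ = fhat volume (A.indicator h) ξ := by
    intro ξ
    rw [fhat, fhat, ← integral_indicator hA]
    congr 1
    ext x
    by_cases hx : x ∈ A <;> simp [hx]
  simp only [h3]
  rw [lintegral_fhat_sq ((integrable_indicator_iff hA).2 h1) ((memLp_indicator_iff_restrict hA).2 h2),
    finrank_euclideanSpace, Fintype.card_fin, ← lintegral_indicator hA]
  congr 2
  ext x
  by_cases hx : x ∈ A <;> simp [hx]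

/-! ### The kernel of a patch and its oscillating modification -/

section Kernel

/-- The Fourier transform of the measure carried by a graph patch. -/
def GraphPatch.kern (P : GraphPatch N) (x : Eucl N) : ℂ :=
  ∫ v, (P.χ v : ℂ) * Complex.exp (Complex.I * ((⟪P.param v, x⟫_ℝ : ℝ) : ℂ))

lemma GraphPatch.integrable_χ (P : GraphPatch N) : Integrable fun v => (P.χ v : ℂ) :=
  (P.continuous_χ.integrable_of_hasCompactSupport P.compact_χ).ofReal

lemma GraphPatch.continuous_kern (P : GraphPatch N) : Continuous P.kern := by
  have hc := P.continuous_param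
  refine continuous_of_dominated (bound := fun v => ‖(P.χ v : ℂ)‖) ?_ ?_ P.integrable_χ.norm ?_
  · intro x
    exact P.integrable_χ.aestronglyMeasurable.mul (Continuous.aestronglyMeasurable (by fun_prop))
  · intro x
    refine Eventually.of_forall fun v => ?_
    rw [norm_mul, mul_comm Complex.I, Complex.norm_exp_ofReal_mul_I, mul_one]
  · exact Eventually.of_forall fun v => by fun_prop

/-- Splitting `x` along and across `ν` turns the phase into a linear term plus `⟪ν, x⟫ φ`, up to a
unimodular factor from the base point. Uniformity of the oscillatory bound in the linear term
absorbs the tangential component. -/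
lemma GraphPatch.exists_kern_decay (P : GraphPatch N) : ∃ C : ℝ, 0 ≤ C ∧ ∀ x,
    ‖P.kern x‖ * (1 + |⟪P.ν, x⟫_ℝ|) ^ (((N : ℝ) - 1) / 2) ≤ C := by
  obtain ⟨C, hC, h⟩ := P.decay
  refine ⟨C, hC, fun x => ?_⟩
  refine le_of_eq_of_le ?_ (h ((ℝ ∙ P.ν)ᗮ.orthogonalProjectionOnto x) ⟪P.ν, x⟫_ℝ)
  congr 1
  have h1 : P.kern x = Complex.exp (Complex.I * ((⟪P.p, x⟫_ℝ : ℝ) : ℂ)) *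
      ∫ v, P.χ v • Complex.exp (Complex.I * ((⟪v, (ℝ ∙ P.ν)ᗮ.orthogonalProjectionOnto x⟫_ℝ +
        ⟪P.ν, x⟫_ℝ * P.φ v : ℝ) : ℂ)) := by
    rw [GraphPatch.kern, ← integral_const_mul]
    refine integral_congr_ae (Eventually.of_forall fun v => ?_)
    have h2 : ⟪P.param v, x⟫_ℝ = ⟪P.p, x⟫_ℝ +
        (⟪v, (ℝ ∙ P.ν)ᗮ.orthogonalProjectionOnto x⟫_ℝ + ⟪P.ν, x⟫_ℝ * P.φ v) := by
      rw [GraphPatch.param, inner_add_left, inner_add_left, real_inner_smul_left,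
        Submodule.inner_orthogonalProjectionOnto_eq_of_mem_left]
      ring
    simp only
    rw [h2, Complex.real_smul, Complex.ofReal_add, mul_add, Complex.exp_add]
    ring
  rw [h1, norm_mul, mul_comm Complex.I, Complex.norm_exp_ofReal_mul_I, one_mul]

/-- For `r = 1 + i⟪ν, x⟫`, the integral of `t^(iσ) e^(-rt)` is a Gamma factor times `(1/r)^(1+iσ)`.
The part `e^(-it⟪ν,x⟫)` of `e^(-rt)` shifts the patch by `-tν`, so the surface measure is smeared
into a density on `ℝ^N`. -/
lemma GraphPatch.kern_mul_cpow (P : GraphPatch N) (σ : ℝ) (x : Eucl N) :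
    P.kern x * (1 / (1 + Complex.I * (⟪P.ν, x⟫_ℝ : ℝ))) ^ (1 + Complex.I * σ) =
      (Complex.Gamma (1 + Complex.I * σ))⁻¹ * ∫ z : (ℝ ∙ P.ν)ᗮ × ℝ,
        ((P.χ z.1 : ℂ) * ((z.2 : ℂ) ^ (Complex.I * σ) * Complex.exp (-(z.2 : ℂ)))) *
          Complex.exp (Complex.I * ((⟪P.param z.1 - z.2 • P.ν, x⟫_ℝ : ℝ) : ℂ))
          ∂((volume : Measure (ℝ ∙ P.ν)ᗮ).prod (volume.restrict (Set.Ioi 0))) := by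
  set r : ℂ := 1 + Complex.I * (⟪P.ν, x⟫_ℝ : ℝ) with hr
  have hr0 : 0 < r.re := by simp [hr]
  have hΓ : Complex.Gamma (1 + Complex.I * σ) ≠ 0 :=
    Complex.Gamma_ne_zero_of_re_pos (by simp)
  have h1 : ∀ z : (ℝ ∙ P.ν)ᗮ × ℝ,
      ((P.χ z.1 : ℂ) * ((z.2 : ℂ) ^ (Complex.I * σ) * Complex.exp (-(z.2 : ℂ)))) *
          Complex.exp (Complex.I * ((⟪P.param z.1 - z.2 • P.ν, x⟫_ℝ : ℝ) : ℂ)) =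
      ((P.χ z.1 : ℂ) * Complex.exp (Complex.I * ((⟪P.param z.1, x⟫_ℝ : ℝ) : ℂ))) *
        ((z.2 : ℂ) ^ (Complex.I * σ) * Complex.exp (-(r * z.2))) := by
    intro z
    have h2 : Complex.exp (-(z.2 : ℂ)) *
          Complex.exp (Complex.I * ((⟪P.param z.1 - z.2 • P.ν, x⟫_ℝ : ℝ) : ℂ)) =
        Complex.exp (Complex.I * ((⟪P.param z.1, x⟫_ℝ : ℝ) : ℂ)) * Complex.exp (-(r * z.2)) := by
      rw [← Complex.exp_add, ← Complex.exp_add, inner_sub_left, real_inner_smul_left, hr]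
      congr 1
      push_cast
      ring
    linear_combination ((P.χ z.1 : ℂ) * (z.2 : ℂ) ^ (Complex.I * σ)) * h2
  simp only [h1]
  rw [integral_prod_mul (fun v => (P.χ v : ℂ) * Complex.exp (Complex.I *
      ((⟪P.param v, x⟫_ℝ : ℝ) : ℂ))) (fun t : ℝ => (t : ℂ) ^ (Complex.I * σ) *
        Complex.exp (-(r * t))), integral_cpow_mul_exp_neg_complex hr0, ← GraphPatch.kern]
  field_simp

/-- The oscillating modification of the kernel is bounded on `L²`. -/
lemma GraphPatch.exists_form_bound (P : GraphPatch N) : ∃ C : ℝ, 0 ≤ C ∧ ∀ (σ : ℝ)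
    {A : Set (Eucl N)}, MeasurableSet A → ∀ {h₁ h₂ : Eucl N → ℂ},
    Integrable h₁ (volume.restrict A) → MemLp h₁ 2 (volume.restrict A) →
    Integrable h₂ (volume.restrict A) → MemLp h₂ 2 (volume.restrict A) →
    ‖∫ w : Eucl N × Eucl N, (starRingEnd ℂ) (h₁ w.1) * h₂ w.2 * (P.kern (w.1 - w.2) *
      (1 / (1 + Complex.I * (⟪P.ν, w.1 - w.2⟫_ℝ : ℝ))) ^ (1 + Complex.I * σ))
      ∂((volume.restrict A).prod (volume.restrict A))‖ₑ ≤
      ENNReal.ofReal (C * Real.exp (Real.pi * |σ|)) *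
        ((∫⁻ x in A, ‖h₁ x‖ₑ ^ 2) + ∫⁻ x in A, ‖h₂ x‖ₑ ^ 2) := by
  obtain ⟨M, hM⟩ := P.compact_χ.exists_bound_of_continuous P.continuous_χ
  have hM0 : 0 ≤ M := (norm_nonneg _).trans (hM 0)
  refine ⟨M * (2 * Real.pi) ^ N, by positivity, fun σ A hA h₁ h₂ i₁ m₁ i₂ m₂ => ?_⟩
  have hcont : Continuous fun z : (ℝ ∙ P.ν)ᗮ × ℝ => P.param z.1 - z.2 • P.ν := by
    have := P.continuous_param
    fun_prop
  have hnorm : ∀ t ∈ Set.Ioi (0 : ℝ), ‖(t : ℂ) ^ (Complex.I * σ)‖ = 1 := by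
    intro t ht
    rw [Complex.norm_cpow_eq_rpow_re_of_pos ht]
    simp
  have hexp : ∀ t : ℝ, ‖Complex.exp (-(t : ℂ))‖ = Real.exp (-t) := by
    intro t
    rw [Complex.norm_exp]
    simp
  have hc : Integrable (fun z : (ℝ ∙ P.ν)ᗮ × ℝ =>
      (P.χ z.1 : ℂ) * ((z.2 : ℂ) ^ (Complex.I * σ) * Complex.exp (-(z.2 : ℂ))))
      ((volume : Measure (ℝ ∙ P.ν)ᗮ).prod (volume.restrict (Set.Ioi 0))) := by
    refine P.integrable_χ.mul_prod (g := fun t : ℝ => (t : ℂ) ^ (Complex.I * σ) *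
      Complex.exp (-(t : ℂ))) ?_
    have h1 : IntegrableOn (fun t : ℝ => Real.exp (-1 * t)) (Set.Ioi 0) :=
      exp_neg_integrableOn_Ioi 0 one_pos
    refine Integrable.mono' h1 (Measurable.aestronglyMeasurable (by fun_prop)) ?_
    filter_upwards [ae_restrict_mem measurableSet_Ioi] with t ht
    rw [norm_mul, hnorm t ht, hexp, one_mul, neg_one_mul]
  -- For `t > 0` one has `|t^(iσ)| = 1` and `e^(-t) ≤ 1`, so the density is bounded independently of
  -- `σ`; the shear and Plancherel finish. The dependence on `σ` comes from the Gamma factor alone.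
  have hcb : ∀ᵐ z ∂((volume : Measure (ℝ ∙ P.ν)ᗮ).prod (volume.restrict (Set.Ioi (0 : ℝ)))),
      ‖(P.χ z.1 : ℂ) * ((z.2 : ℂ) ^ (Complex.I * σ) * Complex.exp (-(z.2 : ℂ)))‖ₑ ≤
        ENNReal.ofReal M := by
    have h1 : ∀ᵐ z ∂((volume : Measure (ℝ ∙ P.ν)ᗮ).prod (volume.restrict (Set.Ioi (0 : ℝ)))),
        z.2 ∈ Set.Ioi (0 : ℝ) :=
      Measure.quasiMeasurePreserving_snd.ae (ae_restrict_mem measurableSet_Ioi)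
    filter_upwards [h1] with z hz
    rw [← ofReal_norm]
    refine ENNReal.ofReal_le_ofReal ?_
    rw [norm_mul, norm_mul, hnorm _ hz, hexp, Complex.norm_real, one_mul]
    have h2 : Real.exp (-z.2) ≤ 1 := Real.exp_le_one_iff.2 (by simpa using (le_of_lt hz))
    calc ‖P.χ z.1‖ * Real.exp (-z.2) ≤ M * 1 := by
          gcongr
          exact hM _
      _ = M := mul_one M
  simp only [P.kern_mul_cpow σ]
  have h3 := integral_conj_mul_mul_kernel hc hcont.measurable i₁ i₂
  have h4 : ∀ h : Eucl N → ℂ, Integrable h (volume.restrict A) → MemLp h 2 (volume.restrict A) →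
      ∫⁻ z : (ℝ ∙ P.ν)ᗮ × ℝ, ‖fhat (volume.restrict A) h (P.param z.1 - z.2 • P.ν)‖ₑ ^ 2
        ∂((volume : Measure (ℝ ∙ P.ν)ᗮ).prod (volume.restrict (Set.Ioi (0 : ℝ)))) ≤
      ENNReal.ofReal ((2 * Real.pi) ^ N) * ∫⁻ x in A, ‖h x‖ₑ ^ 2 := by
    intro h i m
    rw [← lintegral_fhat_restrict_sq hA i m, ← P.lintegral_param_sub
      (((continuous_fhat i).measurable.enorm).pow_const 2)]
    refine lintegral_mono' (Measure.prod_mono le_rfl Measure.restrict_le_self) le_rfl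
  have h5 : (fun w : Eucl N × Eucl N => (starRingEnd ℂ) (h₁ w.1) * h₂ w.2 *
      ((Complex.Gamma (1 + Complex.I * σ))⁻¹ * ∫ z : (ℝ ∙ P.ν)ᗮ × ℝ,
        ((P.χ z.1 : ℂ) * ((z.2 : ℂ) ^ (Complex.I * σ) * Complex.exp (-(z.2 : ℂ)))) *
          Complex.exp (Complex.I * ((⟪P.param z.1 - z.2 • P.ν, w.1 - w.2⟫_ℝ : ℝ) : ℂ))
          ∂((volume : Measure (ℝ ∙ P.ν)ᗮ).prod (volume.restrict (Set.Ioi 0))))) =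
      fun w => (Complex.Gamma (1 + Complex.I * σ))⁻¹ * ((starRingEnd ℂ) (h₁ w.1) * h₂ w.2 *
      (∫ z : (ℝ ∙ P.ν)ᗮ × ℝ,
        ((P.χ z.1 : ℂ) * ((z.2 : ℂ) ^ (Complex.I * σ) * Complex.exp (-(z.2 : ℂ)))) *
          Complex.exp (Complex.I * ((⟪P.param z.1 - z.2 • P.ν, w.1 - w.2⟫_ℝ : ℝ) : ℂ))
          ∂((volume : Measure (ℝ ∙ P.ν)ᗮ).prod (volume.restrict (Set.Ioi 0))))) := by
    ext w; ring
  rw [h5, integral_const_mul, h3, enorm_mul]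
  have h6 : ‖(Complex.Gamma (1 + Complex.I * σ))⁻¹‖ₑ ≤
      ENNReal.ofReal (Real.exp (Real.pi * |σ|)) := by
    rw [← ofReal_norm]
    exact ENNReal.ofReal_le_ofReal (norm_inv_Gamma_le σ)
  refine (mul_le_mul' h6 ((enorm_integral_conj_fhat_le hcont.measurable i₁ i₂ hcb).trans
    (mul_le_mul' le_rfl (add_le_add (h4 h₁ i₁ m₁) (h4 h₂ i₂ m₂))))).trans (le_of_eq ?_)
  rw [ENNReal.ofReal_mul (by positivity), ENNReal.ofReal_mul (by positivity)]
  ring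

end Kernel

end OrthoRestriction

end

noncomputable section

namespace OrthoRestriction

variable {N : ℕ}

/-! ### Three lines with exponential growth -/

section Interpolation

/-- The three lines theorem for entire functions of exponential growth in the imaginary direction. -/
lemma norm_le_interp_of_exp_growth {Φ : ℂ → ℂ} (hΦ : Differentiable ℂ Φ) {B₁ B₂ k D₀ D₁ : ℝ}
    (hB₁ : 0 ≤ B₁) (hD₀ : 0 ≤ D₀) (hD₁ : 0 ≤ D₁)
    (hB : ∀ z : ℂ, 0 ≤ z.re → z.re ≤ 1 → ‖Φ z‖ ≤ B₁ * Real.exp (B₂ * |z.im|))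
    (h0 : ∀ s : ℝ, ‖Φ (Complex.I * s)‖ ≤ D₀ * Real.exp (k * |s|))
    (h1 : ∀ s : ℝ, ‖Φ (1 + Complex.I * s)‖ ≤ D₁ * Real.exp (k * |s|))
    {θ : ℝ} (hθ0 : 0 ≤ θ) (hθ1 : θ ≤ 1) :
    ‖Φ θ‖ ≤ (D₀ * Real.exp (1 + k ^ 2)) ^ (1 - θ) * (D₁ * Real.exp (1 + k ^ 2)) ^ θ := by
  -- The factor `exp(z²)` has modulus `exp(x² - y²)`, which beats any exponential in `|y|` on the
  -- strip. At real `θ` its modulus is at least one, so it can be dropped at the end.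
  have hgauss : ∀ (z : ℂ) (B : ℝ), 0 ≤ z.re → z.re ≤ 1 →
      ‖Complex.exp (z ^ 2)‖ * Real.exp (B * |z.im|) ≤ Real.exp (1 + B ^ 2) := by
    intro z B hz0 hz1
    rw [Complex.norm_exp, ← Real.exp_add]
    refine Real.exp_le_exp.2 ?_
    have e1 : (z ^ 2).re = z.re ^ 2 - z.im ^ 2 := by simp [sq]
    rw [e1, ← sq_abs z.im]
    nlinarith [sq_nonneg (|z.im| - B), sq_nonneg (|z.im|), sq_nonneg B, abs_nonneg z.im]
  have hbound : ∀ (z : ℂ) (D B : ℝ), 0 ≤ D → 0 ≤ z.re → z.re ≤ 1 →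
      ‖Φ z‖ ≤ D * Real.exp (B * |z.im|) →
      ‖Complex.exp (z ^ 2) * Φ z‖ ≤ D * Real.exp (1 + B ^ 2) := by
    intro z D B hD hz0 hz1 h
    rw [norm_mul]
    calc ‖Complex.exp (z ^ 2)‖ * ‖Φ z‖
        ≤ ‖Complex.exp (z ^ 2)‖ * (D * Real.exp (B * |z.im|)) := by gcongr
      _ = D * (‖Complex.exp (z ^ 2)‖ * Real.exp (B * |z.im|)) := by ring
      _ ≤ D * Real.exp (1 + B ^ 2) := by gcongr; exact hgauss z B hz0 hz1
  have hd : Differentiable ℂ fun z : ℂ => Complex.exp (z ^ 2) * Φ z := by fun_prop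
  have key := Complex.HadamardThreeLines.norm_le_interp_of_mem_verticalClosedStrip₀₁'
    (fun z : ℂ => Complex.exp (z ^ 2) * Φ z) (z := θ) (a := D₀ * Real.exp (1 + k ^ 2))
    (b := D₁ * Real.exp (1 + k ^ 2)) (by
      simpa [Complex.HadamardThreeLines.verticalClosedStrip] using ⟨hθ0, hθ1⟩) hd.diffContOnCl
    ?_ ?_ ?_
  · simp only [Complex.ofReal_re] at key
    refine le_trans ?_ key
    rw [norm_mul]
    refine le_mul_of_one_le_left (norm_nonneg _) ?_
    rw [Complex.norm_exp]
    refine Real.one_le_exp ?_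
    rw [← Complex.ofReal_pow, Complex.ofReal_re]
    positivity
  · refine ⟨B₁ * Real.exp (1 + B₂ ^ 2), ?_⟩
    rintro _ ⟨z, hz, rfl⟩
    have hz' : 0 ≤ z.re ∧ z.re ≤ 1 := by
      simpa [Complex.HadamardThreeLines.verticalClosedStrip] using hz
    exact hbound z B₁ B₂ hB₁ hz'.1 hz'.2 (hB z hz'.1 hz'.2)
  · intro z hz
    have hz' : z.re = 0 := by simpa using hz
    have e : z = Complex.I * z.im := by
      conv_lhs => rw [← Complex.re_add_im z, hz']
      simp [mul_comm]
    refine hbound z D₀ k hD₀ hz'.ge (by rw [hz']; norm_num) ?_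
    have := h0 z.im
    rwa [← e] at this
  · intro z hz
    have hz' : z.re = 1 := by simpa using hz
    have e : z = 1 + Complex.I * z.im := by
      conv_lhs => rw [← Complex.re_add_im z, hz']
      simp [mul_comm]
    refine hbound z D₁ k hD₁ (by rw [hz']; norm_num) hz'.le ?_
    have := h1 z.im
    rwa [← e] at this

end Interpolation

/-! ### Diagonal matrix elements of Hilbert–Schmidt kernels -/

section HilbertSchmidt

variable {X : Type*} [MeasurableSpace X] {μ : Measure X}

lemma memLp_two_mul_prod {f g : X → ℂ} (hf : MemLp f 2 μ) (hg : MemLp g 2 μ) :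
    MemLp (fun w : X × X => f w.1 * g w.2) 2 (μ.prod μ) := by
  have hm : AEStronglyMeasurable (fun w : X × X => f w.1 * g w.2) (μ.prod μ) :=
    hf.aestronglyMeasurable.comp_fst.mul hg.aestronglyMeasurable.comp_snd
  rw [memLp_two_iff_integrable_sq_norm hm]
  have h1 := ((memLp_two_iff_integrable_sq_norm hf.aestronglyMeasurable).1 hf).mul_prod
    ((memLp_two_iff_integrable_sq_norm hg.aestronglyMeasurable).1 hg)
  refine h1.congr (Eventually.of_forall fun w => ?_)
  simp [mul_pow]

variable [SFinite μ]

/-- Bessel's inequality for the orthonormal system `u_j(x) conj(u_j(y))`. -/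
lemma sum_sq_norm_integral_kernel_le {n : ℕ} {u : Fin n → Lp ℂ 2 μ} (hu : Orthonormal ℂ u)
    {g : X × X → ℂ} (hg : MemLp g 2 (μ.prod μ)) :
    ∑ j, ‖∫ w, (starRingEnd ℂ) (u j w.1) * u j w.2 * g w ∂(μ.prod μ)‖ ^ 2 ≤
      ∫ w, ‖g w‖ ^ 2 ∂(μ.prod μ) := by
  have hstar : ∀ j, MemLp (fun x => (starRingEnd ℂ) (u j x)) 2 μ := fun j => (Lp.memLp (u j)).star
  have hφ : ∀ j, MemLp (fun w : X × X => u j w.1 * (starRingEnd ℂ) (u j w.2)) 2 (μ.prod μ) :=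
    fun j => memLp_two_mul_prod (Lp.memLp (u j)) (hstar j)
  let φ : Fin n → Lp ℂ 2 (μ.prod μ) := fun j => (hφ j).toLp _
  have hinner : ∀ i (f : X × X → ℂ) (hf : MemLp f 2 (μ.prod μ)), ⟪φ i, hf.toLp f⟫_ℂ =
      ∫ w, (starRingEnd ℂ) (u i w.1) * u i w.2 * f w ∂(μ.prod μ) := by
    intro i f hf
    rw [L2.inner_def]
    refine integral_congr_ae ?_
    filter_upwards [(hφ i).coeFn_toLp, hf.coeFn_toLp] with w h1 h2
    simp only [φ]
    rw [h1, h2, RCLike.inner_apply]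
    simp only [map_mul, RCLike.conj_conj]
    ring
  have hφo : Orthonormal ℂ φ := by
    rw [orthonormal_iff_ite] at hu ⊢
    intro i j
    change ⟪φ i, (hφ j).toLp _⟫_ℂ = _
    rw [hinner]
    have h1 : ∫ w : X × X, (starRingEnd ℂ) (u i w.1) * u i w.2 *
        (u j w.1 * (starRingEnd ℂ) (u j w.2)) ∂(μ.prod μ) =
        ⟪u i, u j⟫_ℂ * ⟪u j, u i⟫_ℂ := by
      rw [L2.inner_def, L2.inner_def, ← integral_prod_mul]
      refine integral_congr_ae (Eventually.of_forall fun w => ?_)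
      simp only [RCLike.inner_apply]
      ring
    rw [h1, hu i j, hu j i]
    by_cases hij : i = j <;> simp [hij]
  have h2 := hφo.sum_inner_products_le (hg.toLp g) (s := Finset.univ)
  simp only [hinner _ g hg] at h2
  refine h2.trans (le_of_eq ?_)
  have h3 : ((‖hg.toLp g‖ ^ 2 : ℝ) : ℂ) = ((∫ w, ‖g w‖ ^ 2 ∂(μ.prod μ) : ℝ) : ℂ) := by
    rw [← integral_complex_ofReal]
    have h4 := inner_self_eq_norm_sq_to_K (𝕜 := ℂ) (hg.toLp g)
    rw [L2.inner_def] at h4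
    push_cast
    refine Eq.trans h4.symm (integral_congr_ae ?_)
    filter_upwards [hg.coeFn_toLp] with w h1
    rw [h1, inner_self_eq_norm_sq_to_K]
    simp
  exact_mod_cast h3

lemma sum_sq_norm_integral_kernel_restrict_le {n : ℕ} {u : Fin n → Lp ℂ 2 μ}
    (hu : Orthonormal ℂ u) {A : Set X} (hA : MeasurableSet A) {g : X × X → ℂ}
    (hg : MemLp g 2 ((μ.restrict A).prod (μ.restrict A))) :
    ∑ j, ‖∫ w, (starRingEnd ℂ) (u j w.1) * u j w.2 * g w ∂((μ.restrict A).prod (μ.restrict A))‖ ^ 2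
      ≤ ∫ w, ‖g w‖ ^ 2 ∂((μ.restrict A).prod (μ.restrict A)) := by
  have hAA := hA.prod hA
  rw [Measure.prod_restrict] at hg ⊢
  have h1 := sum_sq_norm_integral_kernel_le hu ((memLp_indicator_iff_restrict hAA).2 hg)
  have h2 : ∀ w, ‖(A ×ˢ A).indicator g w‖ ^ 2 = (A ×ˢ A).indicator (fun w => ‖g w‖ ^ 2) w := by
    intro w
    by_cases hw : w ∈ A ×ˢ A <;> simp [-Set.mem_prod, hw]
  have h3 : ∀ j w, (starRingEnd ℂ) (u j w.1) * u j w.2 * (A ×ˢ A).indicator g w =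
      (A ×ˢ A).indicator (fun w => (starRingEnd ℂ) (u j w.1) * u j w.2 * g w) w := by
    intro j w
    by_cases hw : w ∈ A ×ˢ A <;> simp [-Set.mem_prod, hw]
  simpa only [h2, h3, integral_indicator hAA] using h1

end HilbertSchmidt

/-! ### The analytic family and its interpolation -/

section SteinFamily

lemma norm_one_add_I_mul_le (τ : ℝ) : ‖(1 + Complex.I * τ : ℂ)‖ ≤ 1 + |τ| := by
  refine (norm_add_le _ _).trans ?_
  simp

lemma one_le_norm_one_add_I_mul (τ : ℝ) : 1 ≤ ‖(1 + Complex.I * τ : ℂ)‖ := by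
  have := Complex.abs_re_le_norm (1 + Complex.I * τ)
  simpa using this

lemma norm_log_one_add_I_mul_le (τ : ℝ) : ‖Complex.log (1 + Complex.I * τ)‖ ≤ |τ| + Real.pi := by
  refine (Complex.norm_le_abs_re_add_abs_im _).trans ?_
  rw [Complex.log_re, Complex.log_im]
  refine add_le_add ?_ (Complex.abs_arg_le_pi _)
  rw [abs_of_nonneg (Real.log_nonneg (one_le_norm_one_add_I_mul τ))]
  have h1 := Real.log_le_sub_one_of_pos (lt_of_lt_of_le one_pos (one_le_norm_one_add_I_mul τ))
  have h2 := norm_one_add_I_mul_le τ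
  linarith

lemma one_add_I_mul_ne_zero (τ : ℝ) : (1 + Complex.I * τ : ℂ) ≠ 0 := by
  rw [← norm_pos_iff]
  exact lt_of_lt_of_le one_pos (one_le_norm_one_add_I_mul τ)

/-- The exponent of the analytic family. -/
def steinExponent (P : GraphPatch N) (W : Eucl N → ℝ) (w : Eucl N × Eucl N) : ℂ :=
  (((N : ℝ) + 1) / 2 : ℝ) * ((Real.log (W w.1) : ℝ) + (Real.log (W w.2) : ℝ) +
    Complex.log (1 + Complex.I * (⟪P.ν, w.1 - w.2⟫_ℝ : ℝ)))

/-- The kernel of the analytic family at the origin. -/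
def steinKernel (P : GraphPatch N) (w : Eucl N × Eucl N) : ℂ :=
  P.kern (w.1 - w.2) * (1 / (1 + Complex.I * (⟪P.ν, w.1 - w.2⟫_ℝ : ℝ)))

lemma measurable_steinExponent (P : GraphPatch N) {W : Eucl N → ℝ} (hW : Measurable W) :
    Measurable (steinExponent P W) := by
  have h1 : Measurable fun w : Eucl N × Eucl N =>
      Complex.log (1 + Complex.I * (⟪P.ν, w.1 - w.2⟫_ℝ : ℝ)) := by
    refine Complex.measurable_log.comp (Continuous.measurable ?_)
    fun_prop
  have h2 : Measurable fun w : Eucl N × Eucl N => ((Real.log (W w.1) : ℝ) : ℂ) := by fun_prop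
  have h3 : Measurable fun w : Eucl N × Eucl N => ((Real.log (W w.2) : ℝ) : ℂ) := by fun_prop
  exact ((h2.add h3).add h1).const_mul _

lemma continuous_steinKernel (P : GraphPatch N) : Continuous (steinKernel P) := by
  have := P.continuous_kern
  unfold steinKernel
  refine Continuous.mul (by fun_prop) ?_
  refine Continuous.div continuous_const (by fun_prop) fun w => one_add_I_mul_ne_zero _

lemma exists_norm_steinKernel_le (P : GraphPatch N) : ∃ C : ℝ, 0 ≤ C ∧ ∀ w,
    ‖steinKernel P w‖ ≤ C := by
  refine ⟨∫ v, ‖(P.χ v : ℂ)‖, integral_nonneg fun v => norm_nonneg _, fun w => ?_⟩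
  rw [steinKernel, norm_mul, norm_div, norm_one]
  refine (mul_le_of_le_one_right (norm_nonneg _) ?_).trans ?_
  · exact (div_le_one (lt_of_lt_of_le one_pos (one_le_norm_one_add_I_mul _))).2
      (one_le_norm_one_add_I_mul _)
  · refine (norm_integral_le_integral_norm _).trans (le_of_eq ?_)
    refine integral_congr_ae (Eventually.of_forall fun v => ?_)
    simp only [norm_mul]
    rw [mul_comm Complex.I, Complex.norm_exp_ofReal_mul_I, mul_one]

lemma exists_norm_steinExponent_le (P : GraphPatch N) {W : Eucl N → ℝ} {ε M R : ℝ} (hε : 0 < ε)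
    (hW : ∀ x, ε ≤ W x ∧ W x ≤ M) :
    ∃ B : ℝ, 0 ≤ B ∧ ∀ w : Eucl N × Eucl N, ‖w.1‖ ≤ R → ‖w.2‖ ≤ R → ‖steinExponent P W w‖ ≤ B := by
  have hlog : ∀ x, |Real.log (W x)| ≤ |Real.log ε| + |Real.log M| := by
    intro x
    have hx := hW x
    have h0 : 0 < W x := hε.trans_le hx.1
    have h1 := Real.log_le_log hε hx.1
    have h2 := Real.log_le_log h0 hx.2
    rw [abs_le]
    constructor
    · have := neg_abs_le (Real.log ε); have := abs_nonneg (Real.log M); linarith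
    · have := le_abs_self (Real.log M); have := abs_nonneg (Real.log ε); linarith
  refine ⟨|((N : ℝ) + 1) / 2| * (2 * (|Real.log ε| + |Real.log M|) + (2 * |R| + Real.pi)), by
    have := Real.pi_pos; positivity, ?_⟩
  intro w h1 h2
  rw [steinExponent, norm_mul, Complex.norm_real, Real.norm_eq_abs]
  gcongr
  refine (norm_add_le _ _).trans (add_le_add ?_ ?_)
  · refine (norm_add_le _ _).trans ?_
    rw [Complex.norm_real, Complex.norm_real, Real.norm_eq_abs, Real.norm_eq_abs]
    have := hlog w.1; have := hlog w.2
    linarith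
  · refine (norm_log_one_add_I_mul_le _).trans ?_
    gcongr
    refine (abs_real_inner_le_norm _ _).trans ?_
    rw [P.norm_ν, one_mul]
    refine (norm_sub_le _ _).trans ?_
    have := le_abs_self R
    linarith

/-- The analytic family on the line `Re z = 0`. -/
lemma exp_steinExponent_mul_I (P : GraphPatch N) (W : Eucl N → ℝ) (s : ℝ) (a b : ℂ)
    (w : Eucl N × Eucl N) :
    Complex.exp (Complex.I * s * steinExponent P W w) *
        ((starRingEnd ℂ) a * b * steinKernel P w) =
      (starRingEnd ℂ) (Complex.exp ((-(s * (((N : ℝ) + 1) / 2) * Real.log (W w.1)) : ℝ) *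
          Complex.I) * a) *
        (Complex.exp (((s * (((N : ℝ) + 1) / 2) * Real.log (W w.2)) : ℝ) * Complex.I) * b) *
        (P.kern (w.1 - w.2) * (1 / (1 + Complex.I * (⟪P.ν, w.1 - w.2⟫_ℝ : ℝ))) ^
          (1 + Complex.I * ((-(s * (((N : ℝ) + 1) / 2)) : ℝ) : ℂ))) := by
  set r : ℂ := 1 + Complex.I * (⟪P.ν, w.1 - w.2⟫_ℝ : ℝ) with hr
  have hr0 : r ≠ 0 := one_add_I_mul_ne_zero _
  have harg : r.arg ≠ Real.pi := by
    intro h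
    have := (Complex.arg_eq_pi_iff.1 h).1
    simp [hr] at this
    linarith
  have hlog : Complex.log (1 / r) = -Complex.log r := by rw [one_div, Complex.log_inv _ harg]
  have h1 : (1 / r : ℂ) = Complex.exp (-Complex.log r) := by
    rw [Complex.exp_neg, Complex.exp_log hr0, one_div]
  rw [Complex.cpow_def_of_ne_zero (one_div_ne_zero hr0), hlog, steinKernel, steinExponent, ← hr, h1,
    map_mul, ← Complex.exp_conj]
  simp only [map_mul, Complex.conj_ofReal, Complex.conj_I]
  have h2 : Complex.exp (Complex.I * s * ((((N : ℝ) + 1) / 2 : ℝ) * ((Real.log (W w.1) : ℝ) +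
      (Real.log (W w.2) : ℝ) + Complex.log r))) * Complex.exp (-Complex.log r) =
      Complex.exp ((-(s * (((N : ℝ) + 1) / 2) * Real.log (W w.1)) : ℝ) * -Complex.I) *
      Complex.exp (((s * (((N : ℝ) + 1) / 2) * Real.log (W w.2)) : ℝ) * Complex.I) *
      Complex.exp (-Complex.log r *
        (1 + Complex.I * ((-(s * (((N : ℝ) + 1) / 2)) : ℝ) : ℂ))) := by
    rw [← Complex.exp_add, ← Complex.exp_add, ← Complex.exp_add]
    congr 1
    push_cast
    ring
  linear_combination ((starRingEnd ℂ) a * b * P.kern (w.1 - w.2)) * h2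

/-- The analytic family on the line `Re z = 1`. -/
lemma exists_norm_exp_steinExponent_le (P : GraphPatch N) : ∃ C : ℝ, 0 ≤ C ∧
    ∀ {W : Eucl N → ℝ}, (∀ x, 0 < W x) → ∀ (s : ℝ) (w : Eucl N × Eucl N),
    ‖Complex.exp ((1 + Complex.I * s) * steinExponent P W w) * steinKernel P w‖ ≤
      C * Real.exp (Real.pi * (((N : ℝ) + 1) / 2) * |s|) *
        (W w.1 ^ (((N : ℝ) + 1) / 2) * W w.2 ^ (((N : ℝ) + 1) / 2)) := by
  obtain ⟨C, hC, h⟩ := P.exists_kern_decay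
  refine ⟨C, hC, fun {W} hW s w => ?_⟩
  set b : ℝ := ((N : ℝ) + 1) / 2 with hb
  have hb0 : 0 ≤ b := by positivity
  set τ : ℝ := ⟪P.ν, w.1 - w.2⟫_ℝ with hτ
  set r : ℂ := 1 + Complex.I * τ with hr
  have hrn : 1 ≤ ‖r‖ := one_le_norm_one_add_I_mul _
  have hr0 : 0 < ‖r‖ := one_pos.trans_le hrn
  rw [norm_mul, steinKernel, ← hτ, ← hr, norm_mul, norm_div, norm_one, Complex.norm_exp]
  have h1 : ((1 + Complex.I * s) * steinExponent P W w).re =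
      b * Real.log (W w.1) + b * Real.log (W w.2) + b * Real.log ‖r‖ - s * b * r.arg := by
    rw [steinExponent, ← hb, ← hτ, ← hr]
    simp only [Complex.mul_re, Complex.add_re, Complex.one_re, Complex.I_re, Complex.ofReal_re,
      Complex.I_im, Complex.ofReal_im, Complex.add_im, Complex.one_im, Complex.mul_im,
      Complex.log_re, Complex.log_im]
    ring
  have h2 : -(s * b * r.arg) ≤ Real.pi * b * |s| := by
    have h3 := Complex.abs_arg_le_pi r
    calc -(s * b * r.arg) ≤ |s * b * r.arg| := neg_le_abs _
      _ = |s| * b * |r.arg| := by rw [abs_mul, abs_mul, abs_of_nonneg hb0]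
      _ ≤ |s| * b * Real.pi := by gcongr
      _ = Real.pi * b * |s| := by ring
  have h3 : Real.exp ((1 + Complex.I * s) * steinExponent P W w).re ≤
      W w.1 ^ b * W w.2 ^ b * ‖r‖ ^ b * Real.exp (Real.pi * b * |s|) := by
    rw [Real.rpow_def_of_pos (hW _), Real.rpow_def_of_pos (hW _), Real.rpow_def_of_pos hr0,
      ← Real.exp_add, ← Real.exp_add, ← Real.exp_add, h1]
    refine Real.exp_le_exp.2 ?_
    linarith
  -- This fixes `b = (N+1)/2`: after division by `‖r‖` the power is `(N-1)/2`, exactly the decay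
  -- rate of the kernel.
  have h4 : ‖r‖ ^ b * (‖P.kern (w.1 - w.2)‖ * (1 / ‖r‖)) ≤ C := by
    have h5 : ‖r‖ ^ b * (1 / ‖r‖) = ‖r‖ ^ (((N : ℝ) - 1) / 2) := by
      have e : (((N : ℝ) - 1) / 2) = b - 1 := by rw [hb]; ring
      rw [e, Real.rpow_sub hr0, Real.rpow_one, mul_one_div]
    have hN : (1 : ℝ) ≤ N := by
      exact_mod_cast Nat.le_of_add_left_le (finrank_orthogonal_unit P.norm_ν).le
    calc ‖r‖ ^ b * (‖P.kern (w.1 - w.2)‖ * (1 / ‖r‖))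
          = ‖P.kern (w.1 - w.2)‖ * ‖r‖ ^ (((N : ℝ) - 1) / 2) := by rw [← h5]; ring
        _ ≤ ‖P.kern (w.1 - w.2)‖ * (1 + |τ|) ^ (((N : ℝ) - 1) / 2) := by
            gcongr
            exact norm_one_add_I_mul_le τ
        _ ≤ C := h _
  calc Real.exp ((1 + Complex.I * s) * steinExponent P W w).re *
        (‖P.kern (w.1 - w.2)‖ * (1 / ‖r‖))
      ≤ (W w.1 ^ b * W w.2 ^ b * ‖r‖ ^ b * Real.exp (Real.pi * b * |s|)) *
        (‖P.kern (w.1 - w.2)‖ * (1 / ‖r‖)) := by gcongr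
    _ = (‖r‖ ^ b * (‖P.kern (w.1 - w.2)‖ * (1 / ‖r‖))) * Real.exp (Real.pi * b * |s|) *
        (W w.1 ^ b * W w.2 ^ b) := by ring
    _ ≤ C * Real.exp (Real.pi * b * |s|) * (W w.1 ^ b * W w.2 ^ b) := by
        have := fun x => (Real.rpow_pos_of_pos (hW x) b).le
        gcongr
        exact mul_nonneg (this _) (this _)

lemma norm_exp_mul_le_of_re_le_one {z Λ : ℂ} {B : ℝ} (hΛ : ‖Λ‖ ≤ B) (h0 : 0 ≤ z.re)
    (h1 : z.re ≤ 1) : ‖Complex.exp (z * Λ)‖ ≤ Real.exp B * Real.exp (B * |z.im|) := by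
  have hB : 0 ≤ B := (norm_nonneg _).trans hΛ
  refine (Complex.norm_exp_le_exp_norm _).trans ?_
  rw [← Real.exp_add]
  refine Real.exp_le_exp.2 ?_
  rw [norm_mul]
  have h2 : ‖z‖ ≤ 1 + |z.im| := by
    refine (Complex.norm_le_abs_re_add_abs_im z).trans ?_
    rw [abs_of_nonneg h0]
    linarith
  calc ‖z‖ * ‖Λ‖ ≤ (1 + |z.im|) * B := by gcongr
    _ = B + B * |z.im| := by ring

lemma lintegral_restrict_enorm_sq_le_one {u : L2Space N} (hu : ‖u‖ = 1) (A : Set (Eucl N)) :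
    ∫⁻ x in A, ‖u x‖ₑ ^ 2 ≤ 1 := by
  refine (setLIntegral_le_lintegral _ _).trans (le_of_eq ?_)
  have h1 : ‖u‖ₑ = 1 := by rw [← ofReal_norm, hu, ENNReal.ofReal_one]
  rw [Lp.enorm_def, eLpNorm_eq_lintegral_rpow_enorm_toReal (by norm_num) (by norm_num)] at h1
  simp only [ENNReal.toReal_ofNat, one_div] at h1
  have h2 := congrArg (fun t => t ^ (2 : ℝ)) h1
  simp only [← ENNReal.rpow_mul] at h2
  simpa using h2

/-- Weighted Schatten-type bound for one graph patch. -/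
theorem GraphPatch.exists_weighted_bound (P : GraphPatch N) : ∃ C : ℝ, 0 ≤ C ∧
    ∀ {A : Set (Eucl N)} {R : ℝ}, MeasurableSet A → A ⊆ Metric.closedBall 0 R →
    ∀ {W : Eucl N → ℝ} {ε M : ℝ}, Measurable W → 0 < ε → (∀ x, ε ≤ W x ∧ W x ≤ M) →
    ∀ {n : ℕ} {u : Fin n → L2Space N}, Orthonormal ℂ u → ∀ {t : Fin n → ℝ}, (∀ j, 0 < t j) →
    ∑ j, t j ^ ((N : ℝ) / (N + 1)) * ∫ v, P.χ v *
      ‖fhat (volume.restrict A) (fun x => (W x : ℂ) * u j x) (P.param v)‖ ^ 2 ≤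
      C * (∑ j, t j) ^ ((N : ℝ) / (N + 1)) * (∫ x in A, W x ^ ((N : ℝ) + 1)) ^ (2 / ((N : ℝ) + 1)) := by
  obtain ⟨C₀, hC₀, hform⟩ := P.exists_form_bound
  obtain ⟨C₁, hC₁, hline⟩ := exists_norm_exp_steinExponent_le P
  obtain ⟨CK, hCK, hker⟩ := exists_norm_steinKernel_le P
  set b : ℝ := ((N : ℝ) + 1) / 2 with hb
  have hN : (1 : ℝ) ≤ N := by
    exact_mod_cast Nat.le_of_add_left_le (finrank_orthogonal_unit P.norm_ν).le
  have hb0 : 0 < b := by positivity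
  have hb1 : 1 ≤ b := by rw [hb]; linarith
  set k : ℝ := Real.pi * b with hk
  set θ : ℝ := 1 / b with hθ
  have hθ0 : 0 < θ := by positivity
  have hθ1 : θ ≤ 1 := by rw [hθ, div_le_one hb0]; exact hb1
  have hθN : θ = 2 / ((N : ℝ) + 1) := by rw [hθ, hb]; field_simp
  refine ⟨(C₀ * 2 * Real.exp (1 + k ^ 2)) ^ (1 - θ) * (C₁ * Real.exp (1 + k ^ 2)) ^ θ, by positivity,
    fun {A R} hA hAR {W ε M} hWm hε hW {n u} hu {t} ht => ?_⟩
  have hWpos : ∀ x, 0 < W x := fun x => hε.trans_le (hW x).1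
  set μ : Measure (Eucl N) := volume.restrict A with hμ
  have hfin : IsFiniteMeasure μ := by
    refine ⟨?_⟩
    rw [hμ, Measure.restrict_apply_univ]
    exact (measure_mono hAR).trans_lt measure_closedBall_lt_top
  have hΛm := measurable_steinExponent P hWm
  obtain ⟨B, hB0, hB⟩ := exists_norm_steinExponent_le P (R := R) hε hW
  have hAae : ∀ᵐ w ∂(μ.prod μ), w.1 ∈ A ∧ w.2 ∈ A := by
    rw [hμ, Measure.prod_restrict]
    filter_upwards [ae_restrict_mem (hA.prod hA)] with w hw using hw
  have hBae : ∀ᵐ w ∂(μ.prod μ), ‖steinExponent P W w‖ ≤ B := by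
    filter_upwards [hAae] with w hw
    exact hB w (by simpa using hAR hw.1) (by simpa using hAR hw.2)
  have hu2 : ∀ j, MemLp (u j) 2 μ := fun j => (Lp.memLp (u j)).restrict A
  have hu1 : ∀ j, Integrable (u j) μ := fun j => (hu2 j).integrable (by norm_num)
  have hconj : ∀ j, Integrable (fun x => (starRingEnd ℂ) (u j x)) μ := fun j =>
    (Complex.conjCLE.toContinuousLinearMap.integrable_comp (hu1 j))
  have hG : ∀ j, Integrable (fun w : Eucl N × Eucl N =>
      (starRingEnd ℂ) (u j w.1) * u j w.2 * steinKernel P w) (μ.prod μ) := fun j =>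
    ((hconj j).mul_prod (hu1 j)).mul_bdd (c := CK)
      (continuous_steinKernel P).aestronglyMeasurable (Eventually.of_forall hker)
  set Ψ : Fin n → ℂ → ℂ := fun j z => ∫ w, Complex.exp (z * steinExponent P W w) *
    ((starRingEnd ℂ) (u j w.1) * u j w.2 * steinKernel P w) ∂(μ.prod μ) with hΨ
  have hΨd : ∀ j, Differentiable ℂ (Ψ j) := fun j =>
    differentiable_integral_cexp_mul (hG j) hΛm.aestronglyMeasurable hBae
  -- The weights are interpolated with the operators: `|t^(1-z/2)|` is `t` on `Re z = 0`, to be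
  -- paired with a uniform bound, and `t^(1/2)` on `Re z = 1`, to be paired with a square-summable
  -- one. At `θ = 2/(N+1)` the exponent is `N/(N+1)`.
  set Φ : ℂ → ℂ := fun z => ∑ j, Complex.exp ((1 - z / 2) * (Real.log (t j) : ℝ)) * Ψ j z with hΦ
  have hΦd : Differentiable ℂ Φ := by
    refine Differentiable.fun_sum fun j _ => ?_
    have := hΨd j
    fun_prop
  have hcoef : ∀ j (z : ℂ), ‖Complex.exp ((1 - z / 2) * (Real.log (t j) : ℝ))‖ =
      t j ^ (1 - z.re / 2) := by
    intro j z
    rw [Complex.norm_exp, Real.rpow_def_of_pos (ht j)]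
    congr 1
    simp
    ring
  -- A priori growth only. It depends on the truncation of `W` and on the system, but does not enter
  -- the final constant.
  have hgrow : ∃ B₁ : ℝ, 0 ≤ B₁ ∧ ∀ z : ℂ, 0 ≤ z.re → z.re ≤ 1 →
      ‖Φ z‖ ≤ B₁ * Real.exp (B * |z.im|) := by
    refine ⟨∑ j, (1 + t j) * (Real.exp B * ∫ w, ‖(starRingEnd ℂ) (u j w.1) * u j w.2 *
      steinKernel P w‖ ∂(μ.prod μ)), Finset.sum_nonneg fun j _ => mul_nonneg
        (by have := ht j; positivity) (by positivity), fun z hz0 hz1 => ?_⟩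
    rw [Finset.sum_mul]
    refine (norm_sum_le _ _).trans (Finset.sum_le_sum fun j _ => ?_)
    rw [norm_mul, hcoef, mul_assoc]
    have h1 : t j ^ (1 - z.re / 2) ≤ 1 + t j := by
      have := ht j
      calc t j ^ (1 - z.re / 2) ≤ (1 + t j) ^ (1 - z.re / 2) := by
            gcongr
            · linarith
            · linarith
        _ ≤ (1 + t j) ^ (1 : ℝ) :=
            Real.rpow_le_rpow_of_exponent_le (by linarith) (by linarith)
        _ = 1 + t j := Real.rpow_one _
    have h2 : ‖Ψ j z‖ ≤ Real.exp B * (∫ w, ‖(starRingEnd ℂ) (u j w.1) * u j w.2 *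
        steinKernel P w‖ ∂(μ.prod μ)) * Real.exp (B * |z.im|) := by
      refine (norm_integral_le_of_norm_le (((hG j).norm).const_mul
        (Real.exp B * Real.exp (B * |z.im|))) ?_).trans (le_of_eq ?_)
      · filter_upwards [hBae] with w hw
        rw [norm_mul]
        gcongr
        exact norm_exp_mul_le_of_re_le_one hw hz0 hz1
      · rw [integral_const_mul]
        ring
    have := ht j
    gcongr
  obtain ⟨B₁, hB₁, hgrow⟩ := hgrow
  have hline0 : ∀ s : ℝ, ‖Φ (Complex.I * s)‖ ≤ C₀ * 2 * (∑ j, t j) * Real.exp (k * |s|) := by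
    intro s
    have h1 : ∀ j, ‖Ψ j (Complex.I * s)‖ ≤ C₀ * 2 * Real.exp (k * |s|) := by
      intro j
      -- For imaginary `z` the powers of `W` are unimodular and are absorbed into `u j`, with
      -- opposite signs in the two arguments of the form, without changing `L²` norms.
      have hex : ∀ (c : ℝ) (x : Eucl N),
          ‖Complex.exp ((c * Real.log (W x) : ℝ) * Complex.I) * u j x‖ = ‖u j x‖ := by
        intro c x
        rw [norm_mul, Complex.norm_exp_ofReal_mul_I, one_mul]
      have hexm : ∀ c : ℝ, AEStronglyMeasurable (fun x =>
          Complex.exp ((c * Real.log (W x) : ℝ) * Complex.I) * u j x) μ := by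
        intro c
        refine AEStronglyMeasurable.mul (Measurable.aestronglyMeasurable (by fun_prop))
          (hu1 j).aestronglyMeasurable
      have hexi : ∀ c : ℝ, Integrable (fun x =>
          Complex.exp ((c * Real.log (W x) : ℝ) * Complex.I) * u j x) μ := fun c =>
        (hu1 j).congr' (hexm c) (Eventually.of_forall fun x => (hex c x).symm)
      have hex2 : ∀ c : ℝ, MemLp (fun x =>
          Complex.exp ((c * Real.log (W x) : ℝ) * Complex.I) * u j x) 2 μ := fun c =>
        (hu2 j).congr_norm (hexm c) (Eventually.of_forall fun x => (hex c x).symm)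
      have hexl : ∀ c : ℝ, ∫⁻ x in A, ‖Complex.exp ((c * Real.log (W x) : ℝ) * Complex.I) *
          u j x‖ₑ ^ 2 ≤ 1 := by
        intro c
        refine le_of_eq_of_le ?_ (lintegral_restrict_enorm_sq_le_one (hu.1 j) A)
        refine lintegral_congr fun x => ?_
        rw [← ofReal_norm, hex, ofReal_norm]
      have h2 := hform (-(s * b)) hA (hexi (-(s * b))) (hex2 (-(s * b))) (hexi (s * b))
        (hex2 (s * b))
      have h3 := h2.trans (mul_le_mul' le_rfl (add_le_add (hexl _) (hexl _)))
      have e2 : (1 : ℝ≥0∞) + 1 = ENNReal.ofReal 2 := by rw [ENNReal.ofReal_ofNat]; norm_num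
      rw [← ofReal_norm, e2,
        ← ENNReal.ofReal_mul (by positivity), ENNReal.ofReal_le_ofReal_iff (by positivity)] at h3
      refine le_trans (le_of_eq ?_) (h3.trans (le_of_eq ?_))
      · rw [hΨ]
        simp only [exp_steinExponent_mul_I, ← hb]
        simp only [neg_mul]
        rfl
      · rw [abs_neg, abs_mul, abs_of_pos hb0, hk]
        ring_nf
    refine (norm_sum_le _ _).trans ?_
    rw [Finset.mul_sum, Finset.sum_mul]
    refine Finset.sum_le_sum fun j _ => ?_
    rw [norm_mul, hcoef]
    have e : (Complex.I * s).re = 0 := by simp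
    rw [e, zero_div, sub_zero, Real.rpow_one]
    have := ht j
    calc t j * ‖Ψ j (Complex.I * s)‖ ≤ t j * (C₀ * 2 * Real.exp (k * |s|)) := by
          gcongr
          exact h1 j
      _ = _ := by ring
  have hWint : Integrable (fun x => W x ^ ((N : ℝ) + 1)) μ := by
    refine Integrable.of_bound (C := M ^ ((N : ℝ) + 1))
      (Measurable.aestronglyMeasurable (by fun_prop)) (Eventually.of_forall fun x => ?_)
    rw [Real.norm_of_nonneg (Real.rpow_nonneg (hWpos x).le _)]
    exact Real.rpow_le_rpow (hWpos x).le (hW x).2 (by positivity)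
  have hI0 : 0 ≤ ∫ x, W x ^ ((N : ℝ) + 1) ∂μ :=
    integral_nonneg fun x => Real.rpow_nonneg (hWpos x).le _
  have hS0 : 0 ≤ ∑ j, t j := Finset.sum_nonneg fun j _ => (ht j).le
  have hline1 : ∀ s : ℝ, ‖Φ (1 + Complex.I * s)‖ ≤
      C₁ * ((∑ j, t j) ^ (1 / 2 : ℝ) * ∫ x, W x ^ ((N : ℝ) + 1) ∂μ) * Real.exp (k * |s|) := by
    intro s
    set g : Eucl N × Eucl N → ℂ := fun w =>
      Complex.exp ((1 + Complex.I * s) * steinExponent P W w) * steinKernel P w with hg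
    have hgm : AEStronglyMeasurable g (μ.prod μ) := by
      refine AEStronglyMeasurable.mul (Measurable.aestronglyMeasurable ?_)
        (continuous_steinKernel P).aestronglyMeasurable
      exact Complex.measurable_exp.comp (hΛm.const_mul _)
    have hgb : ∀ w, ‖g w‖ ^ 2 ≤ (C₁ * Real.exp (k * |s|)) ^ 2 *
        (W w.1 ^ ((N : ℝ) + 1) * W w.2 ^ ((N : ℝ) + 1)) := by
      intro w
      have h1 := hline hWpos s w
      have h2 : ∀ x, (W x ^ b) ^ 2 = W x ^ ((N : ℝ) + 1) := by
        intro x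
        rw [← Real.rpow_natCast, ← Real.rpow_mul (hWpos x).le]
        congr 1
        rw [hb]
        push_cast
        ring
      calc ‖g w‖ ^ 2 ≤ (C₁ * Real.exp (k * |s|) * (W w.1 ^ b * W w.2 ^ b)) ^ 2 := by
            gcongr
        _ = _ := by rw [mul_pow, mul_pow (W w.1 ^ b), h2, h2]
    have hdom : Integrable (fun w : Eucl N × Eucl N => (C₁ * Real.exp (k * |s|)) ^ 2 *
        (W w.1 ^ ((N : ℝ) + 1) * W w.2 ^ ((N : ℝ) + 1))) (μ.prod μ) :=
      (hWint.mul_prod hWint).const_mul _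
    have hgi : Integrable (fun w => ‖g w‖ ^ 2) (μ.prod μ) := by
      refine hdom.mono' (hgm.norm.pow 2) (Eventually.of_forall fun w => ?_)
      rw [Real.norm_of_nonneg (by positivity)]
      exact hgb w
    have hg2 : MemLp g 2 (μ.prod μ) := (memLp_two_iff_integrable_sq_norm hgm).2 hgi
    -- The squared kernel is dominated by a multiple of `W^(N+1) ⊗ W^(N+1)`. Bessel makes the
    -- diagonal elements square-summable, and Cauchy–Schwarz pairs them with `t^(1/2)`.
    have h1 := sum_sq_norm_integral_kernel_restrict_le hu hA hg2
    have h2 : ∫ w, ‖g w‖ ^ 2 ∂(μ.prod μ) ≤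
        (C₁ * Real.exp (k * |s|) * ∫ x, W x ^ ((N : ℝ) + 1) ∂μ) ^ 2 := by
      refine (integral_mono hgi hdom hgb).trans (le_of_eq ?_)
      rw [integral_const_mul, integral_prod_mul (fun x => W x ^ ((N : ℝ) + 1))
        (fun x => W x ^ ((N : ℝ) + 1)), ← sq, ← mul_pow]
    have h3 : ∀ j, Ψ j (1 + Complex.I * s) =
        ∫ w, (starRingEnd ℂ) (u j w.1) * u j w.2 * g w ∂(μ.prod μ) := by
      intro j
      refine integral_congr_ae (Eventually.of_forall fun w => ?_)
      simp only [hg]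
      ring
    have h4 : ‖Φ (1 + Complex.I * s)‖ ≤ ∑ j, t j ^ (1 / 2 : ℝ) * ‖Ψ j (1 + Complex.I * s)‖ := by
      refine (norm_sum_le _ _).trans (Finset.sum_le_sum fun j _ => ?_)
      rw [norm_mul, hcoef]
      have e : (1 - (1 + Complex.I * (s : ℂ)).re / 2) = 1 / 2 := by simp; norm_num
      rw [e]
    have h5 : (∑ j, t j ^ (1 / 2 : ℝ) * ‖Ψ j (1 + Complex.I * s)‖) ^ 2 ≤
        (∑ j, t j) * (C₁ * Real.exp (k * |s|) * ∫ x, W x ^ ((N : ℝ) + 1) ∂μ) ^ 2 := by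
      refine (Finset.sum_mul_sq_le_sq_mul_sq _ _ _).trans ?_
      have e : ∀ j, (t j ^ (1 / 2 : ℝ)) ^ 2 = t j := by
        intro j
        rw [← Real.rpow_natCast, ← Real.rpow_mul (ht j).le]
        norm_num
      simp only [e]
      gcongr
      simp only [h3]
      exact h1.trans h2
    refine h4.trans (le_of_sq_le_sq (h5.trans (le_of_eq ?_)) (by positivity))
    have e : ((∑ j, t j) ^ (1 / 2 : ℝ)) ^ 2 = ∑ j, t j := by
      rw [← Real.rpow_natCast, ← Real.rpow_mul hS0]
      norm_num
    calc _ = ((∑ j, t j) ^ (1 / 2 : ℝ)) ^ 2 *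
          (C₁ * Real.exp (k * |s|) * ∫ x, W x ^ ((N : ℝ) + 1) ∂μ) ^ 2 := by rw [e]
      _ = _ := by ring
  have key := norm_le_interp_of_exp_growth hΦd hB₁ (by positivity) (by positivity) hgrow hline0
    hline1 hθ0.le hθ1
  -- At `θ = 1/b` the factors `1 + iτ` cancel, and the form of the remaining kernel is the energy of
  -- the Fourier transform of `W u j` on the patch.
  have hval : Φ θ = ((∑ j, t j ^ ((N : ℝ) / (N + 1)) * ∫ v, P.χ v *
      ‖fhat μ (fun x => (W x : ℂ) * u j x) (P.param v)‖ ^ 2 : ℝ) : ℂ) := by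
    rw [hΦ]
    push_cast
    refine Finset.sum_congr rfl fun j _ => ?_
    congr 1
    · rw [Real.rpow_def_of_pos (ht j), Complex.ofReal_exp]
      congr 1
      rw [hθN]
      push_cast
      have : (N : ℂ) + 1 ≠ 0 := by exact_mod_cast Nat.succ_ne_zero N
      field_simp
      ring
    · have hWu : Integrable (fun x => (W x : ℂ) * u j x) μ := by
        refine (hu1 j).bdd_mul (c := M) (Measurable.aestronglyMeasurable (by fun_prop))
          (Eventually.of_forall fun x => ?_)
        rw [Complex.norm_real, Real.norm_of_nonneg (hWpos x).le]
        exact (hW x).2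
      have h1 := integral_conj_mul_mul_kernel P.integrable_χ P.continuous_param.measurable hWu hWu
      have h2 : Ψ j θ = ∫ w : Eucl N × Eucl N, (starRingEnd ℂ) ((W w.1 : ℂ) * u j w.1) *
          ((W w.2 : ℂ) * u j w.2) * P.kern (w.1 - w.2) ∂(μ.prod μ) := by
        refine integral_congr_ae (Eventually.of_forall fun w => ?_)
        simp only
        have e1 : (θ : ℂ) * steinExponent P W w = (Real.log (W w.1) : ℝ) + (Real.log (W w.2) : ℝ) +
            Complex.log (1 + Complex.I * (⟪P.ν, w.1 - w.2⟫_ℝ : ℝ)) := by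
          rw [steinExponent, ← hb, ← mul_assoc, ← Complex.ofReal_mul, hθ, one_div,
            inv_mul_cancel₀ hb0.ne', Complex.ofReal_one, one_mul]
        rw [e1, Complex.exp_add, Complex.exp_add, ← Complex.ofReal_exp, ← Complex.ofReal_exp,
          Real.exp_log (hWpos _), Real.exp_log (hWpos _),
          Complex.exp_log (one_add_I_mul_ne_zero _), steinKernel, map_mul, Complex.conj_ofReal]
        have := one_add_I_mul_ne_zero ⟪P.ν, w.1 - w.2⟫_ℝ
        field_simp
      rw [h2]
      refine h1.trans ?_
      rw [← integral_complex_ofReal]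
      refine integral_congr_ae (Eventually.of_forall fun v => ?_)
      simp only
      rw [← Complex.normSq_eq_conj_mul_self, Complex.normSq_eq_norm_sq]
      push_cast
      ring
  rw [hval, Complex.norm_real] at key
  refine (Real.le_norm_self _).trans (key.trans (le_of_eq ?_))
  have hD₀ : 0 ≤ C₀ * 2 * Real.exp (1 + k ^ 2) := by positivity
  have hD₁ : 0 ≤ C₁ * Real.exp (1 + k ^ 2) := by positivity
  rw [mul_right_comm (C₀ * 2), mul_right_comm C₁]
  generalize C₀ * 2 * Real.exp (1 + k ^ 2) = D₀ at hD₀ ⊢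
  generalize C₁ * Real.exp (1 + k ^ 2) = D₁ at hD₁ ⊢
  rw [Real.mul_rpow hD₀ hS0, Real.mul_rpow hD₁ (by positivity),
    Real.mul_rpow (by positivity) hI0, ← Real.rpow_mul hS0, ← hθN]
  have e : (∑ j, t j) ^ ((N : ℝ) / (N + 1)) =
      (∑ j, t j) ^ (1 - θ) * (∑ j, t j) ^ (1 / 2 * θ) := by
    rw [← Real.rpow_add' hS0]
    · congr 1
      rw [hθN]
      field_simp
      ring
    · refine ne_of_gt ?_
      linarith
  rw [e]
  ring

end SteinFamily

end OrthoRestriction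

end

noncomputable section

namespace OrthoRestriction

variable {N : ℕ} {S : Set (Eucl N)}

/-! ### From patches to the surface -/

section Surface

/-- The patch domination tested on the constant `1`. Finiteness places `L²(S)` in `L¹(S)`, so point
evaluations of the extension are bounded functionals. -/
lemma isFiniteMeasure_surfaceMeasure (hcompact : IsCompact S) (hcurv : HasNonzeroGaussCurvature S) :
    IsFiniteMeasure (surfaceMeasure S) := by
  obtain ⟨k, P, C, hC, h⟩ := exists_graphPatches hcompact hcurv
  refine ⟨?_⟩
  have h1 := h (fun _ => 1) measurable_const
  simp only [lintegral_one, mul_one] at h1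
  refine h1.trans_lt (ENNReal.sum_lt_top.2 fun i _ => ENNReal.mul_lt_top hC.lt_top ?_)
  have h2 : Integrable (P i).χ :=
    (P i).continuous_χ.integrable_of_hasCompactSupport (P i).compact_χ
  exact h2.lintegral_lt_top

/-- Weighted Schatten-type bound for the restricted Fourier transform on a bounded set. -/
theorem exists_weighted_bound (hcompact : IsCompact S) (hcurv : HasNonzeroGaussCurvature S) :
    ∃ C : ℝ, 0 ≤ C ∧
    ∀ {A : Set (Eucl N)} {R : ℝ}, MeasurableSet A → A ⊆ Metric.closedBall 0 R →
    ∀ {W : Eucl N → ℝ} {ε M : ℝ}, Measurable W → 0 < ε → (∀ x, ε ≤ W x ∧ W x ≤ M) →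
    ∀ {n : ℕ} {u : Fin n → L2Space N}, Orthonormal ℂ u → ∀ {t : Fin n → ℝ}, (∀ j, 0 < t j) →
    ∑ j, ENNReal.ofReal (t j ^ ((N : ℝ) / (N + 1))) * ∫⁻ ξ,
      ‖fhat (volume.restrict A) (fun x => (W x : ℂ) * u j x) ξ‖ₑ ^ 2 ∂(surfaceMeasure S) ≤
      ENNReal.ofReal (C * (∑ j, t j) ^ ((N : ℝ) / (N + 1)) *
        (∫ x in A, W x ^ ((N : ℝ) + 1)) ^ (2 / ((N : ℝ) + 1))) := by
  obtain ⟨k, P, C, hC, h⟩ := exists_graphPatches hcompact hcurv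
  choose D hD0 hD using fun i => (P i).exists_weighted_bound
  refine ⟨C.toReal * ∑ i, D i, mul_nonneg ENNReal.toReal_nonneg
    (Finset.sum_nonneg fun i _ => hD0 i),
    fun {A R} hA hAR {W ε M} hWm hε hW {n u} hu {t} ht => ?_⟩
  set μ : Measure (Eucl N) := volume.restrict A with hμ
  have hfin : IsFiniteMeasure μ := by
    refine ⟨?_⟩
    rw [hμ, Measure.restrict_apply_univ]
    exact (measure_mono hAR).trans_lt measure_closedBall_lt_top
  have hWu : ∀ j, Integrable (fun x => (W x : ℂ) * u j x) μ := by
    intro j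
    have hu1 : Integrable (u j) μ := ((Lp.memLp (u j)).restrict A).integrable (by norm_num)
    refine hu1.bdd_mul (c := M) (Measurable.aestronglyMeasurable (by fun_prop))
      (Eventually.of_forall fun x => ?_)
    rw [Complex.norm_real, Real.norm_of_nonneg (hε.le.trans (hW x).1)]
    exact (hW x).2
  set g : Fin n → Eucl N → ℂ := fun j => fhat μ (fun x => (W x : ℂ) * u j x) with hg
  have hgc : ∀ j, Continuous (g j) := fun j => continuous_fhat (hWu j)
  have hgm : ∀ j, Measurable fun ξ => ‖g j ξ‖ₑ ^ 2 := fun j =>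
    ((hgc j).measurable.enorm).pow_const 2
  have hpatch : ∀ i j, ∫⁻ v, ENNReal.ofReal ((P i).χ v) * ‖g j ((P i).param v)‖ₑ ^ 2 =
      ENNReal.ofReal (∫ v, (P i).χ v * ‖g j ((P i).param v)‖ ^ 2) := by
    intro i j
    have hcont : Continuous fun v => (P i).χ v * ‖g j ((P i).param v)‖ ^ 2 :=
      (P i).continuous_χ.mul (((hgc j).comp (P i).continuous_param).norm.pow 2)
    have h_integrable : Integrable fun v => (P i).χ v * ‖g j ((P i).param v)‖ ^ 2 :=
      hcont.integrable_of_hasCompactSupport (P i).compact_χ.mul_right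
    rw [ofReal_integral_eq_lintegral_ofReal h_integrable (Eventually.of_forall fun v =>
      mul_nonneg ((P i).χ_nonneg v) (by positivity))]
    refine lintegral_congr fun v => ?_
    rw [ENNReal.ofReal_mul ((P i).χ_nonneg v), ENNReal.ofReal_pow (norm_nonneg _), ofReal_norm]
  have hS0 : 0 ≤ ∑ j, t j := Finset.sum_nonneg fun j _ => (ht j).le
  have hI0 : 0 ≤ ∫ x in A, W x ^ ((N : ℝ) + 1) :=
    integral_nonneg fun x => Real.rpow_nonneg (hε.le.trans (hW x).1) _
  have hq0 : ∀ i j, 0 ≤ ∫ v, (P i).χ v * ‖g j ((P i).param v)‖ ^ 2 := fun i j =>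
    integral_nonneg fun v => mul_nonneg ((P i).χ_nonneg v) (by positivity)
  have ht0 : ∀ j, 0 ≤ t j ^ ((N : ℝ) / (N + 1)) := fun j => Real.rpow_nonneg (ht j).le _
  calc ∑ j, ENNReal.ofReal (t j ^ ((N : ℝ) / (N + 1))) * ∫⁻ ξ, ‖g j ξ‖ₑ ^ 2 ∂(surfaceMeasure S)
      ≤ ∑ j, ENNReal.ofReal (t j ^ ((N : ℝ) / (N + 1))) * ∑ i, C *
          ENNReal.ofReal (∫ v, (P i).χ v * ‖g j ((P i).param v)‖ ^ 2) := by
        gcongr with j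
        refine (h _ (hgm j)).trans (le_of_eq ?_)
        simp only [hpatch]
    _ = C * ∑ i, ENNReal.ofReal (∑ j, t j ^ ((N : ℝ) / (N + 1)) *
          ∫ v, (P i).χ v * ‖g j ((P i).param v)‖ ^ 2) := by
        simp only [ENNReal.ofReal_sum_of_nonneg fun j _ => mul_nonneg (ht0 j) (hq0 _ j),
          ENNReal.ofReal_mul (ht0 _), Finset.mul_sum]
        rw [Finset.sum_comm]
        refine Finset.sum_congr rfl fun i _ => Finset.sum_congr rfl fun j _ => ?_
        ring
    _ ≤ C * ∑ i, ENNReal.ofReal (D i * (∑ j, t j) ^ ((N : ℝ) / (N + 1)) *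
          (∫ x in A, W x ^ ((N : ℝ) + 1)) ^ (2 / ((N : ℝ) + 1))) := by
        gcongr with i
        exact hD i hA hAR hWm hε hW hu ht
    _ = _ := by
        rw [← ENNReal.ofReal_sum_of_nonneg fun i _ => by have := hD0 i; positivity]
        conv_lhs => rw [← ENNReal.ofReal_toReal hC]
        rw [← ENNReal.ofReal_mul ENNReal.toReal_nonneg, ← Finset.sum_mul, ← Finset.sum_mul]
        congr 1
        ring

end Surface

/-! ### The extension operator as a family of evaluation functionals -/

section Extension

variable [IsFiniteMeasure (surfaceMeasure S)]

lemma memLp_planeWave (x : Eucl N) : MemLp (fun ξ : Eucl N =>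
    (((2 * Real.pi) ^ ((N : ℝ) / 2) : ℝ) : ℂ)⁻¹ *
      Complex.exp (-(Complex.I * ((⟪ξ, x⟫_ℝ : ℝ) : ℂ)))) 2 (surfaceMeasure S) := by
  refine MemLp.of_bound (C := ‖(((2 * Real.pi) ^ ((N : ℝ) / 2) : ℝ) : ℂ)⁻¹‖)
    (Continuous.aestronglyMeasurable (by fun_prop)) (Eventually.of_forall fun ξ => ?_)
  rw [norm_mul, ← mul_neg, mul_comm Complex.I, ← Complex.ofReal_neg, Complex.norm_exp_ofReal_mul_I,
    mul_one]

/-- The function representing evaluation of the extension at `x`. -/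
def planeWave (S : Set (Eucl N)) [IsFiniteMeasure (surfaceMeasure S)] (x : Eucl N) : L2Surface S :=
  (memLp_planeWave x).toLp _

lemma extensionOp_eq_inner (f : L2Surface S) (x : Eucl N) :
    extensionOp S f x = ⟪planeWave S x, f⟫_ℂ := by
  rw [L2.inner_def, extensionOp, ← integral_const_mul]
  refine integral_congr_ae ?_
  filter_upwards [(memLp_planeWave (S := S) x).coeFn_toLp] with ξ hξ
  rw [planeWave, hξ, RCLike.inner_apply, map_mul, ← Complex.exp_conj]
  simp only [map_inv₀, map_neg, map_mul, Complex.conj_I, Complex.conj_ofReal]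
  rw [neg_mul, neg_neg]
  ring

lemma exists_norm_planeWave_le (S : Set (Eucl N)) [IsFiniteMeasure (surfaceMeasure S)] :
    ∃ K : ℝ, 0 < K ∧ ∀ x, ‖planeWave S x‖ ^ 2 ≤ K := by
  have h : ∀ x, ‖planeWave S x‖ ≤ measureUnivNNReal (surfaceMeasure S) ^ (2 : ℝ≥0∞).toReal⁻¹ *
      ‖(((2 * Real.pi) ^ ((N : ℝ) / 2) : ℝ) : ℂ)⁻¹‖ := by
    intro x
    refine Lp.norm_le_of_ae_bound (norm_nonneg _) ?_
    filter_upwards [(memLp_planeWave (S := S) x).coeFn_toLp] with ξ hξ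
    rw [planeWave, hξ, norm_mul, ← mul_neg, mul_comm Complex.I, ← Complex.ofReal_neg,
      Complex.norm_exp_ofReal_mul_I, mul_one]
  refine ⟨(measureUnivNNReal (surfaceMeasure S) ^ (2 : ℝ≥0∞).toReal⁻¹ *
      ‖(((2 * Real.pi) ^ ((N : ℝ) / 2) : ℝ) : ℂ)⁻¹‖) ^ 2 + 1, by positivity, fun x => ?_⟩
  have := pow_le_pow_left₀ (norm_nonneg _) (h x) 2
  linarith

lemma continuous_extensionOp (f : L2Surface S) : Continuous (extensionOp S f) := by
  have hf : Integrable f (surfaceMeasure S) := (Lp.memLp f).integrable (by norm_num)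
  refine continuous_const.mul (continuous_of_dominated (bound := fun ξ => ‖f ξ‖) ?_ ?_ hf.norm ?_)
  · intro x
    exact hf.aestronglyMeasurable.mul (Continuous.aestronglyMeasurable (by fun_prop))
  · intro x
    refine Eventually.of_forall fun ξ => ?_
    rw [norm_mul, mul_comm Complex.I, Complex.norm_exp_ofReal_mul_I, mul_one]
  · exact Eventually.of_forall fun ξ => by fun_prop

/-- Bessel's inequality for the vector representing evaluation at `x`; this is the `q = 1` end of
the range. -/
lemma sum_norm_extensionOp_sq_le {ι : Type*} {f : ι → L2Surface S} (hf : Orthonormal ℂ f)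
    (s : Finset ι) (x : Eucl N) :
    ∑ j ∈ s, ‖extensionOp S (f j) x‖ ^ 2 ≤ ‖planeWave S x‖ ^ 2 := by
  have := hf.sum_inner_products_le (planeWave S x) (s := s)
  simpa only [extensionOp_eq_inner, norm_inner_symm (planeWave S x)] using this

/-- The operator `f ↦ W · E f`. -/
def mulExt (W : Eucl N → ℂ) (C : ℝ)
    (h : ∀ f : L2Surface S, MemLp (fun x => W x * extensionOp S f x) 2 volume)
    (hC : ∀ f : L2Surface S,
      eLpNorm (fun x => W x * extensionOp S f x) 2 volume ≤ ENNReal.ofReal (C * ‖f‖)) :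
    L2Surface S →L[ℂ] L2Space N :=
  LinearMap.mkContinuous
    { toFun := fun f => (h f).toLp _
      map_add' := fun f g => by
        rw [← MemLp.toLp_add]
        refine MemLp.toLp_congr _ _ (Eventually.of_forall fun x => ?_)
        simp only [Pi.add_apply, extensionOp_eq_inner, inner_add_right]
        ring
      map_smul' := fun c f => by
        rw [RingHom.id_apply, ← MemLp.toLp_const_smul]
        refine MemLp.toLp_congr _ _ (Eventually.of_forall fun x => ?_)
        simp only [Pi.smul_apply, extensionOp_eq_inner, inner_smul_right, smul_eq_mul]
        ring } (max C 0) fun f => by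
      change ‖(h f).toLp _‖ ≤ _
      rw [Lp.norm_toLp]
      -- `C` carries no sign assumption, while the bound passed to `toReal` must be nonnegative.
      have h1 : C * ‖f‖ ≤ max C 0 * ‖f‖ := by
        gcongr
        exact le_max_left _ _
      exact ENNReal.toReal_le_of_le_ofReal (by positivity)
        ((hC f).trans (ENNReal.ofReal_le_ofReal h1))

variable {W : Eucl N → ℂ} {C : ℝ}
  {h : ∀ f : L2Surface S, MemLp (fun x => W x * extensionOp S f x) 2 volume}
  {hC : ∀ f : L2Surface S,
    eLpNorm (fun x => W x * extensionOp S f x) 2 volume ≤ ENNReal.ofReal (C * ‖f‖)}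

lemma coeFn_mulExt (f : L2Surface S) :
    mulExt W C h hC f =ᵐ[volume] fun x => W x * extensionOp S f x := (h f).coeFn_toLp

lemma ofReal_norm_mulExt_sq (f : L2Surface S) :
    ENNReal.ofReal (‖mulExt W C h hC f‖ ^ 2) = ∫⁻ x, ‖W x‖ₑ ^ 2 * ‖extensionOp S f x‖ₑ ^ 2 := by
  rw [ENNReal.ofReal_pow (norm_nonneg _), ofReal_norm, Lp.enorm_def,
    eLpNorm_congr_ae (coeFn_mulExt f),
    eLpNorm_eq_lintegral_rpow_enorm_toReal (by norm_num) (by norm_num), ← ENNReal.rpow_natCast,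
    ← ENNReal.rpow_mul]
  simp [mul_pow]

lemma inner_mulExt_eq_integral (f : L2Surface S) (u : L2Space N) :
    ⟪mulExt W C h hC f, u⟫_ℂ = ∫ x, (starRingEnd ℂ) (W x * extensionOp S f x) * u x := by
  rw [L2.inner_def]
  refine integral_congr_ae ?_
  filter_upwards [coeFn_mulExt (h := h) (hC := hC) f] with x hx
  rw [hx, RCLike.inner_apply, mul_comm]

end Extension

/-! ### Weighted sums versus energy bounds -/

section Weights

/-- Absorption into the left side, legitimate because `X` is finite. -/
lemma le_rpow_of_le_mul_rpow {X D τ : ℝ} (hX : 0 ≤ X) (hD : 0 ≤ D) (hτ : τ < 1)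
    (h : X ≤ D * X ^ τ) : X ≤ D ^ (1 / (1 - τ)) := by
  rcases hX.eq_or_lt with rfl | hX
  · positivity
  have h1 : X ^ (1 - τ) ≤ D := by
    rw [Real.rpow_sub hX, Real.rpow_one, div_le_iff₀ (Real.rpow_pos_of_pos hX _)]
    exact h
  have h2 : 0 < 1 - τ := by linarith
  calc X = (X ^ (1 - τ)) ^ (1 / (1 - τ)) := by
        rw [← Real.rpow_mul hX.le, mul_one_div_cancel h2.ne', Real.rpow_one]
    _ ≤ D ^ (1 / (1 - τ)) := by gcongr

/-- The analytic family takes logarithms of the weights, hence requires them positive; replacing `t`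
by `t + δ` and letting `δ ↓ 0` removes this. -/
lemma sum_rpow_mul_le_of_pos {n : ℕ} {Q : Fin n → ℝ} {γ D : ℝ} (hγ : 0 ≤ γ)
    (h : ∀ t : Fin n → ℝ, (∀ j, 0 < t j) → ∑ j, t j ^ γ * Q j ≤ D * (∑ j, t j) ^ γ)
    {t : Fin n → ℝ} (ht : ∀ j, 0 ≤ t j) : ∑ j, t j ^ γ * Q j ≤ D * (∑ j, t j) ^ γ := by
  have h1 : Continuous fun δ : ℝ => ∑ j, (t j + δ) ^ γ * Q j :=
    continuous_finsetSum _ fun j _ =>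
      ((continuous_const.add continuous_id).rpow_const fun _ => Or.inr hγ).mul continuous_const
  have h2 : Continuous fun δ : ℝ => D * (∑ j, (t j + δ)) ^ γ := by
    refine continuous_const.mul (Continuous.rpow_const ?_ fun _ => Or.inr hγ)
    fun_prop
  have h3 := le_of_tendsto_of_tendsto (b := nhdsWithin (0 : ℝ) (Set.Ioi 0))
    (h1.continuousAt (x := 0)).continuousWithinAt (h2.continuousAt (x := 0)).continuousWithinAt (by
      filter_upwards [self_mem_nhdsWithin] with δ hδ
      exact h _ fun j => add_pos_of_nonneg_of_pos (ht j) hδ)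
  simpa using h3

variable {H₁ H₂ : Type*} [NormedAddCommGroup H₁] [InnerProductSpace ℂ H₁] [NormedAddCommGroup H₂]
  [InnerProductSpace ℂ H₂]

/-- The extremal weights for Hölder, `tⱼ = ‖A uⱼ‖^(2/(1-γ))`, turn both sides into powers of the
energy sum, and absorption finishes. -/
lemma energyBound_of_weighted {A : H₁ →L[ℂ] H₂} {γ D : ℝ} (hγ1 : γ < 1)
    (hD : 0 ≤ D) (h : ∀ (n : ℕ) (u : Fin n → H₁), Orthonormal ℂ u → ∀ t : Fin n → ℝ,
      (∀ j, 0 ≤ t j) → ∑ j, t j ^ γ * ‖A (u j)‖ ^ 2 ≤ D * (∑ j, t j) ^ γ) :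
    EnergyBound (1 / (1 - γ)) (D ^ (1 / (1 - γ))) A := by
  intro n u hu
  have h1 : 0 < 1 - γ := by linarith
  have h0 : 0 < 1 / (1 - γ) := by positivity
  have h2 := h n u hu (fun j => (‖A (u j)‖ ^ 2) ^ (1 / (1 - γ))) fun j => by positivity
  have h3 : ∀ j, ((‖A (u j)‖ ^ 2) ^ (1 / (1 - γ))) ^ γ * ‖A (u j)‖ ^ 2 =
      (‖A (u j)‖ ^ 2) ^ (1 / (1 - γ)) := by
    intro j
    rcases (sq_nonneg ‖A (u j)‖).eq_or_lt with hQ | hQ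
    · rw [← hQ, Real.zero_rpow h0.ne', mul_zero]
    · rw [← Real.rpow_mul hQ.le]
      nth_rw 2 [← Real.rpow_one (‖A (u j)‖ ^ 2)]
      rw [← Real.rpow_add hQ]
      congr 1
      field_simp
      ring
  simp only [h3] at h2
  simp only [← norm_sq_rpow (norm_nonneg _)]
  exact le_rpow_of_le_mul_rpow (Finset.sum_nonneg fun j _ => by positivity) hD hγ1 h2

/-- The converse of `energyBound_of_weighted`: Hölder with exponents `1/γ` and `1/(1-γ)`. -/
lemma EnergyBound.weighted {A : H₁ →L[ℂ] H₂} {γ D : ℝ} (hγ0 : 0 < γ) (hγ1 : γ < 1) (hD : 0 ≤ D)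
    (h : EnergyBound (1 / (1 - γ)) (D ^ (1 / (1 - γ))) A) {n : ℕ} {u : Fin n → H₁}
    (hu : Orthonormal ℂ u) {t : Fin n → ℝ} (ht : ∀ j, 0 ≤ t j) :
    ∑ j, t j ^ γ * ‖A (u j)‖ ^ 2 ≤ D * (∑ j, t j) ^ γ := by
  have h1 : 0 < 1 - γ := by linarith
  have hpq : (1 / γ).HolderConjugate (1 / (1 - γ)) := by
    rw [Real.holderConjugate_iff]
    refine ⟨by rw [lt_div_iff₀ hγ0]; linarith, ?_⟩
    rw [one_div, one_div, inv_inv, inv_inv]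
    ring
  have h2 := Real.inner_le_Lp_mul_Lq_of_nonneg Finset.univ hpq (f := fun j => t j ^ γ)
    (g := fun j => ‖A (u j)‖ ^ 2) (fun j _ => Real.rpow_nonneg (ht j) _)
    (fun j _ => by positivity)
  have h3 : ∀ j, (t j ^ γ) ^ (1 / γ) = t j := by
    intro j
    rw [← Real.rpow_mul (ht j), mul_one_div_cancel hγ0.ne', Real.rpow_one]
  have h4 := h n u hu
  simp only [← norm_sq_rpow (norm_nonneg _)] at h4
  simp only [h3, one_div_one_div] at h2
  refine h2.trans ?_
  rw [mul_comm]
  refine mul_le_mul_of_nonneg_right ?_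
    (Real.rpow_nonneg (Finset.sum_nonneg fun j _ => ht j) _)
  calc (∑ j, (‖A (u j)‖ ^ 2) ^ (1 / (1 - γ))) ^ (1 - γ)
      ≤ (D ^ (1 / (1 - γ))) ^ (1 - γ) := by gcongr
    _ = D := by rw [← Real.rpow_mul hD, one_div_mul_cancel h1.ne', Real.rpow_one]

end Weights

/-! ### The endpoint estimate -/

section Endpoint

variable [IsFiniteMeasure (surfaceMeasure S)]

lemma norm_extensionOp_le (f : L2Surface S) (x : Eucl N) :
    ‖extensionOp S f x‖ ≤ ‖planeWave S x‖ * ‖f‖ := by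
  rw [extensionOp_eq_inner]
  exact norm_inner_le_norm _ _

/-- Since `E f` is bounded, square integrability of `W` suffices. This only provides an operator for
truncated weights; its constant is discarded. -/
lemma exists_mulExt_bound {W : Eucl N → ℂ} (hW : MemLp W 2 volume) : ∃ C : ℝ,
    (∀ f : L2Surface S, MemLp (fun x => W x * extensionOp S f x) 2 volume) ∧
    ∀ f : L2Surface S,
      eLpNorm (fun x => W x * extensionOp S f x) 2 volume ≤ ENNReal.ofReal (C * ‖f‖) := by
  obtain ⟨K, hK0, hK⟩ := exists_norm_planeWave_le S
  have hK' : ∀ x, ‖planeWave S x‖ ≤ K.sqrt := fun x => Real.le_sqrt_of_sq_le (hK x)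
  have hb : ∀ (f : L2Surface S) x, ‖W x * extensionOp S f x‖ ≤ (K.sqrt * ‖f‖) * ‖W x‖ := by
    intro f x
    rw [norm_mul, mul_comm]
    gcongr
    exact (norm_extensionOp_le f x).trans (by gcongr; exact hK' x)
  refine ⟨K.sqrt * (eLpNorm W 2 volume).toReal, fun f => ?_, fun f => ?_⟩
  · exact hW.of_le_mul (hW.aestronglyMeasurable.mul
      (continuous_extensionOp f).aestronglyMeasurable) (Eventually.of_forall (hb f))
  · refine (eLpNorm_le_mul_eLpNorm_of_ae_le_mul (Eventually.of_forall (hb f)) 2).trans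
      (le_of_eq ?_)
    rw [mul_right_comm, ENNReal.ofReal_mul (p := K.sqrt * ‖f‖) (by positivity),
      ENNReal.ofReal_toReal hW.eLpNorm_ne_top]

/-- By Fubini the adjoint sends `u` to `(2π)^(-N/2)` times the Fourier transform of `w u` on `A`,
viewed on the surface. The prefactor is at most one and is dropped. -/
lemma ofReal_norm_adjoint_mulExt_sq_le {A : Set (Eucl N)} (hA : MeasurableSet A)
    (hAfin : volume A ≠ ⊤) {w : Eucl N → ℝ} (hw : Measurable w) {M : ℝ}
    (hM : ∀ x, 0 ≤ w x ∧ w x ≤ M) {C : ℝ}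
    {h : ∀ f : L2Surface S, MemLp (fun x => A.indicator (fun x => (w x : ℂ)) x *
      extensionOp S f x) 2 volume}
    {hC : ∀ f : L2Surface S, eLpNorm (fun x => A.indicator (fun x => (w x : ℂ)) x *
      extensionOp S f x) 2 volume ≤ ENNReal.ofReal (C * ‖f‖)} (u : L2Space N) :
    ENNReal.ofReal (‖ContinuousLinearMap.adjoint
      (mulExt (A.indicator (fun x => (w x : ℂ))) C h hC) u‖ ^ 2) ≤
      ∫⁻ ξ, ‖fhat (volume.restrict A) (fun x => (w x : ℂ) * u x) ξ‖ₑ ^ 2 ∂(surfaceMeasure S) := by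
  set c : ℂ := (((2 * Real.pi) ^ ((N : ℝ) / 2) : ℝ) : ℂ)⁻¹ with hc
  have hcconj : (starRingEnd ℂ) c = c := by
    rw [hc, ← Complex.ofReal_inv, Complex.conj_ofReal]
  have hc1 : ‖c‖ ≤ 1 := by
    rw [hc, norm_inv, Complex.norm_real, Real.norm_of_nonneg (by positivity)]
    refine inv_le_one_of_one_le₀ (Real.one_le_rpow ?_ (by positivity))
    have := Real.pi_gt_three
    linarith
  set μ : Measure (Eucl N) := volume.restrict A with hμ
  have hfin : IsFiniteMeasure μ := by
    refine ⟨?_⟩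
    rw [hμ, Measure.restrict_apply_univ]
    exact hAfin.lt_top
  have hwu : Integrable (fun x => (w x : ℂ) * u x) μ := by
    have hu1 : Integrable u μ := ((Lp.memLp u).restrict A).integrable (by norm_num)
    refine hu1.bdd_mul (c := M) (Measurable.aestronglyMeasurable (by fun_prop))
      (Eventually.of_forall fun x => ?_)
    rw [Complex.norm_real, Real.norm_of_nonneg (hM x).1]
    exact (hM x).2
  set g : Eucl N → ℂ := fhat μ (fun x => (w x : ℂ) * u x) with hg
  have hgc : Continuous g := continuous_fhat hwu
  have hgb : ∀ ξ, ‖g ξ‖ ≤ ∫ x, ‖(w x : ℂ) * u x‖ ∂μ := by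
    intro ξ
    refine (norm_integral_le_integral_norm _).trans (le_of_eq ?_)
    refine integral_congr_ae (Eventually.of_forall fun x => ?_)
    simp only
    rw [norm_mul, ← mul_neg, mul_comm Complex.I, ← Complex.ofReal_neg,
      Complex.norm_exp_ofReal_mul_I, one_mul]
  have hcg : MemLp (fun ξ => c * g ξ) 2 (surfaceMeasure S) :=
    (MemLp.of_bound hgc.aestronglyMeasurable _ (Eventually.of_forall hgb)).const_mul c
  have hadj : ContinuousLinearMap.adjoint (mulExt (A.indicator (fun x => (w x : ℂ))) C h hC) u =
      hcg.toLp _ := by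
    refine ext_inner_left ℂ fun f => ?_
    rw [ContinuousLinearMap.adjoint_inner_right, inner_mulExt_eq_integral, L2.inner_def]
    have hf : Integrable f (surfaceMeasure S) := (Lp.memLp f).integrable (by norm_num)
    have hfc : Integrable (fun ξ => (starRingEnd ℂ) (f ξ)) (surfaceMeasure S) :=
      (Complex.conjCLE.toContinuousLinearMap.integrable_comp hf)
    have e1 : ∫ x, (starRingEnd ℂ) (A.indicator (fun x => (w x : ℂ)) x * extensionOp S f x) * u x =
        ∫ x, c * ∫ ξ, (starRingEnd ℂ) (f ξ) *
          (Complex.exp (-(Complex.I * ((⟪ξ, x⟫_ℝ : ℝ) : ℂ))) * ((w x : ℂ) * u x))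
          ∂(surfaceMeasure S) ∂μ := by
      rw [hμ, ← integral_indicator hA]
      refine integral_congr_ae (Eventually.of_forall fun x => ?_)
      simp only
      by_cases hx : x ∈ A
      · rw [Set.indicator_of_mem hx, Set.indicator_of_mem hx, extensionOp, ← hc, map_mul, map_mul,
          hcconj, Complex.conj_ofReal, ← integral_conj]
        rw [show (w x : ℂ) * (c * ∫ ξ, (starRingEnd ℂ) (f ξ * Complex.exp (Complex.I *
            ((⟪ξ, x⟫_ℝ : ℝ) : ℂ))) ∂(surfaceMeasure S)) * u x = c * (((w x : ℂ) * u x) *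
            ∫ ξ, (starRingEnd ℂ) (f ξ * Complex.exp (Complex.I *
            ((⟪ξ, x⟫_ℝ : ℝ) : ℂ))) ∂(surfaceMeasure S)) by ring, ← integral_const_mul]
        congr 1
        refine integral_congr_ae (Eventually.of_forall fun ξ => ?_)
        simp only [map_mul, ← Complex.exp_conj, Complex.conj_I, Complex.conj_ofReal]
        rw [neg_mul]
        ring
      · rw [Set.indicator_of_notMem hx, Set.indicator_of_notMem hx]
        simp
    have h_integrable : Integrable (fun p : Eucl N × Eucl N => (starRingEnd ℂ) (f p.2) *
        (Complex.exp (-(Complex.I * ((⟪p.2, p.1⟫_ℝ : ℝ) : ℂ))) * ((w p.1 : ℂ) * u p.1)))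
        (μ.prod (surfaceMeasure S)) := by
      have h0 := hwu.mul_prod hfc
      refine (h0.mul_bdd (c := 1) (g := fun p : Eucl N × Eucl N =>
        Complex.exp (-(Complex.I * ((⟪p.2, p.1⟫_ℝ : ℝ) : ℂ))))
        (Continuous.aestronglyMeasurable (by fun_prop)) (Eventually.of_forall fun p => ?_)).congr
        (Eventually.of_forall fun p => ?_)
      · rw [← mul_neg, mul_comm Complex.I, ← Complex.ofReal_neg, Complex.norm_exp_ofReal_mul_I]
      · simp only
        ring
    rw [e1, integral_const_mul, integral_integral_swap h_integrable, ← integral_const_mul]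
    refine integral_congr_ae ?_
    filter_upwards [hcg.coeFn_toLp] with ξ hξ
    rw [hξ, RCLike.inner_apply, integral_const_mul, hg, fhat]
    ring
  rw [hadj, ENNReal.ofReal_pow (norm_nonneg _), ofReal_norm, Lp.enorm_def,
    eLpNorm_congr_ae hcg.coeFn_toLp,
    eLpNorm_eq_lintegral_rpow_enorm_toReal (by norm_num) (by norm_num), ← ENNReal.rpow_natCast,
    ← ENNReal.rpow_mul]
  simp only [ENNReal.toReal_ofNat, Nat.cast_ofNat, one_div, ne_eq, OfNat.ofNat_ne_zero,
    not_false_eq_true, inv_mul_cancel₀, ENNReal.rpow_one, ENNReal.rpow_ofNat]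
  refine lintegral_mono fun ξ => ?_
  simp only [enorm_mul]
  gcongr
  refine mul_le_of_le_one_left' ?_
  rw [← ofReal_norm]
  exact ENNReal.ofReal_le_one.2 hc1

/-- Dual form of the endpoint estimate, for weights bounded above and below on a bounded set. -/
theorem exists_endpoint_weighted (hN : 2 ≤ N) (hcompact : IsCompact S)
    (hcurv : HasNonzeroGaussCurvature S) : ∃ C : ℝ, 0 ≤ C ∧
    ∀ {A : Set (Eucl N)} {R : ℝ}, MeasurableSet A → A ⊆ Metric.closedBall 0 R →
    ∀ {w : Eucl N → ℝ} {ε M : ℝ}, Measurable w → 0 < ε → (∀ x, ε ≤ w x ∧ w x ≤ M) →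
    ∀ {n : ℕ} {f : Fin n → L2Surface S}, Orthonormal ℂ f → ∀ {t : Fin n → ℝ}, (∀ j, 0 ≤ t j) →
    ∑ j, ENNReal.ofReal (t j ^ ((N : ℝ) / (N + 1))) *
      ∫⁻ x in A, ENNReal.ofReal (w x) ^ 2 * ‖extensionOp S (f j) x‖ₑ ^ 2 ≤
      ENNReal.ofReal (C * (∑ j, t j) ^ ((N : ℝ) / (N + 1)) *
        (∫ x in A, w x ^ ((N : ℝ) + 1)) ^ (2 / ((N : ℝ) + 1))) := by
  obtain ⟨C, hC0, hC⟩ := exists_weighted_bound hcompact hcurv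
  refine ⟨C, hC0, fun {A R} hA hAR {w ε M} hwm hε hw {n f} hf {t} ht => ?_⟩
  have hAfin : volume A ≠ ⊤ := ((measure_mono hAR).trans_lt measure_closedBall_lt_top).ne
  have hW2 : MemLp (A.indicator (fun x => (w x : ℂ))) 2 volume := by
    rw [memLp_indicator_iff_restrict hA]
    have hfin : IsFiniteMeasure (volume.restrict A) := ⟨by
      rw [Measure.restrict_apply_univ]; exact hAfin.lt_top⟩
    refine MemLp.of_bound (C := M) (Measurable.aestronglyMeasurable (by fun_prop))
      (Eventually.of_forall fun x => ?_)
    rw [Complex.norm_real, Real.norm_of_nonneg (hε.le.trans (hw x).1)]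
    exact (hw x).2
  obtain ⟨B, h, hB⟩ := exists_mulExt_bound (S := S) hW2
  set T := mulExt (A.indicator (fun x => (w x : ℂ))) B h hB with hT
  have hI0 : 0 ≤ ∫ x in A, w x ^ ((N : ℝ) + 1) :=
    integral_nonneg fun x => Real.rpow_nonneg (hε.le.trans (hw x).1) _
  have hγ0 : 0 < (N : ℝ) / (N + 1) := by positivity
  have hγ1 : (N : ℝ) / (N + 1) < 1 := by rw [div_lt_one (by positivity)]; linarith
  have hα : 1 ≤ 1 / (1 - (N : ℝ) / (N + 1)) := by
    rw [le_div_iff₀ (by linarith)]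
    linarith
  set D : ℝ := C * (∫ x in A, w x ^ ((N : ℝ) + 1)) ^ (2 / ((N : ℝ) + 1)) with hD
  have hD0 : 0 ≤ D := by positivity
  -- Interpolation controls `T†`, acting on systems in `L²(ℝ^N)`. Duality of energy bounds moves the
  -- estimate to systems in `L²(S)`, at the Schatten exponent `N + 1`.
  have hadj : EnergyBound (1 / (1 - (N : ℝ) / (N + 1))) (D ^ (1 / (1 - (N : ℝ) / (N + 1))))
      (ContinuousLinearMap.adjoint T) := by
    refine energyBound_of_weighted hγ1 hD0 fun m u hu s hs => ?_
    refine sum_rpow_mul_le_of_pos hγ0.le (fun s hs => ?_) hs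
    have h1 := hC hA hAR hwm hε hw hu hs
    have hs0 : 0 ≤ ∑ j, s j := Finset.sum_nonneg fun j _ => (hs j).le
    have h2 : ENNReal.ofReal (∑ j, s j ^ ((N : ℝ) / (N + 1)) *
        ‖ContinuousLinearMap.adjoint T (u j)‖ ^ 2) ≤
        ENNReal.ofReal (D * (∑ j, s j) ^ ((N : ℝ) / (N + 1))) := by
      rw [ENNReal.ofReal_sum_of_nonneg fun j _ => by have := (hs j).le; positivity]
      refine le_trans (Finset.sum_le_sum fun j _ => ?_) (h1.trans (le_of_eq ?_))
      · rw [ENNReal.ofReal_mul (Real.rpow_nonneg (hs j).le _)]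
        gcongr
        exact ofReal_norm_adjoint_mulExt_sq_le hA hAfin hwm
          (fun x => ⟨hε.le.trans (hw x).1, (hw x).2⟩) (u j)
      · rw [hD, mul_right_comm]
    exact (ENNReal.ofReal_le_ofReal_iff (by positivity)).1 h2
  have hT' := hadj.adjoint hα
  rw [ContinuousLinearMap.adjoint_adjoint] at hT'
  have h3 := hT'.weighted hγ0 hγ1 hD0 hf ht
  have h4 : ∀ j, ∫⁻ x in A, ENNReal.ofReal (w x) ^ 2 * ‖extensionOp S (f j) x‖ₑ ^ 2 =
      ENNReal.ofReal (‖T (f j)‖ ^ 2) := by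
    intro j
    rw [ofReal_norm_mulExt_sq, ← lintegral_indicator hA]
    refine lintegral_congr fun x => ?_
    by_cases hx : x ∈ A
    · rw [Set.indicator_of_mem hx, Set.indicator_of_mem hx, ← ofReal_norm (w x : ℂ),
        Complex.norm_real, Real.norm_of_nonneg (hε.le.trans (hw x).1)]
    · rw [Set.indicator_of_notMem hx, Set.indicator_of_notMem hx]
      simp
  simp only [h4, ← ENNReal.ofReal_mul (Real.rpow_nonneg (ht _) _)]
  rw [← ENNReal.ofReal_sum_of_nonneg fun j _ => by have := ht j; positivity]
  refine ENNReal.ofReal_le_ofReal (h3.trans (le_of_eq ?_))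
  rw [hD, mul_right_comm]

/-- The endpoint estimate for finite orthonormal systems. -/
theorem exists_endpoint_bound (hN : 2 ≤ N) (hcompact : IsCompact S)
    (hcurv : HasNonzeroGaussCurvature S) : ∃ C : ℝ, 0 ≤ C ∧
    ∀ {n : ℕ} {f : Fin n → L2Surface S}, Orthonormal ℂ f → ∀ {t : Fin n → ℝ}, (∀ j, 0 ≤ t j) →
    ∫⁻ x, ENNReal.ofReal (∑ j, t j ^ ((N : ℝ) / (N + 1)) * ‖extensionOp S (f j) x‖ ^ 2) ^
        (((N : ℝ) + 1) / (N - 1)) ≤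
      ENNReal.ofReal (C * (∑ j, t j) ^ ((N : ℝ) / (N + 1))) ^ (((N : ℝ) + 1) / (N - 1)) := by
  obtain ⟨C, hC0, hC⟩ := exists_endpoint_weighted hN hcompact hcurv
  refine ⟨C, hC0, fun {n f} hf {t} ht => ?_⟩
  have hN' : (2 : ℝ) ≤ N := by exact_mod_cast hN
  have hN1 : (0 : ℝ) < N - 1 := by linarith
  set p : ℝ := ((N : ℝ) + 1) / (N - 1) with hp
  have hp0 : 0 < p := by positivity
  have hp1 : p - 1 = 2 / (N - 1) := by rw [hp]; field_simp; ring
  set g : Eucl N → ℝ := fun x =>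
    ∑ j, t j ^ ((N : ℝ) / (N + 1)) * ‖extensionOp S (f j) x‖ ^ 2 with hg
  have htγ : ∀ j, 0 ≤ t j ^ ((N : ℝ) / (N + 1)) := fun j => Real.rpow_nonneg (ht j) _
  have hg0 : ∀ x, 0 ≤ g x := fun x =>
    Finset.sum_nonneg fun j _ => mul_nonneg (htγ j) (by positivity)
  have hgc : Continuous g := continuous_finsetSum _ fun j _ =>
    continuous_const.mul ((continuous_extensionOp (f j)).norm.pow 2)
  obtain ⟨K, hK0, hK⟩ := exists_norm_planeWave_le S
  obtain ⟨G, hG0, hG⟩ : ∃ G : ℝ, 0 < G ∧ ∀ x, g x ≤ G := by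
    refine ⟨∑ j, t j ^ ((N : ℝ) / (N + 1)) * K + 1, add_pos_of_nonneg_of_pos
      (Finset.sum_nonneg fun j _ => mul_nonneg (htγ j) hK0.le) one_pos, fun x => ?_⟩
    refine le_add_of_le_of_nonneg (Finset.sum_le_sum fun j _ => ?_) zero_le_one
    refine mul_le_mul_of_nonneg_left ?_ (htγ j)
    calc ‖extensionOp S (f j) x‖ ^ 2 ≤ (‖planeWave S x‖ * ‖f j‖) ^ 2 := by
          gcongr
          exact norm_extensionOp_le _ _
      _ ≤ K := by rw [hf.1 j, mul_one]; exact hK x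
  -- Truncation makes the `L^p` integral of `g` finite and allows a weight bounded away from zero
  -- that agrees with a power of `g` on `A m`. The sets exhaust `{g > 0}`.
  set A : ℕ → Set (Eucl N) := fun m => {x | 1 / ((m : ℝ) + 1) ≤ g x} ∩ Metric.closedBall 0 m with hA
  have hAm : ∀ m, MeasurableSet (A m) := fun m =>
    (measurableSet_le measurable_const hgc.measurable).inter measurableSet_closedBall
  have hset : ∀ m, ∫⁻ x in A m, ENNReal.ofReal (g x) ^ p ≤
      ENNReal.ofReal (C * (∑ j, t j) ^ ((N : ℝ) / (N + 1))) ^ p := by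
    intro m
    -- The weight dual to the density: for `w = g^a` both `w² g` and `w^(N+1)` equal `g^p`. The
    -- estimate becomes `X ≤ D X^(2/(N+1))`, from which `X` is absorbed.
    set a : ℝ := (p - 1) / 2 with ha
    have ha0 : 0 < a := by rw [ha, hp1]; positivity
    set w : Eucl N → ℝ := fun x => (max (1 / ((m : ℝ) + 1)) (g x)) ^ a with hw
    have hwA : ∀ x ∈ A m, w x = g x ^ a := by
      intro x hx
      simp only [hw]
      rw [max_eq_right hx.1]
    have hwm : Measurable w := by
      have := hgc.measurable
      fun_prop
    have hm0 : (0 : ℝ) < 1 / ((m : ℝ) + 1) := by positivity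
    have hwb : ∀ x, (1 / ((m : ℝ) + 1)) ^ a ≤ w x ∧ w x ≤ (max (1 / ((m : ℝ) + 1)) G) ^ a := by
      intro x
      constructor
      · exact Real.rpow_le_rpow hm0.le (le_max_left _ _) ha0.le
      · exact Real.rpow_le_rpow (hm0.le.trans (le_max_left _ _))
          (max_le_max le_rfl (hG x)) ha0.le
    have h1 := hC (hAm m) Set.inter_subset_right hwm (Real.rpow_pos_of_pos hm0 a) hwb hf ht
    have hgi : IntegrableOn (fun x => g x ^ p) (A m) := by
      refine Measure.integrableOn_of_bounded (M := G ^ p)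
        ((measure_mono Set.inter_subset_right).trans_lt measure_closedBall_lt_top).ne
        (hgc.measurable.pow_const p).aestronglyMeasurable (Eventually.of_forall fun x => ?_)
      rw [Real.norm_of_nonneg (Real.rpow_nonneg (hg0 x) _)]
      exact Real.rpow_le_rpow (hg0 x) (hG x) hp0.le
    set X : ℝ := ∫ x in A m, g x ^ p with hX
    have hX0 : 0 ≤ X := integral_nonneg fun x => Real.rpow_nonneg (hg0 x) _
    have hI : ∫ x in A m, w x ^ ((N : ℝ) + 1) = X := by
      refine setIntegral_congr_fun (hAm m) fun x hx => ?_
      rw [hwA x hx, ← Real.rpow_mul (hg0 x)]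
      congr 1
      rw [ha, hp1, hp]
      field_simp
    have hXl : ∫⁻ x in A m, ENNReal.ofReal (g x) ^ p = ENNReal.ofReal X := by
      rw [hX, ofReal_integral_eq_lintegral_ofReal hgi
        (Eventually.of_forall fun x => Real.rpow_nonneg (hg0 x) _)]
      exact lintegral_congr fun x => ENNReal.ofReal_rpow_of_nonneg (hg0 x) hp0.le
    have hL : ∑ j, ENNReal.ofReal (t j ^ ((N : ℝ) / (N + 1))) *
        ∫⁻ x in A m, ENNReal.ofReal (w x) ^ 2 * ‖extensionOp S (f j) x‖ₑ ^ 2 =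
        ENNReal.ofReal X := by
      have hmeas : ∀ j, Measurable fun x => ENNReal.ofReal (w x) ^ 2 *
          ‖extensionOp S (f j) x‖ₑ ^ 2 := by
        intro j
        have := (continuous_extensionOp (f j)).measurable
        fun_prop
      rw [← hXl]
      simp only [← lintegral_const_mul _ (hmeas _)]
      rw [← lintegral_finsetSum _ fun j _ => (hmeas j).const_mul _]
      refine setLIntegral_congr_fun (hAm m) fun x hx => ?_
      have e1 : ∀ j, ENNReal.ofReal (t j ^ ((N : ℝ) / (N + 1))) * (ENNReal.ofReal (w x) ^ 2 *
          ‖extensionOp S (f j) x‖ₑ ^ 2) = ENNReal.ofReal (w x ^ 2 *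
          (t j ^ ((N : ℝ) / (N + 1)) * ‖extensionOp S (f j) x‖ ^ 2)) := by
        intro j
        have hw0 : 0 ≤ w x := by rw [hwA x hx]; exact Real.rpow_nonneg (hg0 x) _
        rw [ENNReal.ofReal_mul (by positivity), ENNReal.ofReal_mul (htγ j),
          ENNReal.ofReal_pow hw0, ENNReal.ofReal_pow (norm_nonneg _), ofReal_norm]
        ring
      simp only [e1]
      rw [← ENNReal.ofReal_sum_of_nonneg fun j _ => mul_nonneg (by positivity)
        (mul_nonneg (htγ j) (by positivity)), ← Finset.mul_sum,
        ENNReal.ofReal_rpow_of_nonneg (hg0 x) hp0.le]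
      congr 1
      have hgx : 0 < g x := hm0.trans_le hx.1
      change w x ^ 2 * g x = _
      rw [hwA x hx, ← Real.rpow_natCast, ← Real.rpow_mul (hg0 x)]
      nth_rw 2 [← Real.rpow_one (g x)]
      rw [← Real.rpow_add hgx]
      congr 1
      rw [ha]
      push_cast
      ring
    have hS0 : 0 ≤ ∑ j, t j := Finset.sum_nonneg fun j _ => ht j
    rw [hL, hI, ENNReal.ofReal_le_ofReal_iff (by positivity)] at h1
    have h2 := le_rpow_of_le_mul_rpow hX0 (by positivity)
      (by rw [div_lt_one (by positivity)]; linarith) h1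
    rw [hXl, ENNReal.ofReal_rpow_of_nonneg (by positivity) hp0.le]
    refine ENNReal.ofReal_le_ofReal (h2.trans (le_of_eq ?_))
    have e : 1 - 2 / ((N : ℝ) + 1) = (N - 1) / (N + 1) := by field_simp; ring
    rw [e, one_div_div]
  have hmono : Monotone A := by
    intro m m' hmm x hx
    have h1 : (m : ℝ) ≤ m' := by exact_mod_cast hmm
    have h2 : 1 / ((m' : ℝ) + 1) ≤ 1 / ((m : ℝ) + 1) := by gcongr
    exact ⟨show 1 / ((m' : ℝ) + 1) ≤ g x from h2.trans hx.1,
      Metric.closedBall_subset_closedBall h1 hx.2⟩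
  have hsupp : ∫⁻ x, ENNReal.ofReal (g x) ^ p = ∫⁻ x in ⋃ m, A m, ENNReal.ofReal (g x) ^ p := by
    rw [← lintegral_indicator (MeasurableSet.iUnion hAm)]
    refine lintegral_congr fun x => ?_
    by_cases hx : x ∈ ⋃ m, A m
    · rw [Set.indicator_of_mem hx]
    · rw [Set.indicator_of_notMem hx]
      have hgx : g x = 0 := by
        by_contra h0
        have hpos : 0 < g x := lt_of_le_of_ne (hg0 x) (Ne.symm h0)
        obtain ⟨m₁, hm₁⟩ := exists_nat_one_div_lt hpos
        obtain ⟨m₂, hm₂⟩ := exists_nat_ge ‖x‖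
        refine hx (Set.mem_iUnion.2 ⟨max m₁ m₂, ?_, ?_⟩)
        · change 1 / (((max m₁ m₂ : ℕ) : ℝ) + 1) ≤ g x
          refine le_trans ?_ hm₁.le
          have : (m₁ : ℝ) ≤ (max m₁ m₂ : ℕ) := by exact_mod_cast le_max_left _ _
          gcongr
        · have : (m₂ : ℝ) ≤ (max m₁ m₂ : ℕ) := by exact_mod_cast le_max_right _ _
          simpa using hm₂.trans this
      rw [hgx, ENNReal.ofReal_zero, ENNReal.zero_rpow_of_pos hp0]
  change ∫⁻ x, ENNReal.ofReal (g x) ^ p ≤ _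
  rw [hsupp, setLIntegral_iUnion_of_directed _ hmono.directed_le]
  exact iSup_le hset

end Endpoint

end OrthoRestriction

end

noncomputable section

namespace OrthoRestriction

variable {N : ℕ} {S : Set (Eucl N)}

/-! ### The full range of exponents -/

section Range

variable [IsFiniteMeasure (surfaceMeasure S)]

/-- The restriction estimate for finite orthonormal systems, with weights `t_j ^ γ`. -/
theorem exists_finite_bound (hN : 2 ≤ N) (hcompact : IsCompact S)
    (hcurv : HasNonzeroGaussCurvature S) {q : ℝ} (hq₁ : 1 ≤ q) (hq₂ : q ≤ ((N : ℝ) + 1) / 2) :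
    ∃ C : ℝ, 0 < C ∧ ∀ {ι : Type*} [Fintype ι] {f : ι → L2Surface S}, Orthonormal ℂ f →
    ∀ {t : ι → ℝ}, (∀ j, 0 ≤ t j) →
    eLpNorm (fun x => ∑ j, t j ^ ((N : ℝ) * (q - 1) / (((N : ℝ) - 1) * q)) *
        ‖extensionOp S (f j) x‖ ^ 2) (ENNReal.ofReal q / ENNReal.ofReal (q - 1)) volume ≤
      ENNReal.ofReal (C * (∑ j, t j) ^ ((N : ℝ) * (q - 1) / (((N : ℝ) - 1) * q))) := by
  have hN' : (2 : ℝ) ≤ N := by exact_mod_cast hN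
  have hN1 : (0 : ℝ) < N - 1 := by linarith
  obtain ⟨K, hK0, hK⟩ := exists_norm_planeWave_le S
  rcases hq₁.eq_or_lt with rfl | hq
  · refine ⟨K, hK0, fun {ι _ f} hf {t} ht => ?_⟩
    simp only [sub_self, mul_zero, zero_div, Real.rpow_zero, one_mul, mul_one, ENNReal.ofReal_one,
      ENNReal.ofReal_zero, ENNReal.div_zero one_ne_zero, eLpNorm_exponent_top]
    refine eLpNormEssSup_le_of_ae_bound (Eventually.of_forall fun x => ?_)
    rw [Real.norm_of_nonneg (by positivity)]
    exact (sum_norm_extensionOp_sq_le hf Finset.univ x).trans (hK x)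
  obtain ⟨C₀, hC₀, hend⟩ := exists_endpoint_bound (S := S) hN hcompact hcurv
  have hq0 : 0 < q - 1 := by linarith
  set γ : ℝ := (N : ℝ) * (q - 1) / (((N : ℝ) - 1) * q) with hγ
  set p : ℝ := ((N : ℝ) + 1) / (N - 1) with hp
  set q' : ℝ := q / (q - 1) with hq'
  have hp0 : 0 < p := by positivity
  have hq'0 : 0 < q' := by positivity
  -- The hypothesis `q ≤ (N+1)/2` says precisely `l ≥ 1`. Hölder at each point, with weights `‖E
  -- fⱼ(x)‖²` of total mass at most `K`, then raises the exponent `γ` to the endpoint value `γ l =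
  -- N/(N+1)`.
  set l : ℝ := q' / p with hl
  have hl1 : 1 ≤ l := by
    rw [hl, one_le_div hp0, hp, hq', div_le_div_iff₀ hN1 hq0]
    linarith
  have hl0 : 0 < l := by linarith
  have hγl : γ * l = (N : ℝ) / (N + 1) := by
    rw [hγ, hl, hq', hp]
    field_simp
  have hγ0 : 0 ≤ γ := by positivity
  refine ⟨K ^ (1 - l⁻¹) * (C₀ + 1) ^ l⁻¹, by positivity, fun {ι _ f} hf {t} ht => ?_⟩
  set g : Eucl N → ℝ := fun x => ∑ j, t j ^ γ * ‖extensionOp S (f j) x‖ ^ 2 with hg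
  set g₀ : Eucl N → ℝ := fun x =>
    ∑ j, t j ^ ((N : ℝ) / (N + 1)) * ‖extensionOp S (f j) x‖ ^ 2 with hg₀
  have htγ : ∀ j, 0 ≤ t j ^ γ := fun j => Real.rpow_nonneg (ht j) _
  have hgn : ∀ x, 0 ≤ g x := fun x =>
    Finset.sum_nonneg fun j _ => mul_nonneg (htγ j) (by positivity)
  have hg₀n : ∀ x, 0 ≤ g₀ x := fun x =>
    Finset.sum_nonneg fun j _ => mul_nonneg (Real.rpow_nonneg (ht j) _) (by positivity)
  have hS0 : 0 ≤ ∑ j, t j := Finset.sum_nonneg fun j _ => ht j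
  have hpt : ∀ x, g x ≤ K ^ (1 - l⁻¹) * g₀ x ^ l⁻¹ := by
    intro x
    have h1 := Real.inner_le_weight_mul_Lp_of_nonneg Finset.univ hl1
      (fun j => ‖extensionOp S (f j) x‖ ^ 2) (fun j => t j ^ γ) (fun j => by positivity) htγ
    have h2 : ∀ j, (t j ^ γ) ^ l = t j ^ ((N : ℝ) / (N + 1)) := by
      intro j
      rw [← Real.rpow_mul (ht j), hγl]
    simp only [h2, mul_comm (‖extensionOp S (f _) x‖ ^ 2)] at h1
    refine h1.trans (mul_le_mul_of_nonneg_right ?_ (Real.rpow_nonneg (hg₀n x) _))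
    refine Real.rpow_le_rpow (by positivity)
      ((sum_norm_extensionOp_sq_le hf Finset.univ x).trans (hK x)) ?_
    rw [sub_nonneg]
    exact inv_le_one_of_one_le₀ hl1
  have hend' : ∫⁻ x, ENNReal.ofReal (g₀ x) ^ p ≤
      ENNReal.ofReal (C₀ * (∑ j, t j) ^ ((N : ℝ) / (N + 1))) ^ p := by
    let e := (Fintype.equivFin ι).symm
    have h1 := hend (hf.comp e e.injective) (t := t ∘ e) fun j => ht _
    have h2 : ∀ x, ∑ j, (t ∘ e) j ^ ((N : ℝ) / (N + 1)) * ‖extensionOp S ((f ∘ e) j) x‖ ^ 2 =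
        g₀ x := fun x =>
      e.sum_comp (fun j => t j ^ ((N : ℝ) / (N + 1)) * ‖extensionOp S (f j) x‖ ^ 2)
    have h3 : ∑ j, (t ∘ e) j = ∑ j, t j := e.sum_comp t
    simpa only [h2, h3] using h1
  have hexp : ENNReal.ofReal q / ENNReal.ofReal (q - 1) = ENNReal.ofReal q' := by
    rw [hq', ENNReal.ofReal_div_of_pos hq0]
  rw [hexp, eLpNorm_eq_lintegral_rpow_enorm_toReal (by simpa using hq'0) ENNReal.ofReal_ne_top,
    ENNReal.toReal_ofReal hq'0.le]
  have hlp : l⁻¹ * q' = p := by rw [hl]; field_simp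
  have hstep : ∫⁻ x, ‖g x‖ₑ ^ q' ≤ ENNReal.ofReal (K ^ (1 - l⁻¹)) ^ q' *
      ENNReal.ofReal (C₀ * (∑ j, t j) ^ ((N : ℝ) / (N + 1))) ^ p := by
    calc ∫⁻ x, ‖g x‖ₑ ^ q' ≤ ∫⁻ x, ENNReal.ofReal (K ^ (1 - l⁻¹)) ^ q' *
          ENNReal.ofReal (g₀ x) ^ p := by
          refine lintegral_mono fun x => ?_
          rw [← ofReal_norm, Real.norm_of_nonneg (hgn x), ← hlp, ENNReal.rpow_mul,
            ENNReal.ofReal_rpow_of_nonneg (hg₀n x) (by positivity),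
            ← ENNReal.mul_rpow_of_nonneg _ _ hq'0.le, ← ENNReal.ofReal_mul (by positivity)]
          gcongr
          exact hpt x
      _ = ENNReal.ofReal (K ^ (1 - l⁻¹)) ^ q' * ∫⁻ x, ENNReal.ofReal (g₀ x) ^ p :=
          lintegral_const_mul' _ _ (ENNReal.rpow_ne_top_of_nonneg hq'0.le ENNReal.ofReal_ne_top)
      _ ≤ _ := by gcongr
  refine (ENNReal.rpow_le_rpow hstep (by positivity)).trans ?_
  rw [ENNReal.mul_rpow_of_nonneg _ _ (by positivity), ← ENNReal.rpow_mul, ← ENNReal.rpow_mul,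
    mul_one_div_cancel hq'0.ne', ENNReal.rpow_one,
    show p * (1 / q') = l⁻¹ by rw [hl]; field_simp,
    ENNReal.ofReal_rpow_of_nonneg (by positivity) (by positivity),
    ← ENNReal.ofReal_mul (by positivity)]
  refine ENNReal.ofReal_le_ofReal ?_
  rw [Real.mul_rpow hC₀ (by positivity), ← Real.rpow_mul hS0,
    show (N : ℝ) / (N + 1) * l⁻¹ = γ by rw [← hγl]; field_simp, mul_assoc]
  gcongr
  linarith

/-- Includes `q = 1`, where the quotient has zero denominator and equals `∞`, the correct conjugate
exponent. -/
lemma holderTriple_ofReal {q : ℝ} (hq : 1 ≤ q) :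
    (ENNReal.ofReal q).HolderTriple (ENNReal.ofReal q / ENNReal.ofReal (q - 1)) 1 := by
  have h0 : ENNReal.ofReal q ≠ 0 := by
    rw [ne_eq, ENNReal.ofReal_eq_zero]; linarith
  refine ⟨?_⟩
  rw [ENNReal.inv_div (Or.inl ENNReal.ofReal_ne_top) (Or.inr h0), inv_one, ← one_div,
    ← ENNReal.add_div, ← ENNReal.ofReal_one, ← ENNReal.ofReal_add zero_le_one (by linarith),
    add_sub_cancel, ENNReal.ofReal_one, ENNReal.div_self h0 ENNReal.ofReal_ne_top]

/-- Dual form of the restriction estimate for finite orthonormal systems. -/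
theorem exists_finite_weighted (hN : 2 ≤ N) (hcompact : IsCompact S)
    (hcurv : HasNonzeroGaussCurvature S) {q : ℝ} (hq₁ : 1 ≤ q) (hq₂ : q ≤ ((N : ℝ) + 1) / 2) :
    ∃ C : ℝ, 0 < C ∧ ∀ {W : Eucl N → ℂ}, MemLp W (ENNReal.ofReal (2 * q)) volume →
    ∀ {n : ℕ} {f : Fin n → L2Surface S}, Orthonormal ℂ f → ∀ {t : Fin n → ℝ}, (∀ j, 0 ≤ t j) →
    ∑ j, ENNReal.ofReal (t j ^ ((N : ℝ) * (q - 1) / (((N : ℝ) - 1) * q))) *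
        ∫⁻ x, ‖W x‖ₑ ^ 2 * ‖extensionOp S (f j) x‖ₑ ^ 2 ≤
      ENNReal.ofReal (C * (∑ j, t j) ^ ((N : ℝ) * (q - 1) / (((N : ℝ) - 1) * q))) *
        eLpNorm W (ENNReal.ofReal (2 * q)) volume ^ 2 := by
  obtain ⟨C, hC, h⟩ := exists_finite_bound (S := S) hN hcompact hcurv hq₁ hq₂
  refine ⟨C, hC, fun {W} hW {n f} hf {t} ht => ?_⟩
  set γ : ℝ := (N : ℝ) * (q - 1) / (((N : ℝ) - 1) * q) with hγ
  set g : Eucl N → ℝ := fun x => ∑ j, t j ^ γ * ‖extensionOp S (f j) x‖ ^ 2 with hg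
  have htγ : ∀ j, 0 ≤ t j ^ γ := fun j => Real.rpow_nonneg (ht j) _
  have hgn : ∀ x, 0 ≤ g x := fun x =>
    Finset.sum_nonneg fun j _ => mul_nonneg (htγ j) (by positivity)
  have hgc : Continuous g := continuous_finsetSum _ fun j _ =>
    continuous_const.mul ((continuous_extensionOp (f j)).norm.pow 2)
  have hmeas : ∀ j, AEMeasurable (fun x => ‖W x‖ₑ ^ 2 * ‖extensionOp S (f j) x‖ₑ ^ 2) volume := by
    intro j
    exact (hW.aestronglyMeasurable.enorm.pow_const 2).mul
      ((continuous_extensionOp (f j)).measurable.enorm.pow_const 2).aemeasurable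
  have htriple := holderTriple_ofReal hq₁
  -- Hölder between `|W|²` in `L^q` and the density in the conjugate space.
  have h1 := eLpNorm_smul_le_mul_eLpNorm (p := ENNReal.ofReal q)
    (q := ENNReal.ofReal q / ENNReal.ofReal (q - 1)) (r := 1) (f := g)
    hgc.aestronglyMeasurable (φ := fun x => ‖W x‖ ^ (2 : ℝ)) (μ := volume)
    (hW.aestronglyMeasurable.norm.aemeasurable.pow_const 2).aestronglyMeasurable
  have h2 : eLpNorm (fun x => ‖W x‖ ^ (2 : ℝ)) (ENNReal.ofReal q) volume =
      eLpNorm W (ENNReal.ofReal (2 * q)) volume ^ 2 := by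
    rw [eLpNorm_norm_rpow _ two_pos, ← ENNReal.ofReal_mul (by linarith), mul_comm q]
    exact ENNReal.rpow_natCast _ 2
  rw [h2, eLpNorm_one_eq_lintegral_enorm] at h1
  simp only [← lintegral_const_mul'' _ (hmeas _)]
  rw [← lintegral_finsetSum' _ fun j _ => (hmeas j).const_mul _]
  refine le_trans (le_of_eq (lintegral_congr fun x => ?_))
    (h1.trans ((mul_le_mul' le_rfl (h hf ht)).trans (le_of_eq (mul_comm _ _))))
  have e1 : ∀ j, ENNReal.ofReal (t j ^ γ) * (‖W x‖ₑ ^ 2 * ‖extensionOp S (f j) x‖ₑ ^ 2) =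
      ENNReal.ofReal (‖W x‖ ^ 2 * (t j ^ γ * ‖extensionOp S (f j) x‖ ^ 2)) := by
    intro j
    rw [ENNReal.ofReal_mul (by positivity), ENNReal.ofReal_mul (htγ j),
      ENNReal.ofReal_pow (norm_nonneg _), ENNReal.ofReal_pow (norm_nonneg _), ofReal_norm,
      ofReal_norm]
    ring
  simp only [e1]
  rw [← ENNReal.ofReal_sum_of_nonneg fun j _ => mul_nonneg (by positivity)
    (mul_nonneg (htγ j) (by positivity)), ← Finset.mul_sum, ← ofReal_norm]
  congr 1
  simp only [Pi.smul_apply', smul_eq_mul, Real.rpow_ofNat]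
  exact (Real.norm_of_nonneg (mul_nonneg (by positivity) (hgn x))).symm

/-- The operator `f ↦ W · E f` for `W ∈ L^{2q}` and its energy bound. -/
theorem exists_mulExt_energyBound (hN : 2 ≤ N) (hcompact : IsCompact S)
    (hcurv : HasNonzeroGaussCurvature S) {q : ℝ} (hq₁ : 1 ≤ q) (hq₂ : q ≤ ((N : ℝ) + 1) / 2) :
    ∃ C : ℝ, 0 < C ∧ ∀ {W : Eucl N → ℂ}, MemLp W (ENNReal.ofReal (2 * q)) volume →
    ∃ (B : ℝ) (h : ∀ f : L2Surface S, MemLp (fun x => W x * extensionOp S f x) 2 volume)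
      (hB : ∀ f : L2Surface S,
        eLpNorm (fun x => W x * extensionOp S f x) 2 volume ≤ ENNReal.ofReal (B * ‖f‖)),
      EnergyBound (((N : ℝ) - 1) * q / ((N : ℝ) - q))
        ((C * (eLpNorm W (ENNReal.ofReal (2 * q)) volume).toReal ^ 2) ^
          (((N : ℝ) - 1) * q / ((N : ℝ) - q))) (mulExt W B h hB) := by
  obtain ⟨C, hC, hw⟩ := exists_finite_weighted (S := S) hN hcompact hcurv hq₁ hq₂
  have hN' : (2 : ℝ) ≤ N := by exact_mod_cast hN
  have hN1 : (0 : ℝ) < N - 1 := by linarith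
  have hNq : 0 < (N : ℝ) - q := by linarith
  have hq0 : 0 < q := by linarith
  refine ⟨C, hC, fun {W} hW => ?_⟩
  set Y : ℝ := (eLpNorm W (ENNReal.ofReal (2 * q)) volume).toReal with hY
  have hYe : eLpNorm W (ENNReal.ofReal (2 * q)) volume = ENNReal.ofReal Y :=
    (ENNReal.ofReal_toReal hW.eLpNorm_ne_top).symm
  have hY0 : 0 ≤ Y := ENNReal.toReal_nonneg
  have hsq : ∀ f : L2Surface S, ∫⁻ x, ‖W x‖ₑ ^ 2 * ‖extensionOp S f x‖ₑ ^ 2 =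
      eLpNorm (fun x => W x * extensionOp S f x) 2 volume ^ 2 := by
    intro f
    rw [eLpNorm_eq_lintegral_rpow_enorm_toReal (by norm_num) (by norm_num), ← ENNReal.rpow_natCast,
      ← ENNReal.rpow_mul]
    simp [mul_pow]
  -- Boundedness of `f ↦ W · E f` is the one-vector case of the weighted estimate.
  have hone : ∀ f : L2Surface S, ‖f‖ = 1 →
      eLpNorm (fun x => W x * extensionOp S f x) 2 volume ≤ ENNReal.ofReal (C.sqrt * Y) := by
    intro f hf
    have hon : Orthonormal ℂ (fun _ : Fin 1 => f) :=
      ⟨fun _ => hf, fun i j hij => absurd (Subsingleton.elim i j) hij⟩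
    have h1 := hw hW hon (t := fun _ => 1) fun _ => zero_le_one
    simp only [Real.one_rpow, ENNReal.ofReal_one, one_mul, Finset.univ_unique, Finset.sum_const,
      Finset.card_singleton, one_smul, mul_one, hsq, hYe] at h1
    have h2 : ENNReal.ofReal C * ENNReal.ofReal Y ^ 2 = ENNReal.ofReal (C.sqrt * Y) ^ 2 := by
      rw [← ENNReal.ofReal_pow hY0, ← ENNReal.ofReal_mul hC.le, ← ENNReal.ofReal_pow (by positivity),
        mul_pow, Real.sq_sqrt hC.le]
    rw [h2] at h1
    exact (ENNReal.pow_le_pow_left_iff two_ne_zero).1 h1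
  have hB : ∀ f : L2Surface S, eLpNorm (fun x => W x * extensionOp S f x) 2 volume ≤
      ENNReal.ofReal (C.sqrt * Y * ‖f‖) := by
    intro f
    rcases eq_or_ne f 0 with rfl | hf
    · have : (fun x => W x * extensionOp S (0 : L2Surface S) x) = fun _ => 0 := by
        ext x
        rw [extensionOp_eq_inner, inner_zero_right, mul_zero]
      rw [this]
      simp
    · have hf0 : (‖f‖ : ℂ) ≠ 0 := by simpa using hf
      have h1 := hone ((‖f‖ : ℂ)⁻¹ • f) (by
        rw [norm_smul, norm_inv, Complex.norm_real, norm_norm, inv_mul_cancel₀ (norm_ne_zero_iff.2 hf)])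
      have h2 : (fun x => W x * extensionOp S f x) = (‖f‖ : ℂ) •
          fun x => W x * extensionOp S ((‖f‖ : ℂ)⁻¹ • f : L2Surface S) x := by
        ext x
        simp only [Pi.smul_apply, extensionOp_eq_inner, inner_smul_right, smul_eq_mul]
        field_simp
      rw [h2, eLpNorm_const_smul, mul_comm (C.sqrt * Y), ENNReal.ofReal_mul (norm_nonneg _),
        ← ofReal_norm (‖f‖ : ℂ), Complex.norm_real, norm_norm]
      gcongr
  have h : ∀ f : L2Surface S, MemLp (fun x => W x * extensionOp S f x) 2 volume := fun f =>
    ⟨hW.aestronglyMeasurable.mul (continuous_extensionOp f).aestronglyMeasurable,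
      (hB f).trans_lt ENNReal.ofReal_lt_top⟩
  refine ⟨C.sqrt * Y, h, hB, ?_⟩
  -- The origin of the Schatten exponent: it is `1/(1-γ)`. For `q = 1` this is `γ = 0`, which
  -- `energyBound_of_weighted` admits.
  have hγ : 1 - (N : ℝ) * (q - 1) / (((N : ℝ) - 1) * q) = (N - q) / ((N - 1) * q) := by
    field_simp
    ring
  have hα : ((N : ℝ) - 1) * q / ((N : ℝ) - q) =
      1 / (1 - (N : ℝ) * (q - 1) / (((N : ℝ) - 1) * q)) := by
    rw [hγ, one_div_div]
  rw [hα]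
  refine energyBound_of_weighted ?_ (by positivity) fun n u hu t ht => ?_
  · have : 0 < (N - q) / (((N : ℝ) - 1) * q) := by positivity
    linarith
  · have h1 := hw hW hu ht
    simp only [← ofReal_norm_mulExt_sq (h := h) (hC := hB),
      ← ENNReal.ofReal_mul (Real.rpow_nonneg (ht _) _)] at h1
    have hS0 : 0 ≤ ∑ j, t j := Finset.sum_nonneg fun j _ => ht j
    rw [← ENNReal.ofReal_sum_of_nonneg fun j _ => by have := ht j; positivity, hYe,
      ← ENNReal.ofReal_pow hY0, ← ENNReal.ofReal_mul (by positivity),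
      ENNReal.ofReal_le_ofReal_iff (by positivity)] at h1
    refine h1.trans (le_of_eq ?_)
    ring

end Range

/-! ### Factorisation of the sandwiched operator -/

section Schatten

variable [IsFiniteMeasure (surfaceMeasure S)]

/-- Multiplication by `W₂` is adjoint to multiplication by its conjugate, so `(W̄₂ E)†` acts as `E†
W₂`. The adjoint pairings converge as products of two `L²` functions. -/
lemma isWTSW_mulExt {W₁ W₂ : Eucl N → ℂ} {B₁ B₂ : ℝ}
    {h₁ : ∀ f : L2Surface S, MemLp (fun x => W₁ x * extensionOp S f x) 2 volume}
    {hB₁ : ∀ f : L2Surface S,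
      eLpNorm (fun x => W₁ x * extensionOp S f x) 2 volume ≤ ENNReal.ofReal (B₁ * ‖f‖)}
    {h₂ : ∀ f : L2Surface S, MemLp (fun x => (starRingEnd ℂ) (W₂ x) * extensionOp S f x) 2 volume}
    {hB₂ : ∀ f : L2Surface S, eLpNorm (fun x => (starRingEnd ℂ) (W₂ x) * extensionOp S f x) 2
      volume ≤ ENNReal.ofReal (B₂ * ‖f‖)} :
    IsWTSW S W₁ W₂ (mulExt W₁ B₁ h₁ hB₁ ∘L ContinuousLinearMap.adjoint
      (mulExt (fun x => (starRingEnd ℂ) (W₂ x)) B₂ h₂ hB₂)) := by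
  intro v
  refine ⟨ContinuousLinearMap.adjoint (mulExt (fun x => (starRingEnd ℂ) (W₂ x)) B₂ h₂ hB₂) v,
    fun f => ?_, coeFn_mulExt (h := h₁) (hC := hB₁) _⟩
  have e : ∀ x, (starRingEnd ℂ) ((starRingEnd ℂ) (W₂ x) * extensionOp S f x) * v x =
      (starRingEnd ℂ) (extensionOp S f x) * (W₂ x * v x) := by
    intro x
    rw [map_mul, RCLike.conj_conj]
    ring
  constructor
  · have h3 : MemLp (fun x => (starRingEnd ℂ) ((starRingEnd ℂ) (W₂ x) * extensionOp S f x)) 2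
      volume := (h₂ f).star
    have h4 := h3.integrable_mul (Lp.memLp v)
    exact h4.congr (Eventually.of_forall fun x => e x)
  · rw [ContinuousLinearMap.adjoint_inner_right, inner_mulExt_eq_integral]
    simp only [e]

/-- Each matrix element is `⟪A₁† v, A₂† u⟫`. Cauchy–Schwarz is used in `H₁` and again in the index,
with the energy bounds of the two adjoints. -/
lemma sum_norm_inner_rpow_le {H₁ H₂ : Type*} [NormedAddCommGroup H₁] [InnerProductSpace ℂ H₁]
    [CompleteSpace H₁] [NormedAddCommGroup H₂] [InnerProductSpace ℂ H₂] [CompleteSpace H₂]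
    {A₁ A₂ : H₁ →L[ℂ] H₂} {α Y₁ Y₂ : ℝ} (hα : 1 ≤ α) (hY₁ : 0 ≤ Y₁) (hY₂ : 0 ≤ Y₂)
    (h₁ : EnergyBound α (Y₁ ^ (2 * α)) A₁) (h₂ : EnergyBound α (Y₂ ^ (2 * α)) A₂) {n : ℕ}
    {u v : Fin n → H₂} (hu : Orthonormal ℂ u) (hv : Orthonormal ℂ v) :
    ∑ i, ‖⟪v i, (A₁ ∘L ContinuousLinearMap.adjoint A₂) (u i)⟫_ℂ‖ ^ α ≤ (Y₁ * Y₂) ^ α := by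
  have hα0 : 0 ≤ α := by linarith
  have k₁ := h₁.adjoint hα n v hv
  have k₂ := h₂.adjoint hα n u hu
  have hsq : ∀ x : ℝ, 0 ≤ x → x ^ (2 * α) = (x ^ α) ^ 2 := by
    intro x hx
    rw [← Real.rpow_natCast, ← Real.rpow_mul hx]
    congr 1
    push_cast
    ring
  simp only [hsq _ (norm_nonneg _), hsq _ hY₁] at k₁
  simp only [hsq _ (norm_nonneg _), hsq _ hY₂] at k₂
  have h3 : ∑ i, ‖⟪v i, (A₁ ∘L ContinuousLinearMap.adjoint A₂) (u i)⟫_ℂ‖ ^ α ≤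
      ∑ i, ‖ContinuousLinearMap.adjoint A₁ (v i)‖ ^ α *
        ‖ContinuousLinearMap.adjoint A₂ (u i)‖ ^ α := by
    refine Finset.sum_le_sum fun i _ => ?_
    rw [← Real.mul_rpow (norm_nonneg _) (norm_nonneg _), ContinuousLinearMap.comp_apply,
      ← ContinuousLinearMap.adjoint_inner_left]
    exact Real.rpow_le_rpow (norm_nonneg _) (norm_inner_le_norm _ _) hα0
  refine h3.trans (le_of_sq_le_sq ?_ (by positivity))
  refine (Finset.sum_mul_sq_le_sq_mul_sq _ _ _).trans ?_
  rw [Real.mul_rpow hY₁ hY₂, mul_pow]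
  gcongr

end Schatten

end OrthoRestriction

end

noncomputable section

namespace OrthoRestriction

variable {N : ℕ} {S : Set (Eucl N)}

/-! ### Infinite orthonormal systems -/

section InfiniteSystems

/-- Orthonormal vectors are `√2` apart, so balls of radius `1/2` around them are disjoint.
Countability is what makes monotone convergence and measurability of the series available. -/
lemma _root_.Orthonormal.countable_of_separable {H J : Type*} [NormedAddCommGroup H]
    [InnerProductSpace ℂ H] [TopologicalSpace.SeparableSpace H] {f : J → H}
    (hf : Orthonormal ℂ f) : Countable J := by
  refine Pairwise.countable_of_isOpen_disjoint (s := fun j => Metric.ball (f j) (1 / 2)) ?_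
    (fun j => Metric.isOpen_ball) fun j => Metric.nonempty_ball.2 (by norm_num)
  intro i j hij
  refine Metric.ball_disjoint_ball ?_
  rw [dist_eq_norm]
  have h1 : ‖f i - f j‖ ^ 2 = 2 := by
    rw [norm_sub_sq (𝕜 := ℂ), hf.2 hij, hf.1 i, hf.1 j]
    norm_num
  nlinarith [norm_nonneg (f i - f j)]

variable [IsFiniteMeasure (surfaceMeasure S)]

lemma countable_of_orthonormal_L2Surface {J : Type*} {f : J → L2Surface S}
    (hf : Orthonormal ℂ f) : Countable J := by
  have : Fact ((2 : ℝ≥0∞) ≠ ⊤) := ⟨by norm_num⟩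
  have : SecondCountableTopology (L2Surface S) := inferInstance
  exact hf.countable_of_separable

/-- The case `q = 1`: a pointwise bound by Bessel's inequality. -/
lemma tsum_enorm_mul_extensionOp_sq_le {J : Type*} {f : J → L2Surface S} (hf : Orthonormal ℂ f)
    {K : ℝ} (hK : ∀ x, ‖planeWave S x‖ ^ 2 ≤ K) (ν : J → ℂ) (x : Eucl N) :
    ∑' j, ‖ν j‖ₑ * ‖extensionOp S (f j) x‖ₑ ^ 2 ≤ ENNReal.ofReal K * ⨆ j, ‖ν j‖ₑ := by
  rw [ENNReal.tsum_eq_iSup_sum]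
  refine iSup_le fun s => ?_
  calc ∑ j ∈ s, ‖ν j‖ₑ * ‖extensionOp S (f j) x‖ₑ ^ 2
      ≤ ∑ j ∈ s, (⨆ j, ‖ν j‖ₑ) * ‖extensionOp S (f j) x‖ₑ ^ 2 := by
        gcongr with j
        exact le_iSup (fun j => ‖ν j‖ₑ) j
    _ = (⨆ j, ‖ν j‖ₑ) * ENNReal.ofReal (∑ j ∈ s, ‖extensionOp S (f j) x‖ ^ 2) := by
        rw [← Finset.mul_sum, ENNReal.ofReal_sum_of_nonneg fun j _ => by positivity]
        simp only [ENNReal.ofReal_pow (norm_nonneg _), ofReal_norm]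
    _ ≤ (⨆ j, ‖ν j‖ₑ) * ENNReal.ofReal K := by
        gcongr
        exact (sum_norm_extensionOp_sq_le hf s x).trans (hK x)
    _ = _ := mul_comm _ _

/-- The case `q > 1`, by monotone convergence from finite systems. -/
lemma eLpNorm_tsum_enorm_mul_extensionOp_sq_le (hN : 2 ≤ N) {q C : ℝ} (hq : 1 < q)
    {J : Type*} {f : J → L2Surface S} (hf : Orthonormal ℂ f) (hC : 0 ≤ C)
    (hbound : ∀ (s : Finset J) {t : s → ℝ}, (∀ j, 0 ≤ t j) →
      eLpNorm (fun x => ∑ j, t j ^ ((N : ℝ) * (q - 1) / (((N : ℝ) - 1) * q)) *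
        ‖extensionOp S (f j) x‖ ^ 2) (ENNReal.ofReal q / ENNReal.ofReal (q - 1)) volume ≤
      ENNReal.ofReal (C * (∑ j, t j) ^ ((N : ℝ) * (q - 1) / (((N : ℝ) - 1) * q))))
    (ν : J → ℂ) :
    eLpNorm (fun x => ∑' j, ‖ν j‖ₑ * ‖extensionOp S (f j) x‖ₑ ^ 2)
        (ENNReal.ofReal q / ENNReal.ofReal (q - 1)) volume ≤
      ENNReal.ofReal C * seqNorm
        (ENNReal.ofReal (((N : ℝ) - 1) * q) / ENNReal.ofReal ((N : ℝ) * (q - 1))) ν := by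
  have hN' : (2 : ℝ) ≤ N := by exact_mod_cast hN
  have hN1 : (0 : ℝ) < N - 1 := by linarith
  have hq0 : 0 < q - 1 := by linarith
  have hcount := countable_of_orthonormal_L2Surface hf
  set β : ℝ := ((N : ℝ) - 1) * q / ((N : ℝ) * (q - 1)) with hβ
  have hβ0 : 0 < β := by positivity
  have hγ : (N : ℝ) * (q - 1) / (((N : ℝ) - 1) * q) = 1 / β := by rw [hβ, one_div_div]
  have hβe : ENNReal.ofReal (((N : ℝ) - 1) * q) / ENNReal.ofReal ((N : ℝ) * (q - 1)) =
      ENNReal.ofReal β := by rw [hβ, ENNReal.ofReal_div_of_pos (by positivity)]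
  set q' : ℝ := q / (q - 1) with hq'
  have hq'0 : 0 < q' := by positivity
  have hqe : ENNReal.ofReal q / ENNReal.ofReal (q - 1) = ENNReal.ofReal q' := by
    rw [hq', ENNReal.ofReal_div_of_pos hq0]
  rw [hβe, seqNorm, if_neg ENNReal.ofReal_ne_top, ENNReal.toReal_ofReal hβ0.le]
  rw [hqe, hγ] at hbound
  rw [hqe]
  have hfin : ∀ s : Finset J, eLpNorm (fun x => ∑ j ∈ s, ‖ν j‖ₑ * ‖extensionOp S (f j) x‖ₑ ^ 2)
      (ENNReal.ofReal q') volume ≤ ENNReal.ofReal C * (∑' j, ‖ν j‖ₑ ^ β) ^ (1 / β) := by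
    intro s
    -- As `1/β` is the weight exponent, these weights reproduce `|ν j|` as coefficients.
    have h1 := hbound s (t := fun j => ‖ν j‖ ^ β) fun j => by positivity
    have h2 : ∀ j : s, (‖ν j‖ ^ β) ^ (1 / β) = ‖ν j‖ := by
      intro j
      rw [← Real.rpow_mul (norm_nonneg _), mul_one_div_cancel hβ0.ne', Real.rpow_one]
    simp only [h2] at h1
    refine le_trans (eLpNorm_mono_enorm fun x => ?_) (h1.trans ?_)
    · rw [enorm_eq_self, ← ofReal_norm, Real.norm_of_nonneg (by positivity),
        ENNReal.ofReal_sum_of_nonneg fun j _ => by positivity, ← Finset.sum_coe_sort s]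
      refine Finset.sum_le_sum fun j _ => ?_
      rw [ENNReal.ofReal_mul (norm_nonneg _), ENNReal.ofReal_pow (norm_nonneg _), ofReal_norm,
        ofReal_norm]
    · rw [ENNReal.ofReal_mul hC, ← ENNReal.ofReal_rpow_of_nonneg (by positivity) (by positivity),
        ENNReal.ofReal_sum_of_nonneg fun j _ => by positivity]
      gcongr
      simp only [← ENNReal.ofReal_rpow_of_nonneg (norm_nonneg _) hβ0.le, ofReal_norm]
      rw [Finset.sum_coe_sort s fun j => ‖ν j‖ₑ ^ β]
      exact ENNReal.sum_le_tsum s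
  have hp0 : ENNReal.ofReal q' ≠ 0 := by simpa using hq'0
  simp only [eLpNorm_eq_lintegral_rpow_enorm_toReal hp0 ENNReal.ofReal_ne_top,
    ENNReal.toReal_ofReal hq'0.le, enorm_eq_self] at hfin ⊢
  have hmeas : ∀ j, Measurable fun x => ‖ν j‖ₑ * ‖extensionOp S (f j) x‖ₑ ^ 2 := by
    intro j
    have := (continuous_extensionOp (f j)).measurable
    fun_prop
  -- Monotone convergence along the directed family of finite index sets.
  have hsup : ∫⁻ x, (∑' j, ‖ν j‖ₑ * ‖extensionOp S (f j) x‖ₑ ^ 2) ^ q' =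
      ⨆ s : Finset J, ∫⁻ x, (∑ j ∈ s, ‖ν j‖ₑ * ‖extensionOp S (f j) x‖ₑ ^ 2) ^ q' := by
    rw [← lintegral_iSup_directed]
    · refine lintegral_congr fun x => ?_
      rw [ENNReal.tsum_eq_iSup_sum]
      exact (ENNReal.orderIsoRpow q' hq'0).map_iSup _
    · intro s
      exact ((Finset.measurable_fun_sum s fun j _ => hmeas j).pow_const q').aemeasurable
    · refine Monotone.directed_le fun s s' hss x => ?_
      exact ENNReal.rpow_le_rpow (Finset.sum_le_sum_of_subset hss) hq'0.le
  rw [hsup, one_div, ENNReal.rpow_inv_le_iff hq'0]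
  refine iSup_le fun s => ?_
  have := hfin s
  rwa [one_div, ENNReal.rpow_inv_le_iff hq'0] at this

/-- Passage from the bound on absolute values to the series. -/
lemma summable_memLp_of_eLpNorm_tsum_le {J : Type*} {f : J → L2Surface S} (hf : Orthonormal ℂ f)
    {ν : J → ℂ} {p R : ℝ≥0∞} (hp : p ≠ 0) (hR : R < ⊤)
    (h : eLpNorm (fun x => ∑' j, ‖ν j‖ₑ * ‖extensionOp S (f j) x‖ₑ ^ 2) p volume ≤ R) :
    (∀ᵐ x ∂(volume : Measure (Eucl N)),
      Summable fun j => ν j * ((‖extensionOp S (f j) x‖ ^ 2 : ℝ) : ℂ)) ∧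
    MemLp (fun x : Eucl N => ∑' j, ν j * ((‖extensionOp S (f j) x‖ ^ 2 : ℝ) : ℂ)) p volume ∧
    eLpNorm (fun x : Eucl N => ∑' j, ν j * ((‖extensionOp S (f j) x‖ ^ 2 : ℝ) : ℂ)) p volume ≤
      R := by
  have hcount := countable_of_orthonormal_L2Surface hf
  have hterm : ∀ j x, ‖ν j * ((‖extensionOp S (f j) x‖ ^ 2 : ℝ) : ℂ)‖ₑ =
      ‖ν j‖ₑ * ‖extensionOp S (f j) x‖ₑ ^ 2 := by
    intro j x
    rw [enorm_mul, ← ofReal_norm (((‖extensionOp S (f j) x‖ ^ 2 : ℝ)) : ℂ), Complex.norm_real,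
      Real.norm_of_nonneg (by positivity), ENNReal.ofReal_pow (norm_nonneg _), ofReal_norm]
  have hmeas : ∀ j, Measurable fun x => ‖ν j‖ₑ * ‖extensionOp S (f j) x‖ₑ ^ 2 := by
    intro j
    have := (continuous_extensionOp (f j)).measurable
    fun_prop
  have hae : ∀ᵐ x ∂(volume : Measure (Eucl N)),
      ∑' j, ‖ν j‖ₑ * ‖extensionOp S (f j) x‖ₑ ^ 2 < ⊤ := by
    rcases eq_or_ne p ⊤ with rfl | hpt
    · rw [eLpNorm_exponent_top] at h
      filter_upwards [ae_le_eLpNormEssSup (f := fun x : Eucl N =>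
        ∑' j, ‖ν j‖ₑ * ‖extensionOp S (f j) x‖ₑ ^ 2) (μ := volume)] with x hx
      rw [enorm_eq_self] at hx
      exact (hx.trans h).trans_lt hR
    · have hp0 : 0 < p.toReal := ENNReal.toReal_pos hp hpt
      rw [eLpNorm_eq_lintegral_rpow_enorm_toReal hp hpt] at h
      simp only [enorm_eq_self] at h
      have h1 : ∫⁻ x : Eucl N, (∑' j, ‖ν j‖ₑ * ‖extensionOp S (f j) x‖ₑ ^ 2) ^ p.toReal ≠ ⊤ := by
        rw [one_div, ENNReal.rpow_inv_le_iff hp0] at h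
        exact ne_top_of_le_ne_top (ENNReal.rpow_ne_top_of_nonneg hp0.le hR.ne) h
      have h2 : Measurable fun x : Eucl N =>
          (∑' j, ‖ν j‖ₑ * ‖extensionOp S (f j) x‖ₑ ^ 2) ^ p.toReal :=
        (Measurable.tsum hmeas).pow_const _
      filter_upwards [ae_lt_top h2 h1] with x hx
      exact (ENNReal.rpow_lt_top_iff_of_pos hp0).1 hx
  have hsum : ∀ᵐ x ∂(volume : Measure (Eucl N)),
      Summable fun j => ν j * ((‖extensionOp S (f j) x‖ ^ 2 : ℝ) : ℂ) := by
    filter_upwards [hae] with x hx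
    refine Summable.of_norm (tsum_enorm_ne_top_iff_summable_norm.1 ?_)
    simp only [hterm]
    exact hx.ne
  have hle : eLpNorm (fun x : Eucl N => ∑' j, ν j * ((‖extensionOp S (f j) x‖ ^ 2 : ℝ) : ℂ)) p
      volume ≤ R := by
    refine le_trans (eLpNorm_mono_enorm fun x => ?_) h
    rw [enorm_eq_self]
    refine enorm_tsum_le_tsum_enorm.trans (le_of_eq ?_)
    simp only [hterm]
  refine ⟨hsum, ⟨?_, hle.trans_lt hR⟩, hle⟩
  refine aestronglyMeasurable_of_tendsto_ae (atTop : Filter (Finset J))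
    (f := fun s x => ∑ j ∈ s, ν j * ((‖extensionOp S (f j) x‖ ^ 2 : ℝ) : ℂ)) (fun s => ?_) ?_
  · refine Continuous.aestronglyMeasurable (continuous_finsetSum _ fun j _ => ?_)
    have := continuous_extensionOp (f j)
    fun_prop
  · filter_upwards [hsum] with x hx using hx.hasSum

end InfiniteSystems

end OrthoRestriction

end

/-! ### The main theorem -/

theorem mainTheorem1 (N : ℕ) (hN : 2 ≤ N) (S : Set (Eucl N)) (hcompact : IsCompact S)
    (hsmooth : IsSmoothHypersurface S) (hcurv : HasNonzeroGaussCurvature S)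
    (q : ℝ) (hq₁ : 1 ≤ q) (hq₂ : q ≤ ((N : ℝ) + 1) / 2) :
    ∃ C : ℝ, 0 < C ∧
      -- Schatten bound for `W₁ T_S W₂`
      (∀ W₁ W₂ : Eucl N → ℂ,
        MemLp W₁ (ENNReal.ofReal (2 * q)) volume → MemLp W₂ (ENNReal.ofReal (2 * q)) volume →
        ∃ B : L2Space N →L[ℂ] L2Space N, IsWTSW S W₁ W₂ B ∧
          MemSchatten (((N : ℝ) - 1) * q / ((N : ℝ) - q)) B ∧
          schattenNorm (((N : ℝ) - 1) * q / ((N : ℝ) - q)) B ≤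
            ENNReal.ofReal C * eLpNorm W₁ (ENNReal.ofReal (2 * q)) volume *
              eLpNorm W₂ (ENNReal.ofReal (2 * q)) volume) ∧
      -- restriction estimate for orthonormal systems; both exponents are `∞` when `q = 1`
      (∀ (J : Type u) (f : J → L2Surface S), Orthonormal ℂ f → ∀ ν : J → ℂ,
        seqNorm (ENNReal.ofReal (((N : ℝ) - 1) * q) / ENNReal.ofReal ((N : ℝ) * (q - 1))) ν < ⊤ →
        (∀ᵐ x ∂(volume : Measure (Eucl N)),
          Summable fun j => ν j * ((‖extensionOp S (f j) x‖ ^ 2 : ℝ) : ℂ)) ∧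
        MemLp (fun x : Eucl N => ∑' j, ν j * ((‖extensionOp S (f j) x‖ ^ 2 : ℝ) : ℂ))
          (ENNReal.ofReal q / ENNReal.ofReal (q - 1)) volume ∧
        eLpNorm (fun x : Eucl N => ∑' j, ν j * ((‖extensionOp S (f j) x‖ ^ 2 : ℝ) : ℂ))
            (ENNReal.ofReal q / ENNReal.ofReal (q - 1)) volume ≤
          ENNReal.ofReal C *
            seqNorm (ENNReal.ofReal (((N : ℝ) - 1) * q) / ENNReal.ofReal ((N : ℝ) * (q - 1))) ν)
    := by
  have hfinite := isFiniteMeasure_surfaceMeasure hcompact hcurv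
  obtain ⟨C₁, hC₁, henergy⟩ := exists_mulExt_energyBound (S := S) hN hcompact hcurv hq₁ hq₂
  obtain ⟨C₂, hC₂, hfin⟩ := exists_finite_bound.{u} (S := S) hN hcompact hcurv hq₁ hq₂
  obtain ⟨K, hK0, hK⟩ := exists_norm_planeWave_le S
  have hN' : (2 : ℝ) ≤ N := by exact_mod_cast hN
  have hN1 : (0 : ℝ) < N - 1 := by linarith
  have hNq : 0 < (N : ℝ) - q := by linarith
  have hq0 : 0 < q := by linarith
  have hα : 1 ≤ ((N : ℝ) - 1) * q / ((N : ℝ) - q) := by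
    rw [le_div_iff₀ hNq]
    nlinarith
  set α : ℝ := ((N : ℝ) - 1) * q / ((N : ℝ) - q) with hαdef
  have hα0 : 0 < α := by linarith
  -- `C₁` serves the Schatten bound, `C₂` the series for `q > 1` and `K` the series for `q = 1`.
  refine ⟨C₁ + C₂ + K, by positivity, fun W₁ W₂ hW₁ hW₂ => ?_, fun J f hf ν hν => ?_⟩
  · have hconj : eLpNorm (fun x => (starRingEnd ℂ) (W₂ x)) (ENNReal.ofReal (2 * q)) volume =
        eLpNorm W₂ (ENNReal.ofReal (2 * q)) volume :=
      eLpNorm_congr_norm_ae (Eventually.of_forall fun x => RCLike.norm_conj _)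
    obtain ⟨B₁, h₁, hB₁, he₁⟩ := henergy hW₁
    obtain ⟨B₂, h₂, hB₂, he₂⟩ := henergy (W := fun x => (starRingEnd ℂ) (W₂ x)) hW₂.star
    rw [hconj] at he₂
    set Y₁ : ℝ := (eLpNorm W₁ (ENNReal.ofReal (2 * q)) volume).toReal with hY₁
    set Y₂ : ℝ := (eLpNorm W₂ (ENNReal.ofReal (2 * q)) volume).toReal with hY₂
    have hY₁0 : 0 ≤ Y₁ := ENNReal.toReal_nonneg
    have hY₂0 : 0 ≤ Y₂ := ENNReal.toReal_nonneg
    -- Each factor contributes `√C₁` times its norm, so the product of the two gives `C₁ Y₁ Y₂`.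
    have hsq : ∀ Y : ℝ, 0 ≤ Y → (C₁ * Y ^ 2) ^ α = (C₁.sqrt * Y) ^ (2 * α) := by
      intro Y hY
      rw [← norm_sq_rpow (by positivity), mul_pow, Real.sq_sqrt hC₁.le]
    rw [hsq _ hY₁0] at he₁
    rw [hsq _ hY₂0] at he₂
    have hsum := schattenSum_le (α := α) (mulExt W₁ B₁ h₁ hB₁ ∘L ContinuousLinearMap.adjoint
      (mulExt (fun x => (starRingEnd ℂ) (W₂ x)) B₂ h₂ hB₂)) fun n u v hu hv =>
        sum_norm_inner_rpow_le hα (by positivity) (by positivity) he₁ he₂ hu hv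
    refine ⟨_, isWTSW_mulExt, ⟨?_, hsum.trans_lt ENNReal.ofReal_lt_top⟩, ?_⟩
    · exact (he₁.isCompactOperator hα0.le).comp_clm _
    · refine (ENNReal.rpow_le_rpow hsum (by positivity)).trans ?_
      rw [ENNReal.ofReal_rpow_of_nonneg (by positivity) (by positivity),
        ← Real.rpow_mul (by positivity), mul_one_div_cancel hα0.ne', Real.rpow_one,
        show C₁.sqrt * Y₁ * (C₁.sqrt * Y₂) = C₁.sqrt * C₁.sqrt * Y₁ * Y₂ by ring,
        Real.mul_self_sqrt hC₁.le, ENNReal.ofReal_mul (by positivity),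
        ENNReal.ofReal_mul hC₁.le, ENNReal.ofReal_toReal hW₁.eLpNorm_ne_top,
        ENNReal.ofReal_toReal hW₂.eLpNorm_ne_top]
      gcongr
      linarith
  · refine summable_memLp_of_eLpNorm_tsum_le hf ?_ (ENNReal.mul_lt_top ENNReal.ofReal_lt_top hν) ?_
    · exact (ENNReal.div_pos (by simpa using hq0) ENNReal.ofReal_ne_top).ne'
    rcases hq₁.eq_or_lt with rfl | hq
    · have h0 : ENNReal.ofReal (((N : ℝ) - 1) * 1) ≠ 0 := by simpa using hN1
      simp only [sub_self, mul_zero, ENNReal.ofReal_zero, ENNReal.div_zero h0, ENNReal.ofReal_one,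
        ENNReal.div_zero one_ne_zero, eLpNorm_exponent_top, seqNorm, if_true]
      refine eLpNormEssSup_le_of_ae_enorm_bound (Eventually.of_forall fun x => ?_)
      rw [enorm_eq_self]
      refine (tsum_enorm_mul_extensionOp_sq_le hf hK ν x).trans ?_
      gcongr
      linarith
    · refine (eLpNorm_tsum_enorm_mul_extensionOp_sq_le hN hq hf hC₂.le (fun s t ht => ?_) ν).trans ?_
      · exact hfin (hf.comp _ Subtype.val_injective) ht
      · gcongr
        linarith
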